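/- Let $\mu\ge 0$, let $B^3=\{\mathbf x\in\mathbb R^3:\|\mathbf x\|\le 1\}$ and $W_\mu(\mathbf x)=(1-\|\mathbf x\|^2)^{\mu-1/2}$. Let $\mathcal V_l^3(W_\mu)$ be the space of real polynomials of degree at most $l$ in three variables that are orthogonal, in $L^2(W_\mu;B^3)=L^2(B^3,W_\mu\,d\mathbf x)$, to all polynomials of degree less than $l$, and let $\operatorname{proj}_{l,3}^\mu$ be the orthogonal projection of $L^2(W_\mu;B^3)$ onto $\mathcal V_l^3(W_\mu)$. For $\theta\in\mathbb R$ and $t,w\in[-1,1]$ put $$\mathcal R_\theta^\mu(f;t,w)=\int_{I(\theta,w;t)} f\,W_\mu\,ds,\qquad I(\theta,w;t)=\{\mathbf x\in B^3:\ x_3=w,\ x_1\cos\theta+x_2\sin\theta=t\sqrt{1-w^2}\},$$ where $ds$ is arc length. Write $(a)_n=a(a+1)\cdots(a+n-1)$. Let $C_n^\lambda$ be the Gegenbauer polynomials and $\widetilde C_n^\lambda=C_n^\lambda\big/\sqrt{\tfrac{\lambda(2\lambda)_n}{(n+\lambda)\,n!}}$ the orthonormal ones, for the weight $(1-s^2)^{\lambda-1/2}$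 on $[-1,1]$ normalized to total mass one; let $p_n^{(\alpha,\beta)}$ be the orthonormal Jacobi polynomials (with positive leading coefficient) for the weight $(1-s)^\alpha(1+s)^\beta$ on $[-1,1]$ normalized to total mass one. For $0\le 2l\le k$ and $\varepsilon\in\{0,1\}$ define polynomials $P_{l,\varepsilon}^k$ of two variables in polar coordinates $x=r\cos\phi$, $y=r\sin\phi$ by $$P_{l,\varepsilon}^k(x,y)=h_{l,k}\,p_l^{(\mu-\frac12,\,k-2l)}(2r^2-1)\,r^{k-2l}S_{k-2l,\varepsilon}(\phi),\qquad S_{m,0}(\phi)=\cos m\phi,\quad S_{m,1}(\phi)=\sin m\phi,$$ $$h_{l,k}>0,\qquad h_{l,k}^2=\kappa_{l,k}\,\frac{\Gamma(k-2l+\mu+\frac32)}{\Gamma(\mu+\frac32)\,\Gamma(k-2l+1)},\qquad \kappa_{l,k}=\begin{cases}2,&2l<k,\\1,&2l=k;\end{cases}$$ the nonzero ones form an orthonormal basis of the orthogonal polynomials of degree $k$ on the unit disk for the normalized weight $\frac{\mu+1/2}{\pi}(1-x^2-y^2)^{\mu-1/2}$. Let $$\lambda_{l,k}^\mu=\frac{l!\,(k-l)!\,(k-l+\mu+\frac12)}{(\mu+\frac12)_l\,(\mu+\frac32)_{k-l}\,(k+\mu+\frac12)},\qquad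 D_k^{\mu+1/2}(\xi;x,y)=\sum_{0\le 2l\le k}\lambda_{l,k}^\mu\sum_{\varepsilon=0,1}P_{l,\varepsilon}^k(\cos\xi,\sin\xi)\,P_{l,\varepsilon}^k(x,y),$$ $$D_k^{\mu+1/2}(\xi,t;x,y)=\frac{k+\mu+\frac12}{\mu+\frac12}\,C_k^{\mu+1/2}(t)\,D_k^{\mu+1/2}(\xi;x,y),\qquad a_{\mu,3}=\frac{\Gamma(\mu+2)}{\pi^{3/2}\,\Gamma(\mu+\frac12)},\qquad h_k^2=\frac{(\mu+2)_k}{(\mu+\frac32)_k},$$ $$G_l(\xi,t,w;\mathbf x)=a_{\mu,3}\sum_{k=0}^l h_k^2\,D_k^{\mu+1/2}\Big(\xi,t;\tfrac{x_1}{\sqrt{1-x_3^2}},\tfrac{x_2}{\sqrt{1-x_3^2}}\Big)(1-w^2)^{k/2}(1-x_3^2)^{k/2}\,\widetilde C_{l-k}^{k+\mu+1}(w)\,\widetilde C_{l-k}^{k+\mu+1}(x_3),$$ extended continuously to $x_3=\pm1$ for $\mathbf x\in B^3$. **Proposition 4.4.** Let $n\ge 0$, $0\le l\le n$, $\xi_\nu=\nu\pi/(n+1)$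 and $f\in L^2(W_\mu;B^3)$. For every $\xi\in\mathbb R$ the integral defining $\mathcal R_\xi^\mu(f;t,w)$ converges absolutely for almost every $(t,w)\in[-1,1]^2$, and for every $\mathbf x\in B^3$ the function $\mathcal R_\xi^\mu(f;t,w)\,G_l(\xi,t,w;\mathbf x)\sqrt{1-w^2}$ is integrable in $(t,w)$ over $[-1,1]^2$. The projection $\operatorname{proj}_{l,3}^\mu f$ is (almost everywhere) equal to a polynomial, whose value at every $\mathbf x\in B^3$ is $$\begin{aligned}\operatorname{proj}_{l,3}^\mu f(\mathbf x)&=\frac1{n+1}\sum_{\nu=0}^{n}\int_{-1}^1\int_{-1}^1\mathcal R_{\xi_\nu}^\mu(f;t,w)\,G_l(\xi_\nu,t,w;\mathbf x)\,dt\,\sqrt{1-w^2}\,dw\\&=\frac1{2n+2}\sum_{\nu=0}^{2n+1}\int_{-1}^1\int_{-1}^1\mathcal R_{\xi_\nu}^\mu(f;t,w)\,G_l(\xi_\nu,t,w;\mathbf x)\,dt\,\sqrt{1-w^2}\,dw.\end{aligned}$$ -/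

import Mathlib

open MeasureTheory
open scoped Real

namespace BallRadon

noncomputable section

/-! ### Classical orthogonal polynomials of one variable -/

/-- Rising factorial `(a)_n = a (a + 1) ⋯ (a + n - 1)`. -/
def rising (a : ℝ) (n : ℕ) : ℝ := (ascPochhammer ℝ n).eval a

/-- Gegenbauer polynomial `C_n^lam (t)`, in its explicit form
`∑_{0 ≤ 2j ≤ n} (-1)^j (lam)_{n-j} / (j! (n-2j)!) (2t)^{n-2j}`. -/
def gegenbauer (n : ℕ) (lam t : ℝ) : ℝ :=
  ∑ j ∈ Finset.range (n / 2 + 1),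
    (-1) ^ j * rising lam (n - j) / ((j.factorial : ℝ) * ((n - 2 * j).factorial : ℝ)) *
      (2 * t) ^ (n - 2 * j)

/-- Square norm `h_n = lam (2 lam)_n / ((n + lam) n!)` of `C_n^lam` for the weight
`(1 - t^2)^(lam - 1/2)` on `[-1, 1]`, normalized to have total mass one. -/
def gegenbauerNormSq (n : ℕ) (lam : ℝ) : ℝ :=
  lam * rising (2 * lam) n / ((n + lam) * (n.factorial : ℝ))

/-- Orthonormal Gegenbauer polynomial `C_n^lam / √h_n`. -/
def gegenbauerON (n : ℕ) (lam t : ℝ) : ℝ :=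
  gegenbauer n lam t / √(gegenbauerNormSq n lam)

/-- Jacobi polynomial `P_n^{(α, β)}(t)`, as the terminating hypergeometric sum
`(α+1)_n / n! ∑_j (-n)_j (n+α+β+1)_j / ((α+1)_j j!) ((1-t)/2)^j`. -/
def jacobi (n : ℕ) (α β t : ℝ) : ℝ :=
  rising (α + 1) n / (n.factorial : ℝ) *
    ∑ j ∈ Finset.range (n + 1),
      rising (-(n : ℝ)) j * rising (n + α + β + 1) j /
        (rising (α + 1) j * (j.factorial : ℝ)) * ((1 - t) / 2) ^ j

/-- Square norm of `P_n^{(α, β)}` for the weight `(1 - t)^α (1 + t)^β` on `[-1, 1]`, normalized to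
have total mass one. -/
def jacobiNormSq (n : ℕ) (α β : ℝ) : ℝ :=
  rising (α + 1) n * rising (β + 1) n * (α + β + n + 1) /
    ((n.factorial : ℝ) * rising (α + β + 2) n * (α + β + 2 * n + 1))

/-- Orthonormal Jacobi polynomial `p_n^{(α, β)}(t)`. -/
def jacobiON (n : ℕ) (α β t : ℝ) : ℝ := jacobi n α β t / √(jacobiNormSq n α β)

/-! ### The orthonormal basis on the disk and the kernels -/

/-- The factor `h_{l,k} > 0` of the disk basis, given by
`h_{l,k}^2 = c Γ(k-2l+μ+3/2) / (Γ(μ+3/2) Γ(k-2l+1))` with `c = 2` if `2l < k` and `c = 1` if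
`2l = k`. -/
def diskNorm (μ : ℝ) (k l : ℕ) : ℝ :=
  √((if 2 * l < k then 2 else 1) *
    (Real.Gamma ((k - 2 * l : ℕ) + μ + 3 / 2) /
      (Real.Gamma (μ + 3 / 2) * Real.Gamma ((k - 2 * l : ℕ) + 1))))

/-- The polynomial `P_{l,ε}^k` on the disk, for `2l ≤ k`: in polar coordinates it is
`h_{l,k} p_l^{(μ-1/2, k-2l)}(2r^2-1) r^(k-2l) S(φ)` with `S(φ) = cos ((k-2l) φ)` for `ε = 0` and
`S(φ) = sin ((k-2l) φ)` for `ε = 1`. Here `r^m cos (m φ)` and `r^m sin (m φ)` are written as the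
real and the imaginary part of `(x + i y)^m`. It vanishes for `2l = k`, `ε = 1`; the other ones form
an orthonormal basis of the orthogonal polynomials of degree `k` on the disk for the weight
`(1-x^2-y^2)^(μ-1/2)`, normalized to have total mass one. -/
def diskBasis (μ : ℝ) (k l : ℕ) (ε : Fin 2) (x y : ℝ) : ℝ :=
  diskNorm μ k l * jacobiON l (μ - 1 / 2) ((k - 2 * l : ℕ) : ℝ) (2 * (x ^ 2 + y ^ 2) - 1) *
    (if ε = 0 then (((x : ℂ) + y * Complex.I) ^ (k - 2 * l)).re
      else (((x : ℂ) + y * Complex.I) ^ (k - 2 * l)).im)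

/-- `λ_{l,k}^μ = l! (k-l)! (k-l+μ+1/2) / ((μ+1/2)_l (μ+3/2)_{k-l} (k+μ+1/2))`. -/
def lamCoeff (μ : ℝ) (l k : ℕ) : ℝ :=
  (l.factorial : ℝ) * ((k - l).factorial : ℝ) * ((k - l : ℕ) + μ + 1 / 2) /
    (rising (μ + 1 / 2) l * rising (μ + 3 / 2) (k - l) * (k + μ + 1 / 2))

/-- `D_k^{μ+1/2}(ξ; x, y)`, a sum over `0 ≤ 2l ≤ k` and `ε = 0, 1`. -/
def diskKernel (μ : ℝ) (k : ℕ) (ξ x y : ℝ) : ℝ :=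
  ∑ l ∈ Finset.range (k / 2 + 1), lamCoeff μ l k *
    ∑ ε : Fin 2, diskBasis μ k l ε (Real.cos ξ) (Real.sin ξ) * diskBasis μ k l ε x y

/-- `D_k^{μ+1/2}(ξ, t; x, y)`. -/
def diskKernelT (μ : ℝ) (k : ℕ) (ξ t x y : ℝ) : ℝ :=
  (k + μ + 1 / 2) / (μ + 1 / 2) * gegenbauer k (μ + 1 / 2) t * diskKernel μ k ξ x y

/-! ### The ball, its weight, and the orthogonal projections -/

/-- Euclidean space of dimension three. -/
abbrev E3 : Type := EuclideanSpace ℝ (Fin 3)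

/-- The weight `W_μ(x) = (1 - ‖x‖^2)^(μ - 1/2)`, to be used on the closed unit ball. -/
def ballWeight (μ : ℝ) (x : E3) : ℝ := (1 - ‖x‖ ^ 2) ^ (μ - 1 / 2)

/-- The measure `W_μ(x) dx` on the closed unit ball. Its `L²` space is `L²(W_μ; B³)`. -/
def ballMeasure (μ : ℝ) : Measure E3 :=
  (volume.restrict (Metric.closedBall (0 : E3) 1)).withDensity
    (fun x => ENNReal.ofReal (ballWeight μ x))

/-- The value at `x` of a polynomial in three variables. -/
def polyEval (P : MvPolynomial (Fin 3) ℝ) (x : E3) : ℝ := MvPolynomial.eval (fun i => x i) P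

/-- Polynomials in three variables all of whose monomials have total degree `< n`. -/
def polyLT (n : ℕ) : Submodule ℝ (MvPolynomial (Fin 3) ℝ) :=
  MvPolynomial.restrictSupport ℝ {s | s.degree < n}

/-- The elements of `L²(W_μ; B³)` given by polynomials of degree `< n` (for `μ ≥ 0` the measure is
finite, so every polynomial gives one). -/
def polyL2 (μ : ℝ) (n : ℕ) : Submodule ℝ (Lp ℝ 2 (ballMeasure μ)) where
  carrier := {F | ∃ P ∈ polyLT n, F =ᵐ[ballMeasure μ] polyEval P}
  zero_mem' := by
    refine ⟨0, Submodule.zero_mem _, (Lp.coeFn_zero ℝ 2 (ballMeasure μ)).trans ?_⟩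
    exact Filter.Eventually.of_forall fun x => by simp [polyEval]
  add_mem' := by
    rintro F G ⟨P, hP, hF⟩ ⟨Q, hQ, hG⟩
    refine ⟨P + Q, Submodule.add_mem _ hP hQ, ?_⟩
    filter_upwards [hF, hG, Lp.coeFn_add F G] with x h1 h2 h3
    rw [h3, Pi.add_apply, h1, h2]
    simp [polyEval]
  smul_mem' := by
    rintro c F ⟨P, hP, hF⟩
    refine ⟨c • P, Submodule.smul_mem _ c hP, ?_⟩
    filter_upwards [hF, Lp.coeFn_smul c F] with x h1 h2
    rw [h2, Pi.smul_apply, h1]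
    simp [polyEval]

theorem finite_setOf_degree_lt (n : ℕ) : {s : Fin 3 →₀ ℕ | s.degree < n}.Finite := by
  refine Set.Finite.subset (Set.finite_Iic (Finsupp.equivFunOnFinite.symm fun _ => n)) ?_
  intro s hs i
  exact (Finsupp.le_degree i s).trans (le_of_lt hs)

instance finiteDimensional_polyLT (n : ℕ) : FiniteDimensional ℝ (polyLT n) := by
  have : Finite {s : Fin 3 →₀ ℕ | s.degree < n} := (finite_setOf_degree_lt n).to_subtype
  exact Module.Finite.of_basis
    (MvPolynomial.basisRestrictSupport ℝ {s : Fin 3 →₀ ℕ | s.degree < n})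

instance finiteDimensional_polyL2 (μ : ℝ) (n : ℕ) : FiniteDimensional ℝ (polyL2 μ n) := by
  let V : Submodule ℝ (polyLT n) :=
    { carrier := {P | MemLp (polyEval P.1) 2 (ballMeasure μ)}
      zero_mem' := by
        have h : polyEval (0 : MvPolynomial (Fin 3) ℝ) = 0 := by funext x; simp [polyEval]
        simp [h]
      add_mem' := by
        intro P Q hP hQ
        have h : polyEval (P.1 + Q.1) = polyEval P.1 + polyEval Q.1 := by
          funext x; simp [polyEval]
        simpa [h] using MemLp.add hP hQ
      smul_mem' := by
        intro c P hP
        have h : polyEval (c • P.1) = c • polyEval P.1 := by funext x; simp [polyEval]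
        simpa [h] using MemLp.const_smul hP c }
  let T : V →ₗ[ℝ] Lp ℝ 2 (ballMeasure μ) :=
    { toFun := fun P => MemLp.toLp (polyEval P.1.1) P.2
      map_add' := by
        intro P Q
        rw [← MemLp.toLp_add]
        congr 1
        funext x
        simp [polyEval]
      map_smul' := by
        intro c P
        rw [RingHom.id_apply, ← MemLp.toLp_const_smul]
        congr 1
        funext x
        simp [polyEval] }
  refine Submodule.finiteDimensional_of_le (S₂ := LinearMap.range T) ?_
  rintro F ⟨P, hP, hF⟩
  have hm : MemLp (polyEval P) 2 (ballMeasure μ) := (memLp_congr_ae hF).1 (Lp.memLp F)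
  refine ⟨⟨⟨P, hP⟩, hm⟩, ?_⟩
  refine Lp.ext ?_
  exact (MemLp.coeFn_toLp hm).trans hF.symm

/-- The space `𝒱_l³(W_μ)` as a subspace of `L²(W_μ; B³)`: polynomials of degree at most `l` that are
orthogonal to all polynomials of degree less than `l`. -/
def orthoPoly (μ : ℝ) (l : ℕ) : Submodule ℝ (Lp ℝ 2 (ballMeasure μ)) :=
  polyL2 μ (l + 1) ⊓ (polyL2 μ l)ᗮ

instance finiteDimensional_orthoPoly (μ : ℝ) (l : ℕ) : FiniteDimensional ℝ (orthoPoly μ l) :=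
  Submodule.finiteDimensional_inf_left _ _

/-- The orthogonal projection `proj_{l,3}^μ` of `L²(W_μ; B³)` onto `𝒱_l³(W_μ)`. It does not change
when the inner product is multiplied by the normalization constant of the weight. -/
def ballProj (μ : ℝ) (l : ℕ) : Lp ℝ 2 (ballMeasure μ) →L[ℝ] Lp ℝ 2 (ballMeasure μ) :=
  (orthoPoly μ l).starProjection

/-! ### Attenuated Radon projections on lines in planes `x₃ = w` -/

/-- Arc length parametrization of the line `x₃ = w`, `x₁ cos θ + x₂ sin θ = t √(1-w²)`. -/
def linePoint (θ t w s : ℝ) : E3 :=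
  !₂[t * √(1 - w ^ 2) * Real.cos θ - s * Real.sin θ,
    t * √(1 - w ^ 2) * Real.sin θ + s * Real.cos θ, w]

/-- The parameters `s` for which the point of the line lies in the closed unit ball. -/
def segment (θ t w : ℝ) : Set ℝ := {s | linePoint θ t w s ∈ Metric.closedBall (0 : E3) 1}

/-- Attenuated Radon projection `ℛ_θ^μ(f; t, w)`: the integral of `f W_μ`, with respect to arc
length, over the part of the line that lies in the ball. -/
def radon (μ : ℝ) (f : E3 → ℝ) (θ t w : ℝ) : ℝ :=
  ∫ s in segment θ t w, f (linePoint θ t w s) * ballWeight μ (linePoint θ t w s)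

/-- Normalization constant `a_{μ,3}` of the weight on the ball. -/
def ballConst (μ : ℝ) : ℝ := Real.Gamma (μ + 2) / (π ^ (3 / 2 : ℝ) * Real.Gamma (μ + 1 / 2))

/-- The kernel `G_l(ξ, t, w; x)`. Where `x₃ = ±1` (so `x₁ = x₂ = 0` on the ball) the terms with
`k ≥ 1` are zero and the term with `k = 0` does not depend on the quotients: this is the continuous
extension. -/
def kernelG (μ : ℝ) (l : ℕ) (ξ t w : ℝ) (x : E3) : ℝ :=
  ballConst μ * ∑ k ∈ Finset.range (l + 1),
    rising (μ + 2) k / rising (μ + 3 / 2) k *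
      diskKernelT μ k ξ t (x 0 / √(1 - x 2 ^ 2)) (x 1 / √(1 - x 2 ^ 2)) *
      √(1 - w ^ 2) ^ k * √(1 - x 2 ^ 2) ^ k *
      gegenbauerON (l - k) (k + μ + 1) w * gegenbauerON (l - k) (k + μ + 1) (x 2)

/-- The integrand of the double integral: `ℛ_ξ^μ(f; t, w) G_l(ξ, t, w; x) √(1-w²)`. -/
def radonIntegrand (μ : ℝ) (l : ℕ) (f : E3 → ℝ) (ξ : ℝ) (x : E3) (t w : ℝ) : ℝ :=
  radon μ f ξ t w * kernelG μ l ξ t w x * √(1 - w ^ 2)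

end

end BallRadon

open BallRadon

namespace BallRadon

open Polynomial

/-! ### Rising factorials -/

/-! Write r² = 1 - x₃² and, for a direction η, F_{k,η}(x) = C_{l-k}^{k+μ+1}(x₃) r^k C_k^{μ+1/2}((x₁
cos η + x₂ sin η)/r), a polynomial of degree at most l (`ridgePoly`). The proof tests the formula on
these functions.

They span 𝒱_l. Powers of linear forms span the binary forms, and F_{k,η} has top degree part
triangular in the products (x₁ cos η + x₂ sin η)^k x₃^{l-k}; so the F_{k,η} span all polynomials of
degree at most l modulo lower degree (`polyLT_succ_le`). They are also orthogonal to every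
polynomial of lower degree (`integral_ridgePoly_mul_ridge_pow`), hence each element of 𝒱_l is a
combination of them (`exists_mem_ridgeSpan`).

The double integral is an integral over the ball. For a fixed ξ use coordinates (t, w, u), where u
runs over [-1, 1] along the chord. The weight splits into three ultraspherical weights because 1 -
‖x‖² = (1-t²)(1-w²)(1-u²) (`measurePreserving_ballCoord`), and the Radon projection is an integral
in u (`radon_eq`). The kernel does not depend on u: as a function on the ball it is a combination of
the F_{k,ξ}, k ≤ l (`kernelG_eq`). So the double integral is the pairing of f with an element of
𝒱_l, and f may be replaced by its projection P (`exists_ballProj_eq`).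

By linearity one may take P = F_{k,η}. In coordinates adapted to ξ the pairing of F_{k,η} with
F_{k',ξ} is an integral in w times an integral in t of C_{k'}^{μ+1/2} against the average of a ridge
polynomial over chords. That average is a polynomial in t of degree at most k, so the pairing
vanishes for k < k', and for k > k' by symmetry. For k = k' only the leading coefficient matters; by
the Laplace-type formula it is a multiple of C_k^{μ+1/2}(cos(ξ-η))
(`wInt_gegenPoly_mul_chordAvg_self`). The normalizing constants cancel (`ballConst_mul`).

What remains is a finite identity (`sum_diskKernel_mul_gegenbauer`): the average over ξ_ν of
D_k(ξ_ν; x, y) C_k^{μ+1/2}(cos(ξ_ν-η)) is C_k^{μ+1/2}(x cos η + y sin η). Both factors are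
trigonometric polynomials in ξ_ν with frequencies at most k and of the parity of k, so the product
has only even frequencies 2d with d ≤ k ≤ n. The nodes νπ/(n+1) annihilate all of them except d = 0,
and the weights λ are exactly those that make the surviving terms rebuild the ridge function. -/

theorem rising_zero (a : ℝ) : rising a 0 = 1 := by simp [rising]

theorem rising_succ (a : ℝ) (n : ℕ) : rising a (n + 1) = rising a n * (a + n) := by
  simp [rising, ascPochhammer_succ_eval]

theorem rising_add (a : ℝ) (m n : ℕ) : rising a (m + n) = rising a m * rising (a + m) n := by
  induction n with
  | zero => simp [rising_zero]
  | succ n ih => rw [← add_assoc, rising_succ, ih, rising_succ]; push_cast; ring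

theorem rising_succ_left (a : ℝ) (n : ℕ) : rising a (n + 1) = a * rising (a + 1) n := by
  rw [add_comm n 1, rising_add]; simp [rising_succ, rising_zero]

theorem rising_pos {a : ℝ} (ha : 0 < a) (n : ℕ) : 0 < rising a n := ascPochhammer_pos n a ha

theorem rising_one (n : ℕ) : rising 1 n = n.factorial := by
  induction n with
  | zero => simp [rising_zero]
  | succ n ih => rw [rising_succ, ih, Nat.factorial_succ]; push_cast; ring

theorem rising_nat_add_one (m n : ℕ) :
    (m.factorial : ℝ) * rising (m + 1) n = ((m + n).factorial : ℝ) := by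
  rw [← rising_one, ← rising_one, rising_add, add_comm (m : ℝ) 1]

/-- `(-M)_j = (-1)^j M! / (M - j)!`. -/
theorem rising_neg_nat {M j : ℕ} (h : j ≤ M) :
    rising (-(M : ℝ)) j = (-1) ^ j * (M.factorial : ℝ) / ((M - j).factorial : ℝ) := by
  obtain ⟨d, rfl⟩ := Nat.exists_eq_add_of_le h
  rw [Nat.add_sub_cancel_left]
  induction j generalizing d with
  | zero =>
    have : (d.factorial : ℝ) ≠ 0 := by positivity
    simp [rising_zero, this]
  | succ j ih =>
    have h1 := ih (d + 1) (by omega)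
    have e : j + 1 + d = j + (d + 1) := by ring
    rw [rising_succ, e, h1, Nat.factorial_succ d]
    have : (d.factorial : ℝ) ≠ 0 := by positivity
    push_cast
    field_simp
    ring

/-- Chu–Vandermonde for rising factorials. -/
theorem rising_vandermonde (a b : ℝ) (N : ℕ) :
    ∑ j ∈ Finset.range (N + 1), (N.choose j : ℝ) * rising a (N - j) * rising b j
      = rising (a + b) N := by
  induction N generalizing a b with
  | zero => simp [rising_zero]
  | succ N ih =>
    -- The first factor a + b is split into a and b, parallel to Pascal's rule for the binomial
    -- coefficients.
    have h1 : rising (a + b) (N + 1) =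
        a * rising (a + 1 + b) N + b * rising (a + (b + 1)) N := by
      rw [rising_succ_left, show a + b + 1 = a + 1 + b by ring,
        show a + (b + 1) = a + 1 + b by ring]
      ring
    rw [h1, ← ih, ← ih, Finset.sum_range_succ', Finset.mul_sum, Finset.mul_sum,
      Finset.sum_range_succ' (fun j => a * ((N.choose j : ℝ) * rising (a + 1) (N - j) * rising b j))]
    have h2 : ∀ j ∈ Finset.range (N + 1),
        (((N + 1).choose (j + 1) : ℕ) : ℝ) * rising a (N + 1 - (j + 1)) * rising b (j + 1) =
        b * ((N.choose j : ℝ) * rising a (N - j) * rising (b + 1) j) +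
        (N.choose (j + 1) : ℝ) * rising a (N - j) * rising b (j + 1) := by
      intro j _
      rw [Nat.choose_succ_succ, Nat.add_sub_add_right, rising_succ_left b j]
      push_cast
      ring
    rw [Finset.sum_congr rfl h2, Finset.sum_add_distrib,
      Finset.sum_range_succ (fun j => (N.choose (j + 1) : ℝ) * rising a (N - j) * rising b (j + 1))]
    have h3 : ∀ j ∈ Finset.range N,
        (N.choose (j + 1) : ℝ) * rising a (N - j) * rising b (j + 1) =
        a * ((N.choose (j + 1) : ℝ) * rising (a + 1) (N - (j + 1)) * rising b (j + 1)) := by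
      intro j hj
      rw [Finset.mem_range] at hj
      rw [show N - j = (N - (j + 1)) + 1 by omega, rising_succ_left]
      ring
    rw [Finset.sum_congr rfl h3]
    simp [rising_zero, rising_succ_left]
    ring

/-! ### Sums over `p + 2 j = n` -/

/-- The sum of `h p j` over all `p + 2 j = n`. -/
def diagSum {M : Type*} [AddCommMonoid M] (n : ℕ) (h : ℕ → ℕ → M) : M :=
  ∑ j ∈ Finset.range (n / 2 + 1), h (n - 2 * j) j

section diagSum
variable {M : Type*} [AddCommMonoid M]

theorem diagSum_congr {n : ℕ} {h h' : ℕ → ℕ → M} (H : ∀ p j, p + 2 * j = n → h p j = h' p j) :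
    diagSum n h = diagSum n h' := by
  refine Finset.sum_congr rfl fun j hj => H _ _ ?_
  rw [Finset.mem_range] at hj
  omega

theorem diagSum_add (n : ℕ) (h h' : ℕ → ℕ → M) :
    diagSum n (fun p j => h p j + h' p j) = diagSum n h + diagSum n h' :=
  Finset.sum_add_distrib

theorem diagSum_zero (h : ℕ → ℕ → M) : diagSum 0 h = h 0 0 := by simp [diagSum]

theorem diagSum_one (h : ℕ → ℕ → M) : diagSum 1 h = h 1 0 := by simp [diagSum]

/-- This shift in p and the shift in j of `diagSum_add_two` bring polynomials of neighbouring
degrees to one common sum, so that recurrences reduce to identities between coefficients. -/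
theorem diagSum_succ {n : ℕ} {h : ℕ → ℕ → M} (h0 : ∀ j, h 0 j = 0) :
    diagSum (n + 1) h = diagSum n (fun p j => h (p + 1) j) := by
  unfold diagSum
  rcases Nat.even_or_odd' n with ⟨q, rfl | rfl⟩
  · rw [show (2 * q + 1) / 2 = q by omega, show 2 * q / 2 = q by omega]
    refine Finset.sum_congr rfl fun j hj => ?_
    rw [Finset.mem_range] at hj
    rw [show 2 * q + 1 - 2 * j = 2 * q - 2 * j + 1 by omega]
  · rw [show (2 * q + 1 + 1) / 2 = q + 1 by omega, show (2 * q + 1) / 2 = q by omega,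
      Finset.sum_range_succ, show 2 * q + 1 + 1 - 2 * (q + 1) = 0 by omega, h0, add_zero]
    refine Finset.sum_congr rfl fun j hj => ?_
    rw [Finset.mem_range] at hj
    rw [show 2 * q + 1 + 1 - 2 * j = 2 * q + 1 - 2 * j + 1 by omega]

theorem diagSum_add_two {n : ℕ} {h : ℕ → ℕ → M} (h0 : ∀ p, h p 0 = 0) :
    diagSum (n + 2) h = diagSum n (fun p j => h p (j + 1)) := by
  unfold diagSum
  rw [show (n + 2) / 2 = n / 2 + 1 by omega, Finset.sum_range_succ', h0, add_zero]
  refine Finset.sum_congr rfl fun j hj => ?_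
  rw [show n + 2 - 2 * (j + 1) = n - 2 * j by omega]

theorem map_diagSum {M' F : Type*} [AddCommMonoid M'] [FunLike F M M'] [AddMonoidHomClass F M M']
    (φ : F) (n : ℕ) (h : ℕ → ℕ → M) :
    φ (diagSum n h) = diagSum n (fun p j => φ (h p j)) := by
  simp [diagSum, map_sum]

theorem mul_diagSum {R : Type*} [NonUnitalNonAssocSemiring R] (n : ℕ) (c : R) (h : ℕ → ℕ → R) :
    c * diagSum n h = diagSum n (fun p j => c * h p j) := Finset.mul_sum _ _ _

end diagSum

/-! ### Gegenbauer polynomials -/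

/-- The coefficient of `(2t)^p` in `C_{p + 2j}^lam (t)`. -/
noncomputable def gegenCoeff (lam : ℝ) (p j : ℕ) : ℝ :=
  (-1) ^ j * rising lam (p + j) / ((j.factorial : ℝ) * (p.factorial : ℝ))

theorem gegenbauer_eq_diagSum (n : ℕ) (lam t : ℝ) :
    gegenbauer n lam t = diagSum n (fun p j => gegenCoeff lam p j * (2 * t) ^ p) := by
  refine Finset.sum_congr rfl fun j hj => ?_
  rw [Finset.mem_range] at hj
  simp only [gegenCoeff]
  rw [show n - 2 * j + j = n - j by omega]

theorem gegenCoeff_succ_left (lam : ℝ) (p j : ℕ) :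
    (p + 1) * gegenCoeff lam (p + 1) j = (lam + p + j) * gegenCoeff lam p j := by
  unfold gegenCoeff
  rw [show p + 1 + j = p + j + 1 by ring, rising_succ, Nat.factorial_succ]
  have := Nat.cast_ne_zero (R := ℝ).2 (Nat.factorial_ne_zero p)
  have := Nat.cast_ne_zero (R := ℝ).2 (Nat.factorial_ne_zero j)
  push_cast
  field_simp
  ring

theorem gegenCoeff_succ_right (lam : ℝ) (p j : ℕ) :
    (j + 1) * gegenCoeff lam p (j + 1) = -(lam + p + j) * gegenCoeff lam p j := by
  unfold gegenCoeff
  rw [← add_assoc, rising_succ, Nat.factorial_succ]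
  have := Nat.cast_ne_zero (R := ℝ).2 (Nat.factorial_ne_zero p)
  have := Nat.cast_ne_zero (R := ℝ).2 (Nat.factorial_ne_zero j)
  push_cast
  field_simp
  ring

theorem gegenCoeff_succ_left' (lam : ℝ) (p j : ℕ) :
    (p + 1) * gegenCoeff lam (p + 1) j = lam * gegenCoeff (lam + 1) p j := by
  unfold gegenCoeff
  rw [show p + 1 + j = p + j + 1 by ring, rising_succ_left, Nat.factorial_succ]
  have := Nat.cast_ne_zero (R := ℝ).2 (Nat.factorial_ne_zero p)
  have := Nat.cast_ne_zero (R := ℝ).2 (Nat.factorial_ne_zero j)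
  push_cast
  field_simp

theorem gegenCoeff_succ_right' (lam : ℝ) (p j : ℕ) :
    (j + 1) * gegenCoeff lam p (j + 1) = -(lam * gegenCoeff (lam + 1) p j) := by
  unfold gegenCoeff
  rw [← add_assoc, rising_succ_left, Nat.factorial_succ]
  have := Nat.cast_ne_zero (R := ℝ).2 (Nat.factorial_ne_zero p)
  have := Nat.cast_ne_zero (R := ℝ).2 (Nat.factorial_ne_zero j)
  push_cast
  field_simp
  ring

theorem gegenbauer_zero (lam t : ℝ) : gegenbauer 0 lam t = 1 := by
  simp [gegenbauer_eq_diagSum, diagSum_zero, gegenCoeff, rising_zero]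

theorem gegenbauer_one (lam t : ℝ) : gegenbauer 1 lam t = 2 * lam * t := by
  simp [gegenbauer_eq_diagSum, diagSum_one, gegenCoeff, rising_succ, rising_zero]; ring

theorem gegenbauer_recurrence (n : ℕ) (lam t : ℝ) :
    (n + 2) * gegenbauer (n + 2) lam t =
      2 * (n + 1 + lam) * t * gegenbauer (n + 1) lam t
        - (n + 2 * lam) * gegenbauer n lam t := by
  simp only [gegenbauer_eq_diagSum]
  have h1 : 2 * (n + 1 + lam) * t *
        diagSum (n + 1) (fun p j => gegenCoeff lam p j * (2 * t) ^ p) =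
      diagSum (n + 2) (fun p j => if p = 0 then 0 else
        (n + 1 + lam) * (gegenCoeff lam (p - 1) j * (2 * t) ^ p)) := by
    rw [show n + 2 = n + 1 + 1 by ring, diagSum_succ (n := n + 1) (by simp), mul_diagSum]
    refine diagSum_congr fun p j _ => ?_
    simp only [Nat.add_eq_zero_iff, one_ne_zero, and_false, if_false, Nat.add_sub_cancel]
    ring
  have h2 : (n + 2 * lam) * diagSum n (fun p j => gegenCoeff lam p j * (2 * t) ^ p) =
      diagSum (n + 2) (fun p j => if j = 0 then 0 else
        (n + 2 * lam) * (gegenCoeff lam p (j - 1) * (2 * t) ^ p)) := by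
    rw [diagSum_add_two (by simp), mul_diagSum]
    refine diagSum_congr fun p j _ => ?_
    simp
  rw [h1, h2, eq_sub_iff_add_eq, mul_diagSum, ← diagSum_add]
  refine diagSum_congr fun p j hpj => ?_
  have hn : (n : ℝ) = p + 2 * j - 2 := by
    have : (p : ℝ) + 2 * j = n + 2 := by exact_mod_cast hpj
    linarith
  -- For p = 0 or j = 0 one of the two shifted sums contributes nothing; p = j = 0 cannot occur
  -- since p + 2j = n + 2.
  rcases p with _ | p <;> rcases j with _ | j
  · omega
  · have := gegenCoeff_succ_right lam 0 j
    simp [hn] at this ⊢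
    linear_combination 2 * this
  · have := gegenCoeff_succ_left lam p 0
    simp [hn] at this ⊢
    linear_combination (2 * t) ^ (p + 1) * this
  · have hp : (p + 1 : ℝ) ≠ 0 := by positivity
    have hj : (j + 1 : ℝ) ≠ 0 := by positivity
    have a1 := eq_div_of_mul_eq hp ((mul_comm _ _).trans (gegenCoeff_succ_left lam p j))
    have a2 := eq_div_of_mul_eq hj ((mul_comm _ _).trans (gegenCoeff_succ_right lam p j))
    have a3 := eq_div_of_mul_eq hj ((mul_comm _ _).trans (gegenCoeff_succ_right lam (p + 1) j))
    simp only [Nat.add_eq_zero_iff, one_ne_zero, and_false, if_false, Nat.add_sub_cancel]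
    rw [a3, a2, a1, hn]
    push_cast
    field_simp
    ring

/-! ### The Laplace-type representation -/

/-- The homogeneous form of the trigonometric representation of `C_n^lam / (2 lam)_n`. -/
noncomputable def laplaceSum (n : ℕ) (lam c s : ℝ) : ℝ :=
  diagSum n (fun p j => (-1) ^ j / ((p.factorial : ℝ) * 4 ^ j * j.factorial * rising (lam + 1 / 2) j)
    * c ^ p * s ^ j)

/-- Up to n!, `laplaceSum` is the mean of (c + i u √s)^n for the weight (1-u²)^{lam-1}. The
relations `e1` and `e2` between neighbouring coefficients turn multiplication by c, c² or s into
multiplication of the terms by polynomials in p and j; with n + 2 = p + 2j the rest is algebra. -/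
theorem laplaceSum_recurrence (n : ℕ) {lam : ℝ} (hlam : 0 < lam) (c s : ℝ) :
    (2 * lam + n + 1) * (n + 2) * laplaceSum (n + 2) lam c s =
      2 * (n + 1 + lam) * c * laplaceSum (n + 1) lam c s - (c ^ 2 + s) * laplaceSum n lam c s := by
  unfold laplaceSum
  set e : ℕ → ℕ → ℝ := fun p j =>
    (-1) ^ j / ((p.factorial : ℝ) * 4 ^ j * j.factorial * rising (lam + 1 / 2) j) with he
  have e1 : ∀ p j, e p j = (p + 1) * e (p + 1) j := by
    intro p j
    have := (rising_pos (show 0 < lam + 1 / 2 by linarith) j).ne'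
    simp only [he, Nat.factorial_succ]
    push_cast
    field_simp
  have e2 : ∀ p j, e p j = - (4 * (j + 1) * (lam + j + 1 / 2)) * e p (j + 1) := by
    intro p j
    have := (rising_pos (show 0 < lam + 1 / 2 by linarith) j).ne'
    have h2 : lam + 1 / 2 + j ≠ 0 := by positivity
    simp only [he, Nat.factorial_succ, rising_succ]
    push_cast
    field_simp
    ring
  have h1 : 2 * (n + 1 + lam) * c * diagSum (n + 1) (fun p j => e p j * c ^ p * s ^ j) =
      diagSum (n + 2) (fun p j => 2 * (n + 1 + lam) * p * (e p j * c ^ p * s ^ j)) := by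
    rw [show n + 2 = n + 1 + 1 by ring, diagSum_succ (n := n + 1) (by simp), mul_diagSum]
    refine diagSum_congr fun p j _ => ?_
    rw [e1 p j]; push_cast; ring
  have h2 : c ^ 2 * diagSum n (fun p j => e p j * c ^ p * s ^ j) =
      diagSum (n + 2) (fun p j => p * (p - 1) * (e p j * c ^ p * s ^ j)) := by
    rw [show n + 2 = n + 1 + 1 by ring, diagSum_succ (n := n + 1) (by simp),
      diagSum_succ (n := n) (by simp), mul_diagSum]
    refine diagSum_congr fun p j _ => ?_
    rw [e1 p j, e1 (p + 1) j]; push_cast; ring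
  have h3 : s * diagSum n (fun p j => e p j * c ^ p * s ^ j) =
      diagSum (n + 2) (fun p j => -(4 * j * (lam + j - 1 / 2)) * (e p j * c ^ p * s ^ j)) := by
    rw [diagSum_add_two (by simp), mul_diagSum]
    refine diagSum_congr fun p j _ => ?_
    rw [e2 p j]; push_cast; ring
  change (2 * lam + n + 1) * (n + 2) * diagSum (n + 2) (fun p j => e p j * c ^ p * s ^ j) =
    2 * (n + 1 + lam) * c * diagSum (n + 1) (fun p j => e p j * c ^ p * s ^ j)
      - (c ^ 2 + s) * diagSum n (fun p j => e p j * c ^ p * s ^ j)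
  rw [h1, add_mul (c ^ 2) s, h2, h3, eq_sub_iff_add_eq, mul_diagSum, ← diagSum_add, ← diagSum_add]
  refine diagSum_congr fun p j hpj => ?_
  have hn : (n : ℝ) = p + 2 * j - 2 := by
    have : (p : ℝ) + 2 * j = n + 2 := by exact_mod_cast hpj
    linarith
  rw [hn]
  ring

/-- For s = 1 - c² the factor c² + s of the recurrence is 1, and after scaling by (2 lam)_n it
becomes the Gegenbauer recurrence; the values for n = 0, 1 agree. -/
theorem gegenbauer_eq_laplaceSum {lam : ℝ} (hlam : 0 < lam) (c : ℝ) (n : ℕ) :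
    gegenbauer n lam c = rising (2 * lam) n * laplaceSum n lam c (1 - c ^ 2) := by
  induction n using Nat.strong_induction_on with
  | _ n ih =>
    match n, ih with
    | 0, _ => simp [gegenbauer_zero, rising_zero, laplaceSum, diagSum_zero]
    | 1, _ => simp [gegenbauer_one, rising_zero, rising_succ, laplaceSum, diagSum_one]
    | n + 2, ih =>
      have h1 := gegenbauer_recurrence n lam c
      have h2 := laplaceSum_recurrence n hlam c (1 - c ^ 2)
      rw [ih n (by omega), ih (n + 1) (by omega)] at h1
      have hn : (n + 2 : ℝ) ≠ 0 := by positivity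
      apply mul_left_cancel₀ hn
      rw [h1, rising_succ _ (n + 1), rising_succ _ n]
      push_cast
      linear_combination (-(rising (2 * lam) n * (2 * lam + n))) * h2

/-! ### Gegenbauer polynomials as elements of the polynomial ring -/

/-- The Gegenbauer polynomial as an element of `ℝ[X]`. -/
noncomputable def gegenPoly (n : ℕ) (lam : ℝ) : ℝ[X] :=
  diagSum n (fun p j => C (gegenCoeff lam p j * 2 ^ p) * X ^ p)


theorem eval_gegenPoly (n : ℕ) (lam t : ℝ) : (gegenPoly n lam).eval t = gegenbauer n lam t := by
  rw [gegenbauer_eq_diagSum, gegenPoly, ← coe_evalRingHom, map_diagSum]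
  refine diagSum_congr fun p j _ => ?_
  rw [coe_evalRingHom, eval_mul, eval_C, eval_pow, eval_X, mul_pow]
  ring

theorem natDegree_gegenPoly_le (n : ℕ) (lam : ℝ) : (gegenPoly n lam).natDegree ≤ n := by
  unfold gegenPoly diagSum
  exact natDegree_sum_le_of_forall_le _ _ fun j _ =>
    (natDegree_C_mul_X_pow_le _ _).trans (Nat.sub_le _ _)

theorem coeff_gegenPoly_self (n : ℕ) (lam : ℝ) :
    (gegenPoly n lam).coeff n = 2 ^ n * rising lam n / n.factorial := by
  unfold gegenPoly diagSum
  rw [finsetSum_coeff, Finset.sum_eq_single 0]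
  · rw [coeff_C_mul, Nat.mul_zero, Nat.sub_zero, coeff_X_pow, if_pos rfl]
    simp [gegenCoeff]
    ring
  · intro j hj h0
    rw [coeff_C_mul, coeff_X_pow, if_neg, mul_zero]
    rw [Finset.mem_range] at hj
    omega
  · simp

theorem gegenPoly_neg (n : ℕ) (lam t : ℝ) :
    gegenbauer n lam (-t) = (-1) ^ n * gegenbauer n lam t := by
  simp only [gegenbauer_eq_diagSum]
  rw [mul_diagSum]
  refine diagSum_congr fun p j hpj => ?_
  rw [← hpj, pow_add, pow_mul, show 2 * -t = -1 * (2 * t) by ring, mul_pow]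
  simp
  ring

/-- The derivative identity behind the Rodrigues formula. -/
theorem gegenPoly_derivative {lam : ℝ} (hlam : lam ≠ 0) (n : ℕ) :
    (1 - X ^ 2) * derivative (gegenPoly n (lam + 1)) - C (2 * lam + 1) * X * gegenPoly n (lam + 1) =
      C (-((n + 1) * (n + 1 + 2 * lam) / (2 * lam))) * gegenPoly (n + 1) lam := by
  set c : ℕ → ℕ → ℝ := fun p j => gegenCoeff (lam + 1) p j * 2 ^ p with hc
  set d : ℕ → ℕ → ℝ := fun p j => gegenCoeff lam p j * 2 ^ p / lam with hd
  have e1 : ∀ p j, c p j = (p + 1) * d (p + 1) j / 2 := by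
    intro p j
    have := gegenCoeff_succ_left' lam p j
    simp only [hc, hd]
    field_simp
    rw [pow_succ]
    linear_combination -(2 ^ p * 2) * this
  have e2 : ∀ p j, (p + 1) * c (p + 1) j = - 2 * (j + 1) * (lam + p + (j + 1)) * d p (j + 1) := by
    intro p j
    have h1 := gegenCoeff_succ_right' lam p j
    have h2 := gegenCoeff_succ_left (lam + 1) p j
    simp only [hc, hd]
    field_simp
    rw [pow_succ]
    linear_combination (2 ^ p * 2) * lam * h2 + 2 ^ p * 2 * (lam + p + (j + 1)) * h1
  have hd' : gegenPoly (n + 1) lam = diagSum (n + 1) (fun p j => C lam * C (d p j) * X ^ p) := by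
    refine diagSum_congr fun p j _ => ?_
    rw [← C_mul]; congr 2; simp only [hd]; field_simp
  have hX : X * gegenPoly n (lam + 1) =
      diagSum (n + 1) (fun p j => C (p * d p j / 2) * X ^ p) := by
    rw [diagSum_succ (by simp), gegenPoly, mul_diagSum]
    refine diagSum_congr fun p j _ => ?_
    have := e1 p j
    simp only [hc] at this
    rw [this]; push_cast; ring
  have hX2 : X ^ 2 * derivative (gegenPoly n (lam + 1)) =
      diagSum (n + 1) (fun p j => C (p * (p - 1) * d p j / 2) * X ^ p) := by
    rw [diagSum_succ (by simp), gegenPoly, map_diagSum, mul_diagSum]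
    refine diagSum_congr fun p j _ => ?_
    have := e1 p j
    simp only [hc] at this
    rw [this, derivative_C_mul_X_pow]
    rcases p with _ | p
    · simp
    · simp only [Nat.add_sub_cancel]
      push_cast
      rw [show C (((p : ℝ) + 1 + 1) * d (p + 1 + 1) j / 2 * (p + 1)) = C (((p : ℝ) + 1 + 1) *
        (p + 1 + 1 - 1) * d (p + 1 + 1) j / 2) by congr 1; ring]
      ring
  have hD : derivative (gegenPoly n (lam + 1)) =
      diagSum (n + 1) (fun p j => C (-2 * j * (lam + p + j) * d p j) * X ^ p) := by
    rcases n with _ | n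
    · simp [diagSum_one, gegenPoly, diagSum_zero]
    rw [diagSum_add_two (by simp), gegenPoly, map_diagSum, diagSum_succ (by simp)]
    refine diagSum_congr fun p j _ => ?_
    have := e2 p j
    simp only [hc] at this
    rw [derivative_C_mul_X_pow, Nat.add_sub_cancel]
    congr 2
    push_cast
    rw [mul_comm, this]
  rw [sub_mul, one_mul, hX2, hD, mul_assoc, hX, hd', mul_diagSum, mul_diagSum,
    sub_sub, sub_eq_iff_eq_add, ← diagSum_add, ← diagSum_add]
  refine diagSum_congr fun p j hpj => ?_
  have hn : (n : ℝ) = p + 2 * j - 1 := by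
    have : (p : ℝ) + 2 * j = n + 1 := by exact_mod_cast hpj
    linarith
  simp only [← mul_assoc, ← C_mul, ← add_mul, ← C_add]
  congr 2
  rw [hn]
  field_simp
  ring

/-! ### The expansion of a Gegenbauer ridge function -/

/-- Expanding s^{l-j} in powers of 1 - s and exchanging the sums leaves an inner sum over j that
Chu–Vandermonde evaluates; the outer sum is then the hypergeometric form of the Jacobi polynomial.
-/
theorem sum_eq_jacobi {lam : ℝ} (hlam : 0 < lam) (l m : ℕ) (s : ℝ) :
    ∑ j ∈ Finset.range (l + 1), (-1) ^ j * rising lam (2 * l + m - j) /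
        ((j.factorial : ℝ) * ((l - j).factorial : ℝ) * ((l + m - j).factorial : ℝ)) * s ^ (l - j) =
      rising lam (l + m) / ((l + m).factorial : ℝ) * jacobi l (lam - 1) m (2 * s - 1) := by
  have h1 : ∀ j, s ^ (l - j) = ∑ i ∈ Finset.range (l - j + 1),
      (-(1 - s)) ^ i * ((l - j).choose i : ℝ) := by
    intro j
    conv_lhs => rw [show s = -(1 - s) + 1 by ring, add_pow]
    simp
  simp_rw [h1, Finset.mul_sum]
  rw [Finset.sum_comm' (s' := fun i => Finset.range (l - i + 1)) (t' := Finset.range (l + 1))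
    (by intro j i; simp only [Finset.mem_range]; omega)]
  unfold jacobi
  rw [Finset.mul_sum, Finset.mul_sum]
  refine Finset.sum_congr rfl fun i hi => ?_
  have hil : i ≤ l := Nat.lt_succ_iff.1 (Finset.mem_range.1 hi)
  have h2 : ∀ j ∈ Finset.range (l - i + 1), (-1) ^ j * rising lam (2 * l + m - j) /
        ((j.factorial : ℝ) * ((l - j).factorial : ℝ) * ((l + m - j).factorial : ℝ)) *
        ((-(1 - s)) ^ i * ((l - j).choose i : ℝ)) =
      (-(1 - s)) ^ i * rising lam (l + m + i) / ((i.factorial : ℝ) * ((l - i).factorial : ℝ) *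
        ((l + m).factorial : ℝ)) * (((l - i).choose j : ℝ) *
        rising (lam + (l + m + i : ℕ)) (l - i - j) * rising (-((l + m : ℕ) : ℝ)) j) := by
    intro j hj
    have hj' : j ≤ l - i := Nat.lt_succ_iff.1 (Finset.mem_range.1 hj)
    rw [show 2 * l + m - j = l + m + i + (l - i - j) by omega, rising_add lam (l + m + i),
      rising_neg_nat (show j ≤ l + m by omega), Nat.cast_choose ℝ (show i ≤ l - j by omega),
      Nat.cast_choose ℝ hj', show l - j - i = l - i - j by omega]
    have := Nat.cast_ne_zero (R := ℝ).2 (Nat.factorial_ne_zero (l - j))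
    have := Nat.cast_ne_zero (R := ℝ).2 (Nat.factorial_ne_zero (l - i))
    have := Nat.cast_ne_zero (R := ℝ).2 (Nat.factorial_ne_zero (l - i - j))
    have := Nat.cast_ne_zero (R := ℝ).2 (Nat.factorial_ne_zero (l + m))
    have := Nat.cast_ne_zero (R := ℝ).2 (Nat.factorial_ne_zero (l + m - j))
    have := Nat.cast_ne_zero (R := ℝ).2 (Nat.factorial_ne_zero i)
    have := Nat.cast_ne_zero (R := ℝ).2 (Nat.factorial_ne_zero j)
    field_simp
  rw [Finset.sum_congr rfl h2, ← Finset.mul_sum, rising_vandermonde]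
  have e1 : lam + ((l + m + i : ℕ) : ℝ) + -((l + m : ℕ) : ℝ) = lam + i := by push_cast; ring
  have e2 : rising lam l = rising lam i * rising (lam + i) (l - i) := by
    rw [← rising_add, Nat.add_sub_cancel' hil]
  have e3 : (l : ℝ) + (lam - 1) + m + 1 = lam + (l + m : ℕ) := by push_cast; ring
  rw [e1, sub_add_cancel, e2, e3, rising_neg_nat hil, rising_add lam (l + m),
    show (1 - (2 * s - 1)) / 2 = 1 - s by ring, neg_pow]
  have := (rising_pos hlam i).ne'
  have := Nat.cast_ne_zero (R := ℝ).2 (Nat.factorial_ne_zero (l - i))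
  have := Nat.cast_ne_zero (R := ℝ).2 (Nat.factorial_ne_zero l)
  have := Nat.cast_ne_zero (R := ℝ).2 (Nat.factorial_ne_zero (l + m))
  have := Nat.cast_ne_zero (R := ℝ).2 (Nat.factorial_ne_zero i)
  field_simp

theorem sum_range_succ_symm (k : ℕ) (h : ℕ → ℝ) (hsymm : ∀ b ≤ k, h (k - b) = h b) :
    ∑ b ∈ Finset.range (k + 1), h b =
      ∑ l ∈ Finset.range (k / 2 + 1), (if 2 * l < k then 2 else 1) * h l := by
  rcases Nat.even_or_odd' k with ⟨q, rfl | rfl⟩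
  · rw [show 2 * q / 2 = q by omega, Finset.sum_range_succ _ q, if_neg (by omega),
      show 2 * q + 1 = q + (1 + q) by ring, Finset.sum_range_add, Finset.sum_range_add]
    have h1 : ∑ x ∈ Finset.range q, h (q + (1 + x)) = ∑ x ∈ Finset.range q, h x := by
      rw [← Finset.sum_range_reflect h q]
      refine Finset.sum_congr rfl fun x hx => ?_
      rw [Finset.mem_range] at hx
      rw [← hsymm (q - 1 - x) (by omega)]
      congr 1
      omega
    have h2 : ∑ x ∈ Finset.range q, (if 2 * x < 2 * q then 2 else 1) * h x =
        ∑ x ∈ Finset.range q, 2 * h x := by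
      refine Finset.sum_congr rfl fun x hx => ?_
      rw [Finset.mem_range] at hx
      rw [if_pos (by omega)]
    rw [h1, h2, ← Finset.mul_sum]
    simp
    ring
  · rw [show (2 * q + 1) / 2 = q by omega,
      show 2 * q + 1 + 1 = (q + 1) + (q + 1) by ring, Finset.sum_range_add]
    have h1 : ∑ x ∈ Finset.range (q + 1), h (q + 1 + x) = ∑ x ∈ Finset.range (q + 1), h x := by
      rw [← Finset.sum_range_reflect h (q + 1)]
      refine Finset.sum_congr rfl fun x hx => ?_
      rw [Finset.mem_range] at hx
      rw [← hsymm (q + 1 - 1 - x) (by omega)]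
      congr 1
      omega
    have h2 : ∑ x ∈ Finset.range (q + 1), (if 2 * x < 2 * q + 1 then 2 else 1) * h x =
        ∑ x ∈ Finset.range (q + 1), 2 * h x := by
      refine Finset.sum_congr rfl fun x hx => ?_
      rw [Finset.mem_range] at hx
      rw [if_pos (by omega)]
    rw [h1, h2, ← Finset.mul_sum]
    ring

open ComplexConjugate in
/-- The terms of bidegree `(k - b, b)` in `v` and its conjugate of `C_k^lam (Re v)`. -/
noncomputable def ridgeTerm (k : ℕ) (lam : ℝ) (v : ℂ) (b : ℕ) : ℂ :=
  ∑ j ∈ Finset.range (min b (k - b) + 1),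
    (((-1) ^ j * rising lam (k - j) / ((j.factorial : ℝ) * ((b - j).factorial : ℝ) *
      ((k - b - j).factorial : ℝ)) : ℝ) : ℂ) * (v ^ (k - b - j) * (conj v) ^ (b - j))

open ComplexConjugate in
theorem ridgeTerm_symm {k b : ℕ} (hb : b ≤ k) (lam : ℝ) (v : ℂ) :
    ridgeTerm k lam v (k - b) = conj (ridgeTerm k lam v b) := by
  unfold ridgeTerm
  rw [map_sum, Nat.sub_sub_self hb, min_comm]
  refine Finset.sum_congr rfl fun j _ => ?_
  rw [map_mul, map_mul, map_pow, map_pow, Complex.conj_conj, Complex.conj_ofReal]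
  congr 1
  · congr 1
    ring
  · ring

open ComplexConjugate in
theorem gegenbauer_eq_sum_ridgeTerm (k : ℕ) (lam : ℝ) (v : ℂ) :
    (gegenbauer k lam v.re : ℂ) = ∑ b ∈ Finset.range (k + 1), ridgeTerm k lam v b := by
  unfold gegenbauer ridgeTerm
  have h1 : (2 : ℂ) * v.re = conj v + v := by rw [add_comm, Complex.add_conj]; push_cast; ring
  push_cast
  rw [Finset.sum_sigma']
  simp_rw [h1, add_pow, Finset.mul_sum]
  rw [Finset.sum_sigma']
  -- The index b is the exponent of the conjugate in the binomial expansion of (v + conj v)^{k-2j},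
  -- raised by j.
  refine Finset.sum_bij' (fun x _ => ⟨x.2 + x.1, x.1⟩) (fun y _ => ⟨y.2, y.1 - y.2⟩) ?_ ?_ ?_ ?_ ?_
  · rintro ⟨j, b⟩ h
    simp only [Finset.mem_sigma, Finset.mem_range] at h ⊢
    omega
  · rintro ⟨b, j⟩ h
    simp only [Finset.mem_sigma, Finset.mem_range] at h ⊢
    omega
  · rintro ⟨j, b⟩ h
    simp
  · rintro ⟨b, j⟩ h
    simp only [Finset.mem_sigma, Finset.mem_range] at h ⊢
    simp
    omega
  · rintro ⟨j, b⟩ h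
    simp only [Finset.mem_sigma, Finset.mem_range] at h ⊢
    have hb : b ≤ k - 2 * j := by omega
    rw [Nat.cast_choose ℂ hb, show b + j - j = b by omega, show k - (b + j) - j = k - 2 * j - b by
      omega]
    have := Nat.cast_ne_zero (R := ℂ).2 (Nat.factorial_ne_zero j)
    have := Nat.cast_ne_zero (R := ℂ).2 (Nat.factorial_ne_zero b)
    have := Nat.cast_ne_zero (R := ℂ).2 (Nat.factorial_ne_zero (k - 2 * j))
    have := Nat.cast_ne_zero (R := ℂ).2 (Nat.factorial_ne_zero (k - 2 * j - b))
    field_simp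

/-- After v^{k-2l} is pulled out, v and its conjugate occur to equal powers, which leaves a
polynomial in |v|². -/
theorem ridgeTerm_eq_jacobi {lam : ℝ} (hlam : 0 < lam) {k l : ℕ} (hl : 2 * l ≤ k) (v : ℂ) :
    ridgeTerm k lam v l = ((rising lam (k - l) / ((k - l).factorial : ℝ) *
      jacobi l (lam - 1) (k - 2 * l : ℕ) (2 * Complex.normSq v - 1) : ℝ) : ℂ) *
        v ^ (k - 2 * l) := by
  obtain ⟨m, rfl⟩ := Nat.exists_eq_add_of_le hl
  rw [show 2 * l + m - l = l + m by omega, show 2 * l + m - 2 * l = m by omega,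
    ← sum_eq_jacobi hlam]
  unfold ridgeTerm
  rw [min_eq_left (by omega), Complex.ofReal_sum, Finset.sum_mul]
  refine Finset.sum_congr rfl fun j hj => ?_
  rw [Finset.mem_range] at hj
  rw [show 2 * l + m - l - j = m + (l - j) by omega, show l + m - j = m + (l - j) by omega,
    pow_add, mul_assoc (v ^ m), ← mul_pow, Complex.mul_conj]
  push_cast
  ring

/-- The expansion of a ridge function in disk polynomials. The terms b and k - b are conjugate, so
they pair up, except for the middle one when k is even. -/
theorem gegenbauer_re {lam : ℝ} (hlam : 0 < lam) (k : ℕ) (v : ℂ) :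
    gegenbauer k lam v.re = ∑ l ∈ Finset.range (k / 2 + 1), (if 2 * l < k then 2 else 1) *
      (rising lam (k - l) / ((k - l).factorial : ℝ) *
        jacobi l (lam - 1) (k - 2 * l : ℕ) (2 * Complex.normSq v - 1) *
          (v ^ (k - 2 * l)).re) := by
  have h1 : gegenbauer k lam v.re = ∑ b ∈ Finset.range (k + 1), (ridgeTerm k lam v b).re := by
    rw [← Complex.re_sum, ← gegenbauer_eq_sum_ridgeTerm, Complex.ofReal_re]
  rw [h1, sum_range_succ_symm]
  · refine Finset.sum_congr rfl fun l hl => ?_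
    rw [Finset.mem_range] at hl
    rw [ridgeTerm_eq_jacobi hlam (by omega), Complex.re_ofReal_mul]
  · intro b hb
    rw [ridgeTerm_symm hb, Complex.conj_re]

/-! ### The disk kernel and its averages over equidistant directions -/

theorem jacobi_one (n : ℕ) (α β : ℝ) :
    jacobi n α β 1 = rising (α + 1) n / (n.factorial : ℝ) := by
  unfold jacobi
  rw [Finset.sum_eq_single 0]
  · simp [rising_zero]
  · intro j _ hj
    simp [hj]
  · simp

theorem Gamma_add_nat_eq_rising {a : ℝ} (ha : 0 < a) (m : ℕ) :
    Real.Gamma (a + m) = rising a m * Real.Gamma a := by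
  induction m with
  | zero => simp [rising_zero]
  | succ m ih =>
    rw [rising_succ, Nat.cast_succ, ← add_assoc, Real.Gamma_add_one (by positivity), ih]
    ring

theorem diskNorm_sq {μ : ℝ} (hμ : 0 ≤ μ) (k l : ℕ) :
    diskNorm μ k l * diskNorm μ k l = (if 2 * l < k then 2 else 1) *
      (rising (μ + 3 / 2) (k - 2 * l) / ((k - 2 * l).factorial : ℝ)) := by
  unfold diskNorm
  have h1 : 0 < μ + 3 / 2 := by positivity
  have h2 : Real.Gamma ((k - 2 * l : ℕ) + μ + 3 / 2) =
      rising (μ + 3 / 2) (k - 2 * l) * Real.Gamma (μ + 3 / 2) := by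
    rw [← Gamma_add_nat_eq_rising h1]; congr 1; ring
  have h3 := Real.Gamma_pos_of_pos h1
  have h4 := rising_pos h1 (k - 2 * l)
  rw [h2, Real.Gamma_nat_eq_factorial, Real.mul_self_sqrt]
  · field_simp
  · positivity

/-- This is what λ is made for: it cancels the normalization of the disk basis and leaves the
reciprocal of the Jacobi value (μ+1/2)_l / l! at 1, which comes from evaluating the second factor on
the unit circle. -/
theorem lamCoeff_mul {μ : ℝ} (hμ : 0 ≤ μ) {k l : ℕ} (hl : 2 * l ≤ k) :
    lamCoeff μ l k * (rising (μ + 3 / 2) (k - 2 * l) / ((k - 2 * l).factorial : ℝ)) *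
      (rising (μ + 1 / 2) l / (l.factorial : ℝ)) /
        jacobiNormSq l (μ - 1 / 2) ((k - 2 * l : ℕ) : ℝ) =
      (l.factorial : ℝ) / rising (μ + 1 / 2) l := by
  obtain ⟨m, rfl⟩ := Nat.exists_eq_add_of_le hl
  unfold lamCoeff jacobiNormSq
  rw [show 2 * l + m - l = m + l by omega, show 2 * l + m - 2 * l = m by omega]
  have e1 : rising (μ + 3 / 2) (m + l) = rising (μ + 3 / 2) m * rising (μ + 3 / 2 + m) l :=
    rising_add _ _ _
  have e2 : μ - 1 / 2 + m + 2 = μ + 3 / 2 + m := by ring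
  have e3 : μ - 1 / 2 + 1 = μ + 1 / 2 := by ring
  rw [e1, e2, e3, ← rising_nat_add_one m l]
  have := rising_pos (show 0 < μ + 1 / 2 by positivity) l
  have := rising_pos (show 0 < μ + 3 / 2 by positivity) m
  have := rising_pos (show 0 < μ + 3 / 2 + m by positivity) l
  have := rising_pos (show 0 < (m : ℝ) + 1 by positivity) l
  have hP : ((m + l : ℕ) : ℝ) + μ + 1 / 2 = μ + m + l + 1 / 2 := by push_cast; ring
  have hQ : ((2 * l + m : ℕ) : ℝ) + μ + 1 / 2 = μ + m + 2 * l + 1 / 2 := by push_cast; ring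
  have hP' : μ - 1 / 2 + m + l + 1 = μ + m + l + 1 / 2 := by ring
  have hQ' : μ - 1 / 2 + m + 2 * l + 1 = μ + m + 2 * l + 1 / 2 := by ring
  have h5 : 0 < μ + m + l + 1 / 2 := by positivity
  have h6 : 0 < μ + m + 2 * l + 1 / 2 := by positivity
  rw [hP, hQ, hP', hQ']
  generalize μ + m + l + 1 / 2 = P at *
  generalize μ + m + 2 * l + 1 / 2 = Q at *
  generalize rising (μ + 1 / 2) l = R1 at *
  generalize rising (μ + 3 / 2) m = R2 at *
  generalize rising (μ + 3 / 2 + m) l = R3 at *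
  generalize rising ((m : ℝ) + 1) l = R4 at *
  field_simp

theorem jacobiNormSq_pos {α β : ℝ} (hα : -1 < α) (hβ : -1 < β) (hαβ : -1 < α + β) (n : ℕ) :
    0 < jacobiNormSq n α β := by
  unfold jacobiNormSq
  have := rising_pos (show 0 < α + 1 by linarith) n
  have := rising_pos (show 0 < β + 1 by linarith) n
  have := rising_pos (show 0 < α + β + 2 by linarith) n
  have hn : (0 : ℝ) ≤ n := by positivity
  have : 0 < α + β + n + 1 := by linarith
  have : 0 < α + β + 2 * n + 1 := by linarith
  positivity

open ComplexConjugate in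
-- On the unit circle the radial factor is the Jacobi value at 1, and the cosine and sine terms
-- combine by the addition formula into one real part.
theorem diskKernel_eq {μ : ℝ} (hμ : 0 ≤ μ) (k : ℕ) (ξ x y : ℝ) :
    diskKernel μ k ξ x y = ∑ l ∈ Finset.range (k / 2 + 1), (if 2 * l < k then 2 else 1) *
      ((l.factorial : ℝ) / rising (μ + 1 / 2) l *
        jacobi l (μ - 1 / 2) ((k - 2 * l : ℕ) : ℝ) (2 * (x ^ 2 + y ^ 2) - 1) *
        ((((x : ℂ) + y * Complex.I) *
          conj ((Real.cos ξ : ℂ) + Real.sin ξ * Complex.I)) ^ (k - 2 * l)).re) := by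
  unfold diskKernel
  refine Finset.sum_congr rfl fun l hl => ?_
  rw [Finset.mem_range] at hl
  rw [← lamCoeff_mul hμ (show 2 * l ≤ k by omega), Fin.sum_univ_two]
  unfold diskBasis jacobiON
  rw [Real.cos_sq_add_sin_sq, show (2 : ℝ) * 1 - 1 = 1 by norm_num, jacobi_one,
    show μ - 1 / 2 + 1 = μ + 1 / 2 by ring]
  have hN : 0 < jacobiNormSq l (μ - 1 / 2) ((k - 2 * l : ℕ) : ℝ) := by
    have : (0 : ℝ) ≤ ((k - 2 * l : ℕ) : ℝ) := by positivity
    exact jacobiNormSq_pos (by linarith) (by linarith) (by linarith) l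
  have hs := Real.sq_sqrt hN.le
  have hs0 := (Real.sqrt_pos.2 hN).ne'
  set s := √(jacobiNormSq l (μ - 1 / 2) ((k - 2 * l : ℕ) : ℝ)) with hsdef
  rw [← hs, mul_pow, ← map_pow, Complex.mul_re, Complex.conj_re, Complex.conj_im]
  have hd := diskNorm_sq hμ k l
  rw [if_pos rfl, if_pos rfl, if_neg (by simp), if_neg (by simp)]
  have hd' : ∀ c a b e f g h : ℝ, diskNorm μ k l * a * b * (diskNorm μ k l * c * e) +
      diskNorm μ k l * a * f * (diskNorm μ k l * c * g) =
      diskNorm μ k l * diskNorm μ k l * (a * c) * (b * e + f * g) := by intros; ring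
  rw [hd' _ _ _ _ _ _ 0, hd]
  field_simp
  ring

/-- With ω a primitive (n+1)-th root of unity the summand is (ω^d)^ν, and 0 < d ≤ n gives ω^d ≠ 1,
so the geometric sum over full periods vanishes. A general multiple M serves both n + 1 and 2n + 2
nodes. -/
theorem sum_exp_pow (n M d : ℕ) (hM : n + 1 ∣ M) (hd : d ≤ n) :
    ∑ ν ∈ Finset.range M,
      ((Real.cos (ν * π / (n + 1)) : ℂ) + Real.sin (ν * π / (n + 1)) * Complex.I) ^ (2 * d) =
      if d = 0 then (M : ℂ) else 0 := by
  split_ifs with h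
  · simp [h]
  set ω : ℂ := Complex.exp (2 * π * Complex.I / (n + 1 : ℕ)) with hω
  have hprim : IsPrimitiveRoot ω (n + 1) := Complex.isPrimitiveRoot_exp _ (Nat.succ_ne_zero n)
  have h1 : ∀ ν : ℕ,
      ((Real.cos (ν * π / (n + 1)) : ℂ) + Real.sin (ν * π / (n + 1)) * Complex.I) ^ (2 * d) =
      (ω ^ d) ^ ν := by
    intro ν
    rw [Complex.ofReal_cos, Complex.ofReal_sin, ← Complex.exp_mul_I, ← Complex.exp_nat_mul, hω,
      ← Complex.exp_nat_mul, ← Complex.exp_nat_mul]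
    congr 1
    push_cast
    ring
  simp_rw [h1]
  have hne : ω ^ d ≠ 1 := hprim.pow_ne_one_of_pos_of_lt h (by omega)
  rw [geom_sum_eq hne, ← pow_mul, mul_comm d, pow_mul, hprim.pow_eq_one_iff_dvd _ |>.2 hM]
  simp

open ComplexConjugate in
theorem sum_re_mul_re (n M m m' : ℕ) (hM : n + 1 ∣ M) (hm : m ≤ n) (hm' : m' ≤ n)
    (hpar : m % 2 = m' % 2) (z w : ℂ) (ζ : ℕ → ℂ)
    (hζ : ∀ ν : ℕ, ζ ν =
      (Real.cos (ν * π / (n + 1)) : ℂ) + Real.sin (ν * π / (n + 1)) * Complex.I) :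
    ∑ ν ∈ Finset.range M, ((z * conj (ζ ν)) ^ m).re * ((ζ ν * conj w) ^ m').re =
      if m = m' then M / (if 0 < m then 2 else 1) * ((z * conj w) ^ m).re else 0 := by
  have hsum : ∀ d ≤ n, ∑ ν ∈ Finset.range M, ζ ν ^ (2 * d) = if d = 0 then (M : ℂ) else 0 := by
    intro d hd
    rw [← sum_exp_pow n M d hM hd]
    simp [hζ]
  have hsumc : ∀ d ≤ n, ∑ ν ∈ Finset.range M, (conj (ζ ν)) ^ (2 * d) =
      if d = 0 then (M : ℂ) else 0 := by
    intro d hd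
    have := congrArg conj (hsum d hd)
    rw [map_sum] at this
    simp only [map_pow] at this
    rw [this]
    split_ifs <;> simp
  have hunit : ∀ ν, ζ ν * conj (ζ ν) = 1 := by
    intro ν
    rw [Complex.mul_conj, hζ, Complex.normSq_add_mul_I, Real.cos_sq_add_sin_sq]
    simp
  -- The two products carry the frequencies m' - m and -(m + m') in ζ. Both are even by the parity
  -- hypothesis, and half of each is at most n in absolute value.
  have hre : ∀ a b : ℂ, a.re * b.re = ((a * b).re + (a * conj b).re) / 2 := by
    intro a b
    simp [Complex.mul_re]
  simp_rw [hre]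
  rw [← Finset.sum_div, Finset.sum_add_distrib, ← Complex.re_sum, ← Complex.re_sum]
  have hplus : ∑ ν ∈ Finset.range M, (z * conj (ζ ν)) ^ m * conj ((ζ ν * conj w) ^ m') =
      z ^ m * w ^ m' * if (m + m') / 2 = 0 then (M : ℂ) else 0 := by
    rw [← hsumc _ (by omega), Finset.mul_sum]
    refine Finset.sum_congr rfl fun ν _ => ?_
    rw [show 2 * ((m + m') / 2) = m + m' by omega, map_pow, map_mul, Complex.conj_conj]
    ring
  have hminus : ∑ ν ∈ Finset.range M, (z * conj (ζ ν)) ^ m * (ζ ν * conj w) ^ m' =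
      z ^ m * conj w ^ m' * if m = m' then (M : ℂ) else 0 := by
    rcases le_total m m' with h | h
    · obtain ⟨d, rfl⟩ : ∃ d, m' = m + 2 * d := ⟨(m' - m) / 2, by omega⟩
      have : (if m = m + 2 * d then (M : ℂ) else 0) = if d = 0 then (M : ℂ) else 0 := by
        congr 1; simp
      rw [this, ← hsum d (by omega), Finset.mul_sum]
      refine Finset.sum_congr rfl fun ν _ => ?_
      calc _ = (ζ ν * conj (ζ ν)) ^ m * (z ^ m * conj w ^ (m + 2 * d) * ζ ν ^ (2 * d)) := by ring
        _ = _ := by rw [hunit, one_pow, one_mul]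
    · obtain ⟨d, rfl⟩ : ∃ d, m = m' + 2 * d := ⟨(m - m') / 2, by omega⟩
      have : (if m' + 2 * d = m' then (M : ℂ) else 0) = if d = 0 then (M : ℂ) else 0 := by
        congr 1; simp
      rw [this, ← hsumc d (by omega), Finset.mul_sum]
      refine Finset.sum_congr rfl fun ν _ => ?_
      calc _ = (ζ ν * conj (ζ ν)) ^ m' *
            (z ^ (m' + 2 * d) * conj w ^ m' * conj (ζ ν) ^ (2 * d)) := by ring
        _ = _ := by rw [hunit, one_pow, one_mul]
  rw [hplus, hminus]
  by_cases h : m = m'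
  · subst h
    rw [if_pos rfl, if_pos rfl, ← mul_pow, mul_comm _ (M : ℂ), ← Complex.ofReal_natCast,
      Complex.re_ofReal_mul]
    -- For m = 0 both products survive the averaging; for m > 0 only the first, which accounts for
    -- the factor 1/2.
    rcases Nat.eq_zero_or_pos m with h0 | h0
    · subst h0
      simp
    · rw [if_neg (by omega), if_pos h0]
      simp
      ring
  · rw [if_neg h, if_neg h, if_neg (by omega)]
    simp

open ComplexConjugate in
/-- Averaging the disk kernel against a Gegenbauer ridge function over equidistant directions. -/
theorem sum_diskKernel_mul_gegenbauer {μ : ℝ} (hμ : 0 ≤ μ) {n M k : ℕ} (hM : n + 1 ∣ M)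
    (hk : k ≤ n) (x y η : ℝ) :
    ∑ ν ∈ Finset.range M, diskKernel μ k (ν * π / (n + 1)) x y *
        gegenbauer k (μ + 1 / 2) (Real.cos (ν * π / (n + 1) - η)) =
      M * gegenbauer k (μ + 1 / 2) (x * Real.cos η + y * Real.sin η) := by
  have hlam : 0 < μ + 1 / 2 := by positivity
  set ζ : ℕ → ℂ := fun ν =>
    (Real.cos (ν * π / (n + 1)) : ℂ) + Real.sin (ν * π / (n + 1)) * Complex.I with hζ
  set w : ℂ := (Real.cos η : ℂ) + Real.sin η * Complex.I with hw
  set z : ℂ := (x : ℂ) + y * Complex.I with hz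
  have hsub : μ + 1 / 2 - 1 = μ - 1 / 2 := by ring
  have hwn : Complex.normSq w = 1 := by
    rw [hw, Complex.normSq_add_mul_I, Real.cos_sq_add_sin_sq]
  have hζn : ∀ ν, Complex.normSq (ζ ν) = 1 := by
    intro ν
    rw [hζ, Complex.normSq_add_mul_I, Real.cos_sq_add_sin_sq]
  have h1 : ∀ ν : ℕ, Real.cos (ν * π / (n + 1) - η) = (ζ ν * conj w).re := by
    intro ν
    simp only [hζ, hw, Real.cos_sub, Complex.mul_re, Complex.conj_re, Complex.conj_im,
      Complex.add_re, Complex.add_im, Complex.mul_im, Complex.I_re, Complex.I_im,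
      Complex.ofReal_re, Complex.ofReal_im]
    ring
  have h2 : x * Real.cos η + y * Real.sin η = (z * conj w).re := by
    simp only [hz, hw, Complex.mul_re, Complex.conj_re, Complex.conj_im,
      Complex.add_re, Complex.add_im, Complex.mul_im, Complex.I_re, Complex.I_im,
      Complex.ofReal_re, Complex.ofReal_im]
    ring
  rw [h2, gegenbauer_re hlam]
  have h3 : ∀ ν : ℕ, diskKernel μ k (ν * π / (n + 1)) x y *
        gegenbauer k (μ + 1 / 2) (Real.cos (ν * π / (n + 1) - η)) =
      ∑ l ∈ Finset.range (k / 2 + 1), ∑ l' ∈ Finset.range (k / 2 + 1),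
        ((if 2 * l < k then 2 else 1) * ((l.factorial : ℝ) / rising (μ + 1 / 2) l *
          jacobi l (μ - 1 / 2) ((k - 2 * l : ℕ) : ℝ) (2 * (x ^ 2 + y ^ 2) - 1)) *
        ((if 2 * l' < k then 2 else 1) * (rising (μ + 1 / 2) (k - l') / ((k - l').factorial : ℝ) *
          (rising (μ + 1 / 2) l' / (l'.factorial : ℝ))))) *
        (((z * conj (ζ ν)) ^ (k - 2 * l)).re * ((ζ ν * conj w) ^ (k - 2 * l')).re) := by
    intro ν
    rw [diskKernel_eq hμ, h1, gegenbauer_re hlam, Finset.sum_mul_sum]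
    refine Finset.sum_congr rfl fun l _ => Finset.sum_congr rfl fun l' _ => ?_
    rw [map_mul, Complex.normSq_conj, hwn, hζn, hsub, show (2 : ℝ) * (1 * 1) - 1 = 1 by norm_num,
      jacobi_one, show μ - 1 / 2 + 1 = μ + 1 / 2 by ring]
    ring
  simp_rw [h3]
  rw [Finset.sum_comm, Finset.mul_sum]
  refine Finset.sum_congr rfl fun l hl => ?_
  rw [Finset.sum_comm]
  simp_rw [← Finset.mul_sum]
  rw [Finset.mem_range] at hl
  -- Only equal frequencies survive. There l!/(μ+1/2)_l cancels the Jacobi value at 1, and one of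
  -- the two multiplicity factors cancels the 1/2 from the averaging.
  rw [Finset.sum_eq_single l]
  · rw [sum_re_mul_re n M _ _ hM (by omega) (by omega) rfl z w ζ (fun _ => rfl), if_pos rfl,
      map_mul, Complex.normSq_conj, hwn, hsub, hz, Complex.normSq_add_mul_I, mul_one]
    have e1 := (rising_pos hlam l).ne'
    have e2 : (if 0 < k - 2 * l then (2 : ℝ) else 1) = if 2 * l < k then 2 else 1 := by
      congr 1
      simp
    have e3 : (if 2 * l < k then (2 : ℝ) else 1) ≠ 0 := by split_ifs <;> norm_num
    rw [e2]
    generalize rising (μ + 1 / 2) l = R at *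
    field_simp
  · intro l' hl' hne
    rw [Finset.mem_range] at hl'
    rw [sum_re_mul_re n M _ _ hM (by omega) (by omega) (by omega) z w ζ (fun _ => rfl),
      if_neg (show ¬k - 2 * l = k - 2 * l' by omega), mul_zero]
  · intro h
    exact absurd (Finset.mem_range.2 hl) h

/-! ### The ultraspherical weights on the interval -/

/-- The measure `(1 - t^2)^ν dt` on `(-1, 1)`. -/
noncomputable def wMeasure (ν : ℝ) : Measure ℝ :=
  (volume.restrict (Set.Ioo (-1) 1)).withDensity (fun t => ENNReal.ofReal ((1 - t ^ 2) ^ ν))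

theorem measurable_weight (ν : ℝ) :
    Measurable (fun t : ℝ => ENNReal.ofReal ((1 - t ^ 2) ^ ν)) := by fun_prop

theorem one_sub_sq_pos {t : ℝ} (ht : t ∈ Set.Ioo (-1 : ℝ) 1) : 0 < 1 - t ^ 2 := by
  nlinarith [ht.1, ht.2]

theorem one_sub_sq_nonneg {t : ℝ} (ht : t ∈ Set.Icc (-1 : ℝ) 1) : 0 ≤ 1 - t ^ 2 := by
  nlinarith [ht.1, ht.2]

theorem ae_mem_wMeasure (ν : ℝ) : ∀ᵐ t ∂wMeasure ν, t ∈ Set.Ioo (-1 : ℝ) 1 :=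
  (withDensity_absolutelyContinuous _ _).ae_le (ae_restrict_mem measurableSet_Ioo)

theorem integral_wMeasure (ν : ℝ) (f : ℝ → ℝ) :
    ∫ t, f t ∂wMeasure ν = ∫ t in Set.Ioo (-1 : ℝ) 1, (1 - t ^ 2) ^ ν * f t := by
  rw [wMeasure, integral_withDensity_eq_integral_toReal_smul (measurable_weight ν)
    (Filter.Eventually.of_forall fun _ => ENNReal.ofReal_lt_top)]
  refine setIntegral_congr_fun measurableSet_Ioo fun t ht => ?_
  simp only [smul_eq_mul]
  rw [ENNReal.toReal_ofReal (Real.rpow_nonneg (one_sub_sq_pos ht).le _)]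

theorem integrable_wMeasure_iff (ν : ℝ) (f : ℝ → ℝ) :
    Integrable f (wMeasure ν) ↔
      IntegrableOn (fun t => (1 - t ^ 2) ^ ν * f t) (Set.Ioo (-1 : ℝ) 1) := by
  rw [wMeasure, integrable_withDensity_iff_integrable_smul' (measurable_weight ν)
    (Filter.Eventually.of_forall fun _ => ENNReal.ofReal_lt_top)]
  refine integrable_congr ?_
  filter_upwards [ae_restrict_mem measurableSet_Ioo] with t ht
  rw [ENNReal.toReal_ofReal (Real.rpow_nonneg (one_sub_sq_pos ht).le _), smul_eq_mul]

theorem intervalIntegrable_beta {ν : ℝ} (hν : -1 < ν) :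
    IntervalIntegrable (fun x : ℝ => x ^ ν * (1 - x) ^ ν) volume 0 1 ∧
      ∫ x in (0 : ℝ)..1, x ^ ν * (1 - x) ^ ν =
        Real.Gamma (ν + 1) * Real.Gamma (ν + 1) / Real.Gamma (2 * ν + 2) := by
  have hu : 0 < (((ν + 1 : ℝ)) : ℂ).re := by rw [Complex.ofReal_re]; linarith
  have heq : ∀ x ∈ Set.uIcc (0 : ℝ) 1,
      (x : ℂ) ^ (((ν + 1 : ℝ) : ℂ) - 1) * (1 - (x : ℂ)) ^ (((ν + 1 : ℝ) : ℂ) - 1) =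
        ((x ^ ν * (1 - x) ^ ν : ℝ) : ℂ) := by
    intro x hx
    rw [Set.uIcc_of_le zero_le_one] at hx
    rw [show ((ν + 1 : ℝ) : ℂ) - 1 = (ν : ℂ) by push_cast; ring, Complex.ofReal_mul,
      Complex.ofReal_cpow hx.1, Complex.ofReal_cpow (by linarith [hx.2])]
    push_cast
    rfl
  have hconv := Complex.betaIntegral_convergent hu hu
  constructor
  · have h1 : IntervalIntegrable (fun x : ℝ => ((x ^ ν * (1 - x) ^ ν : ℝ) : ℂ)) volume 0 1 :=
      hconv.congr fun x hx => heq x (Set.uIoc_subset_uIcc hx)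
    exact ⟨h1.1.re, h1.2.re⟩
  · have h2 := Complex.betaIntegral_eq_Gamma_mul_div _ _ hu hu
    rw [Complex.betaIntegral, intervalIntegral.integral_congr heq,
      intervalIntegral.integral_ofReal, ← Complex.ofReal_add, Complex.Gamma_ofReal,
      Complex.Gamma_ofReal] at h2
    rw [show 2 * ν + 2 = ν + 1 + (ν + 1) by ring]
    exact_mod_cast h2

/-- The substitution x = (t+1)/2 gives 1 - t² = 4x(1-x), hence a Beta integral with equal arguments;
Legendre's duplication formula simplifies its value. -/
theorem intervalIntegrable_weight {ν : ℝ} (hν : -1 < ν) :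
    IntervalIntegrable (fun t : ℝ => (1 - t ^ 2) ^ ν) volume (-1) 1 ∧
      ∫ t in (-1 : ℝ)..1, (1 - t ^ 2) ^ ν =
        √π * Real.Gamma (ν + 1) / Real.Gamma (ν + 3 / 2) := by
  obtain ⟨h1, h2⟩ := intervalIntegrable_beta hν
  have heq : ∀ t ∈ Set.uIcc (-1 : ℝ) 1, (1 - t ^ 2) ^ ν =
      4 ^ ν * ((1 / 2 * t + 1 / 2) ^ ν * (1 - (1 / 2 * t + 1 / 2)) ^ ν) := by
    intro t ht
    rw [Set.uIcc_of_le (by norm_num)] at ht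
    rw [← Real.mul_rpow (by linarith [ht.1]) (by linarith [ht.2]),
      ← Real.mul_rpow (by norm_num) (mul_nonneg (by linarith [ht.1]) (by linarith [ht.2]))]
    congr 1
    ring
  constructor
  · have h3 := (h1.comp_add_right (1 / 2)).comp_mul_left (c := 1 / 2)
    norm_num at h3
    have h4 : IntervalIntegrable (fun t : ℝ =>
        4 ^ ν * ((1 / 2 * t + 1 / 2) ^ ν * (1 - (1 / 2 * t + 1 / 2)) ^ ν)) volume (-1) 1 := by
      norm_num
      exact h3.const_mul _
    exact h4.congr fun t ht => (heq t (Set.uIoc_subset_uIcc ht)).symm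
  · rw [intervalIntegral.integral_congr heq, intervalIntegral.integral_const_mul,
      intervalIntegral.integral_comp_mul_add (fun x : ℝ => x ^ ν * (1 - x) ^ ν)
        (by norm_num : (1 / 2 : ℝ) ≠ 0)]
    norm_num
    rw [h2]
    have hd := Real.Gamma_mul_Gamma_add_half (ν + 1)
    rw [show 2 * (ν + 1) = 2 * ν + 2 by ring, show ν + 1 + 1 / 2 = ν + 3 / 2 by ring] at hd
    have g1 := Real.Gamma_pos_of_pos (show 0 < ν + 1 by linarith)
    have g2 := Real.Gamma_pos_of_pos (show 0 < ν + 3 / 2 by linarith)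
    have g3 := Real.Gamma_pos_of_pos (show 0 < 2 * ν + 2 by linarith)
    have e1 : (4 : ℝ) ^ ν * 2 * (2 : ℝ) ^ (1 - (2 * ν + 2)) = 1 := by
      have h5 : (2 : ℝ) ^ (2 * ν) * 2 * (2 : ℝ) ^ (1 - (2 * ν + 2)) =
          2 ^ (2 * ν + 1 + (1 - (2 * ν + 2))) := by
        rw [Real.rpow_add (by norm_num), Real.rpow_add_one (by norm_num)]
      rw [show (4 : ℝ) = 2 ^ (2 : ℝ) by norm_num, ← Real.rpow_mul (by norm_num), h5,
        show 2 * ν + 1 + (1 - (2 * ν + 2)) = 0 by ring, Real.rpow_zero]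
    rw [mul_div_assoc', mul_div_assoc', div_eq_div_iff g3.ne' g2.ne']
    calc _ = 4 ^ ν * 2 * Real.Gamma (ν + 1) *
          (Real.Gamma (ν + 1) * Real.Gamma (ν + 3 / 2)) := by ring
      _ = (4 ^ ν * 2 * 2 ^ (1 - (2 * ν + 2))) * (√π * Real.Gamma (ν + 1) *
          Real.Gamma (2 * ν + 2)) := by rw [hd]; ring
      _ = _ := by rw [e1, one_mul]

theorem isFiniteMeasure_wMeasure {ν : ℝ} (hν : -1 < ν) : IsFiniteMeasure (wMeasure ν) := by
  have h1 := (intervalIntegrable_weight hν).1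
  rw [intervalIntegrable_iff_integrableOn_Ioo_of_le (by norm_num)] at h1
  exact isFiniteMeasure_withDensity_ofReal h1.2

theorem integrable_eval_wMeasure {ν : ℝ} (hν : -1 < ν) {f : ℝ → ℝ} (hf : Continuous f) :
    Integrable f (wMeasure ν) := by
  have := isFiniteMeasure_wMeasure hν
  obtain ⟨C, hC⟩ := isCompact_Icc.exists_bound_of_continuousOn
    (hf.continuousOn (s := Set.Icc (-1 : ℝ) 1))
  refine Integrable.of_bound hf.aestronglyMeasurable C ?_
  filter_upwards [ae_mem_wMeasure ν] with t ht
  exact hC t (Set.Ioo_subset_Icc_self ht)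

/-- The total mass of the weight `(1 - t^2)^ν`. -/
noncomputable def wMass (ν : ℝ) : ℝ := √π * Real.Gamma (ν + 1) / Real.Gamma (ν + 3 / 2)

theorem integral_one_wMeasure {ν : ℝ} (hν : -1 < ν) : ∫ _, (1 : ℝ) ∂wMeasure ν = wMass ν := by
  rw [integral_wMeasure, wMass, ← (intervalIntegrable_weight hν).2, intervalIntegral.integral_of_le (by norm_num), integral_Ioc_eq_integral_Ioo]
  simp

theorem wMass_add_one {ν : ℝ} (hν : -1 < ν) :
    wMass (ν + 1) = wMass ν * (ν + 1) / (ν + 3 / 2) := by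
  unfold wMass
  have g2 := Real.Gamma_pos_of_pos (show 0 < ν + 3 / 2 by linarith)
  rw [Real.Gamma_add_one (by linarith), show ν + 1 + 3 / 2 = ν + 3 / 2 + 1 by ring,
    Real.Gamma_add_one (show ν + 3 / 2 ≠ 0 by linarith)]
  have : ν + 3 / 2 ≠ 0 := by linarith
  field_simp

theorem wMass_add_nat {ν : ℝ} (hν : -1 < ν) (k : ℕ) :
    wMass (ν + k) = wMass ν * rising (ν + 1) k / rising (ν + 3 / 2) k := by
  induction k with
  | zero => simp [rising_zero]
  | succ k ih =>
    have hk : (0 : ℝ) ≤ k := by positivity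
    rw [Nat.cast_succ, ← add_assoc, wMass_add_one (by linarith), ih, rising_succ, rising_succ]
    have := (rising_pos (show 0 < ν + 3 / 2 by linarith) k).ne'
    have : ν + 3 / 2 + k ≠ 0 := by linarith
    have : ν + k + 3 / 2 ≠ 0 := by linarith
    field_simp
    ring

/-- The value is the integral of (1-x²-y²)^ν over the unit disk, split along chords; in terms of
Gamma functions the factor Γ(ν+3/2) cancels. -/
theorem wMass_mul_wMass_half {ν : ℝ} (hν : -1 < ν) :
    wMass (ν + 1 / 2) * wMass ν = π / (ν + 1) := by
  unfold wMass
  have g1 := Real.Gamma_pos_of_pos (show 0 < ν + 1 by linarith)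
  have g2 := Real.Gamma_pos_of_pos (show 0 < ν + 3 / 2 by linarith)
  rw [show ν + 1 / 2 + 1 = ν + 3 / 2 by ring, show ν + 1 / 2 + 3 / 2 = ν + 1 + 1 by ring,
    Real.Gamma_add_one (by linarith)]
  have : ν + 1 ≠ 0 := by linarith
  have hs := Real.mul_self_sqrt Real.pi_pos.le
  generalize Real.Gamma (ν + 3 / 2) = G at *
  field_simp
  linear_combination hs

theorem integral_one_sub_sq_pow_mul (ν : ℝ) (k : ℕ) (f : ℝ → ℝ) :
    ∫ t, (1 - t ^ 2) ^ k * f t ∂wMeasure ν = ∫ t, f t ∂wMeasure (ν + k) := by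
  rw [integral_wMeasure, integral_wMeasure]
  refine setIntegral_congr_fun measurableSet_Ioo fun t ht => ?_
  rw [Real.rpow_add_natCast (one_sub_sq_pos ht).ne']
  ring


/-- Integration of a polynomial against the weight `(1 - t^2)^ν`. -/
noncomputable def wInt (ν : ℝ) (P : ℝ[X]) : ℝ := ∫ t, P.eval t ∂wMeasure ν

theorem wInt_add {ν : ℝ} (hν : -1 < ν) (P Q : ℝ[X]) : wInt ν (P + Q) = wInt ν P + wInt ν Q := by
  simp only [wInt, eval_add]
  exact integral_add (integrable_eval_wMeasure hν P.continuous)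
    (integrable_eval_wMeasure hν Q.continuous)

theorem wInt_sub {ν : ℝ} (hν : -1 < ν) (P Q : ℝ[X]) : wInt ν (P - Q) = wInt ν P - wInt ν Q := by
  simp only [wInt, eval_sub]
  exact integral_sub (integrable_eval_wMeasure hν P.continuous)
    (integrable_eval_wMeasure hν Q.continuous)

theorem wInt_C_mul (ν c : ℝ) (P : ℝ[X]) : wInt ν (C c * P) = c * wInt ν P := by
  simp only [wInt, eval_mul, eval_C]
  exact integral_const_mul _ _

theorem wInt_zero (ν : ℝ) : wInt ν 0 = 0 := by simp [wInt]

theorem wInt_one {ν : ℝ} (hν : -1 < ν) : wInt ν 1 = wMass ν := by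
  simp only [wInt, eval_one]
  exact integral_one_wMeasure hν

theorem wInt_one_sub_sq_pow_mul (ν : ℝ) (k : ℕ) (P : ℝ[X]) :
    wInt ν ((1 - X ^ 2) ^ k * P) = wInt (ν + k) P := by
  simp only [wInt, eval_mul, eval_pow, eval_sub, eval_one, eval_X]
  exact integral_one_sub_sq_pow_mul ν k _

/-- Integration by parts. -/
theorem wInt_derivative {ν : ℝ} (hν : -1 < ν) (P : ℝ[X]) :
    wInt ν ((1 - X ^ 2) * derivative P - C (2 * (ν + 1)) * X * P) = 0 := by
  have hint := integrable_eval_wMeasure hν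
    ((1 - X ^ 2) * derivative P - C (2 * (ν + 1)) * X * P).continuous
  rw [integrable_wMeasure_iff, ← intervalIntegrable_iff_integrableOn_Ioo_of_le (by norm_num)] at hint
  rw [wInt, integral_wMeasure, ← integral_Ioc_eq_integral_Ioo,
    ← intervalIntegral.integral_of_le (by norm_num),
    intervalIntegral.integral_eq_sub_of_hasDerivAt_of_le (by norm_num)
      (f := fun t => (1 - t ^ 2) ^ (ν + 1) * P.eval t) _ _ hint]
  · have : ν + 1 ≠ 0 := by linarith
    simp [Real.zero_rpow this]
  · refine ContinuousOn.mul (ContinuousOn.rpow_const (by fun_prop) fun t _ => Or.inr ?_)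
      P.continuousOn
    linarith
  · intro t ht
    have h0 := one_sub_sq_pos ht
    have h1 : HasDerivAt (fun t : ℝ => 1 - t ^ 2) (-(2 * t)) t := by
      simpa using (hasDerivAt_pow 2 t).const_sub 1
    have h2 := (h1.rpow_const (p := ν + 1) (Or.inl h0.ne')).mul (P.hasDerivAt t)
    refine HasDerivAt.congr_deriv h2 ?_
    rw [Real.rpow_add_one h0.ne', add_sub_cancel_right]
    simp
    ring

/-- Integration by parts applied to X^{m+1}; this recursion determines all moments. -/
theorem wInt_X_pow_add_two {ν : ℝ} (hν : -1 < ν) (m : ℕ) :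
    (m + 2 * ν + 3) * wInt ν (X ^ (m + 2)) = (m + 1) * wInt ν (X ^ m) := by
  have h := wInt_derivative hν (X ^ (m + 1))
  have e : (1 - X ^ 2) * derivative (X ^ (m + 1)) - C (2 * (ν + 1)) * X * X ^ (m + 1) =
      C ((m : ℝ) + 1) * X ^ m - C ((m : ℝ) + 2 * ν + 3) * X ^ (m + 2) := by
    rw [derivative_X_pow, show (m : ℝ) + 2 * ν + 3 = (m + 1) + 2 * (ν + 1) by ring,
      C_add (a := (m : ℝ) + 1) (b := 2 * (ν + 1))]
    simp
    ring
  rw [e, wInt_sub hν, wInt_C_mul, wInt_C_mul] at h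
  linarith

theorem wInt_X_pow_odd {ν : ℝ} (hν : -1 < ν) (j : ℕ) : wInt ν (X ^ (2 * j + 1)) = 0 := by
  induction j with
  | zero =>
    have h := wInt_derivative hν 1
    rw [derivative_one, mul_zero, mul_one, zero_sub, ← neg_mul, ← C_neg, wInt_C_mul] at h
    rw [mul_zero, zero_add, pow_one]
    exact (mul_eq_zero.1 h).resolve_left (by intro h; linarith)
  | succ j ih =>
    have h := wInt_X_pow_add_two hν (2 * j + 1)
    rw [ih, mul_zero] at h
    have hj : (0 : ℝ) ≤ ((2 * j + 1 : ℕ) : ℝ) := by positivity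
    rw [show 2 * (j + 1) + 1 = 2 * j + 1 + 2 by ring]
    exact (mul_eq_zero.1 h).resolve_left (by intro h; linarith)

theorem wInt_X_pow_even {ν : ℝ} (hν : -1 < ν) (j : ℕ) :
    wInt ν (X ^ (2 * j)) = wMass ν * ((2 * j).factorial : ℝ) /
      (4 ^ j * (j.factorial : ℝ) * rising (ν + 3 / 2) j) := by
  induction j with
  | zero => simp [wInt_one hν, rising_zero]
  | succ j ih =>
    have h := wInt_X_pow_add_two hν (2 * j)
    have hj : (0 : ℝ) ≤ j := by positivity
    have h1 : ν + 3 / 2 + j ≠ 0 := by linarith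
    have h2 : ((2 * j : ℕ) : ℝ) + 2 * ν + 3 ≠ 0 := by push_cast; linarith
    have h3 := (rising_pos (show 0 < ν + 3 / 2 by linarith) j).ne'
    apply mul_left_cancel₀ h2
    rw [show 2 * (j + 1) = 2 * j + 2 by ring, h, ih, rising_succ, Nat.factorial_succ (2 * j + 1),
      Nat.factorial_succ (2 * j), Nat.factorial_succ j]
    generalize rising (ν + 3 / 2) j = R at *
    have h4 : ((2 * j : ℕ) : ℝ) + 2 * ν + 3 = 2 * (ν + 3 / 2 + j) := by push_cast; ring
    rw [h4]
    generalize ν + 3 / 2 + (j : ℝ) = S at *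
    push_cast
    field_simp
    ring

/-! ### Orthogonality of the Gegenbauer polynomials -/

/-- One integration by parts based on the Rodrigues-type identity: the degree drops by one, the
parameter rises by one, and Q is differentiated. Iterating it yields the orthogonality and the
norms. -/
theorem wInt_gegenPoly_succ_mul {lam : ℝ} (hlam : 0 < lam) (n : ℕ) (Q : ℝ[X]) :
    (n + 1) * (n + 1 + 2 * lam) / (2 * lam) * wInt (lam - 1 / 2) (gegenPoly (n + 1) lam * Q) =
      wInt (lam + 1 - 1 / 2) (gegenPoly n (lam + 1) * derivative Q) := by
  have hν : -1 < lam - 1 / 2 := by linarith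
  have h := wInt_derivative hν (gegenPoly n (lam + 1) * Q)
  have hd := gegenPoly_derivative hlam.ne' n
  have e : (1 - X ^ 2) * derivative (gegenPoly n (lam + 1) * Q) -
        C (2 * (lam - 1 / 2 + 1)) * X * (gegenPoly n (lam + 1) * Q) =
      (1 - X ^ 2) ^ 1 * (gegenPoly n (lam + 1) * derivative Q) -
        C ((n + 1) * (n + 1 + 2 * lam) / (2 * lam)) * (gegenPoly (n + 1) lam * Q) := by
    rw [derivative_mul, show 2 * (lam - 1 / 2 + 1) = 2 * lam + 1 by ring]
    rw [C_neg] at hd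
    linear_combination Q * hd
  rw [e, wInt_sub hν, wInt_C_mul, wInt_one_sub_sq_pow_mul] at h
  rw [show lam + 1 - 1 / 2 = lam - 1 / 2 + (1 : ℕ) by push_cast; ring]
  linarith

theorem wInt_gegenPoly_mul_eq_zero {lam : ℝ} (hlam : 0 < lam) (n : ℕ) {Q : ℝ[X]}
    (hQ : Q.degree < n) : wInt (lam - 1 / 2) (gegenPoly n lam * Q) = 0 := by
  induction n generalizing lam Q with
  | zero =>
    have : Q = 0 := by
      rw [← degree_eq_bot]
      exact Nat.WithBot.lt_zero_iff.1 (by simpa using hQ)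
    rw [this, mul_zero, wInt_zero]
  | succ n ih =>
    have h := wInt_gegenPoly_succ_mul hlam n Q
    have h0 : ((n : ℝ) + 1) * (n + 1 + 2 * lam) / (2 * lam) ≠ 0 := by positivity
    by_cases hQ0 : Q = 0
    · rw [hQ0, mul_zero, wInt_zero]
    · rw [ih (by linarith)] at h
      · exact (mul_eq_zero.1 h).resolve_left h0
      · rw [degree_eq_natDegree hQ0] at hQ
        have hn : Q.natDegree ≤ n := Nat.lt_succ_iff.1 (by exact_mod_cast hQ)
        refine (degree_derivative_lt hQ0).trans_le ?_
        rw [degree_eq_natDegree hQ0]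
        exact_mod_cast hn

theorem wInt_gegenPoly_mul_X_pow {lam : ℝ} (hlam : 0 < lam) (n : ℕ) :
    wInt (lam - 1 / 2) (gegenPoly n lam * X ^ n) =
      wMass (lam - 1 / 2) * lam * rising (2 * lam) n / (2 ^ n * rising lam n * (n + lam)) := by
  induction n generalizing lam with
  | zero =>
    have : gegenPoly 0 lam = 1 := by
      simp [gegenPoly, diagSum_zero, gegenCoeff, rising_zero]
    rw [this, pow_zero, mul_one, wInt_one (by linarith)]
    simp [rising_zero]
    field_simp
  | succ n ih =>
    have h := wInt_gegenPoly_succ_mul hlam n (X ^ (n + 1))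
    rw [derivative_X_pow, Nat.add_sub_cancel, ← mul_assoc, mul_comm (gegenPoly _ _) (C _),
      mul_assoc, wInt_C_mul, ih (by linarith), show lam + 1 - 1 / 2 = lam - 1 / 2 + 1 by ring,
      wMass_add_one (by linarith)] at h
    have h0 : ((n : ℝ) + 1) * (n + 1 + 2 * lam) / (2 * lam) ≠ 0 := by positivity
    apply mul_left_cancel₀ h0
    rw [h]
    have r1 : 2 * lam * (2 * lam + 1) * rising (2 * (lam + 1)) n =
        rising (2 * lam) (n + 1) * (2 * lam + (n + 1)) := by
      have := rising_succ (2 * lam) (n + 1)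
      rw [rising_succ_left (2 * lam) (n + 1), rising_succ_left (2 * lam + 1) n] at this
      rw [show 2 * (lam + 1) = 2 * lam + 1 + 1 by ring, mul_assoc, this]
      push_cast
      ring
    have r2 : rising (2 * (lam + 1)) n =
        rising (2 * lam) (n + 1) * (2 * lam + (n + 1)) / (2 * lam * (2 * lam + 1)) := by
      rw [← r1]; field_simp
    rw [r2, rising_succ_left lam n]
    have := rising_pos (show 0 < lam + 1 by linarith) n
    generalize rising (lam + 1) n = R at *
    generalize rising (2 * lam) (n + 1) = S at *
    generalize wMass (lam - 1 / 2) = W at *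
    have : (n : ℝ) + (lam + 1) ≠ 0 := by positivity
    have : (n : ℝ) + 1 + lam ≠ 0 := by positivity
    have e1 : lam - 1 / 2 + 1 = (2 * lam + 1) / 2 := by ring
    have e2 : lam - 1 / 2 + 3 / 2 = lam + 1 := by ring
    rw [e1, e2]
    push_cast
    field_simp
    ring

/-- By orthogonality to lower degrees only the coefficient of X^n in Q counts. -/
theorem wInt_gegenPoly_mul {lam : ℝ} (hlam : 0 < lam) (n : ℕ) {Q : ℝ[X]} (hQ : Q.natDegree ≤ n) :
    wInt (lam - 1 / 2) (gegenPoly n lam * Q) = Q.coeff n *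
      (wMass (lam - 1 / 2) * lam * rising (2 * lam) n / (2 ^ n * rising lam n * (n + lam))) := by
  have hν : -1 < lam - 1 / 2 := by linarith
  have hdeg : (Q - C (Q.coeff n) * X ^ n).degree < (n : WithBot ℕ) := by
    rw [degree_lt_iff_coeff_zero]
    intro m hm
    rw [coeff_sub, coeff_C_mul, coeff_X_pow]
    rcases hm.eq_or_lt with rfl | h
    · simp
    · rw [if_neg (by omega), coeff_eq_zero_of_natDegree_lt (by omega)]
      simp
  have e : gegenPoly n lam * Q = gegenPoly n lam * (Q - C (Q.coeff n) * X ^ n) +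
      C (Q.coeff n) * (gegenPoly n lam * X ^ n) := by ring
  rw [e, wInt_add hν, wInt_gegenPoly_mul_eq_zero hlam n hdeg, wInt_C_mul,
    wInt_gegenPoly_mul_X_pow hlam, zero_add]

theorem wInt_gegenPoly_mul_self {lam : ℝ} (hlam : 0 < lam) (n : ℕ) :
    wInt (lam - 1 / 2) (gegenPoly n lam * gegenPoly n lam) =
      wMass (lam - 1 / 2) * gegenbauerNormSq n lam := by
  rw [wInt_gegenPoly_mul hlam n (natDegree_gegenPoly_le n lam), coeff_gegenPoly_self,
    gegenbauerNormSq]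
  have := rising_pos hlam n
  have : (n : ℝ) + lam ≠ 0 := by positivity
  field_simp

theorem gegenbauerNormSq_pos {lam : ℝ} (hlam : 0 < lam) (n : ℕ) : 0 < gegenbauerNormSq n lam := by
  have := rising_pos (show 0 < 2 * lam by positivity) n
  unfold gegenbauerNormSq
  positivity

theorem wInt_eq_zero_of_odd (ν : ℝ) {P : ℝ[X]} (hP : ∀ t, P.eval (-t) = -P.eval t) :
    wInt ν P = 0 := by
  have h : wInt ν P = -wInt ν P := by
    conv_lhs => rw [wInt, integral_wMeasure, ← integral_Ioc_eq_integral_Ioo,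
      ← intervalIntegral.integral_of_le (by norm_num)]
    rw [← neg_neg (1 : ℝ), ← intervalIntegral.integral_comp_neg, neg_neg,
      intervalIntegral.integral_of_le (by norm_num), integral_Ioc_eq_integral_Ioo, wInt,
      integral_wMeasure, ← integral_neg]
    refine setIntegral_congr_fun measurableSet_Ioo fun t _ => ?_
    simp [hP]
  linarith

/-! ### Averages of ridge polynomials over chords of the disk -/

theorem wInt_sum {ν : ℝ} (hν : -1 < ν) {ι : Type*} (s : Finset ι) (P : ι → ℝ[X]) :
    wInt ν (∑ i ∈ s, P i) = ∑ i ∈ s, wInt ν (P i) := by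
  classical
  induction s using Finset.induction_on with
  | empty => simp [wInt_zero]
  | insert i s hi ih => rw [Finset.sum_insert hi, Finset.sum_insert hi, wInt_add hν, ih]

theorem sum_range_eq_diagSum_of_odd {M : Type*} [AddCommMonoid M] (a : ℕ) (h : ℕ → M)
    (hodd : ∀ j, h (2 * j + 1) = 0) :
    ∑ i ∈ Finset.range (a + 1), h i = diagSum a (fun _ j => h (2 * j)) := by
  induction a using Nat.twoStepInduction with
  | zero => simp [diagSum]
  | one =>
    have := hodd 0
    simp_all [diagSum, Finset.sum_range_succ]
  | more a ih _ =>
    rw [Finset.sum_range_succ, Finset.sum_range_succ, ih]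
    unfold diagSum
    rw [show (a + 2) / 2 + 1 = a / 2 + 1 + 1 by omega, Finset.sum_range_succ _ (a / 2 + 1), add_assoc]
    congr 1
    rcases Nat.even_or_odd' a with ⟨q, rfl | rfl⟩
    · rw [hodd, zero_add]
      congr 1
      omega
    · rw [show 2 * q + 1 + 1 + 1 = 2 * (q + 1) + 1 by ring, hodd, add_zero]
      congr 1
      omega

/-- The polynomial `t ↦ ∫ (t c + u √(1-t²) s)^a (1-u²)^ν du`. -/
noncomputable def chordPoly (ν : ℝ) (a : ℕ) (c s : ℝ) : ℝ[X] :=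
  diagSum a (fun p j => C ((a.factorial : ℝ) * wMass ν *
    ((1 / ((p.factorial : ℝ) * 4 ^ j * j.factorial * rising (ν + 1 + 1 / 2) j)) *
      c ^ p * (s ^ 2) ^ j)) * (X ^ p * (1 - X ^ 2) ^ j))

/-- The odd moments in u vanish, so √(1-t²) enters only through even powers and the average is a
polynomial in t. -/
theorem integral_chord {ν : ℝ} (hν : -1 < ν) (a : ℕ) (c s : ℝ) {t : ℝ}
    (ht : t ∈ Set.Icc (-1 : ℝ) 1) :
    ∫ u, (t * c + u * √(1 - t ^ 2) * s) ^ a ∂wMeasure ν = (chordPoly ν a c s).eval t := by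
  set d := √(1 - t ^ 2) * s with hd
  have h1 : ∫ u, (t * c + u * √(1 - t ^ 2) * s) ^ a ∂wMeasure ν =
      wInt ν (∑ i ∈ Finset.range (a + 1), C (d ^ i * (t * c) ^ (a - i) * (a.choose i : ℝ)) * X ^ i) := by
    unfold wInt
    congr 1
    funext u
    rw [show t * c + u * √(1 - t ^ 2) * s = d * u + t * c by rw [hd]; ring, add_pow,
      eval_finsetSum]
    refine Finset.sum_congr rfl fun i _ => ?_
    rw [eval_mul, eval_C, eval_pow, eval_X, mul_pow]
    ring
  rw [h1, wInt_sum hν]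
  simp_rw [wInt_C_mul]
  rw [sum_range_eq_diagSum_of_odd]
  · rw [chordPoly, ← coe_evalRingHom, map_diagSum]
    refine diagSum_congr fun p j hpj => ?_
    subst hpj
    have hd2 : d ^ (2 * j) = (1 - t ^ 2) ^ j * (s ^ 2) ^ j := by
      rw [hd, pow_mul, mul_pow, Real.sq_sqrt (one_sub_sq_nonneg ht), mul_pow]
    rw [coe_evalRingHom, wInt_X_pow_even hν, hd2, Nat.add_sub_cancel,
      Nat.cast_choose ℝ (show 2 * j ≤ p + 2 * j by omega), Nat.add_sub_cancel,
      show ν + 1 + 1 / 2 = ν + 3 / 2 by ring, mul_pow]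
    have := Nat.cast_ne_zero (R := ℝ).2 (Nat.factorial_ne_zero (2 * j))
    simp only [eval_mul, eval_C, eval_pow, eval_X, eval_sub, eval_one]
    field_simp
  · intro j
    rw [wInt_X_pow_odd hν, mul_zero]

theorem natDegree_X_pow_mul_one_sub (p j : ℕ) :
    (X ^ p * (1 - X ^ 2) ^ j : ℝ[X]).natDegree ≤ p + 2 * j := by
  have h : (1 - X ^ 2 : ℝ[X]).natDegree ≤ 2 := by compute_degree
  refine natDegree_mul_le.trans (add_le_add (natDegree_X_pow_le p) ?_)
  refine natDegree_pow_le.trans ?_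
  rw [mul_comm 2 j]
  exact Nat.mul_le_mul_left _ h

theorem coeff_one_sub_sq_pow (j : ℕ) : ((1 - X ^ 2) ^ j : ℝ[X]).coeff (2 * j) = (-1) ^ j := by
  have h : (1 - X ^ 2 : ℝ[X]).natDegree ≤ 2 := by compute_degree
  rw [mul_comm, coeff_pow_of_natDegree_le h]
  simp [coeff_one]

theorem natDegree_one_sub_sq_pow_le (j : ℕ) : ((1 - X ^ 2) ^ j : ℝ[X]).natDegree ≤ 2 * j := by
  simpa using natDegree_X_pow_mul_one_sub 0 j

theorem coeff_X_pow_mul_one_sub (p j : ℕ) :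
    (X ^ p * (1 - X ^ 2) ^ j : ℝ[X]).coeff (p + 2 * j) = (-1) ^ j := by
  rw [add_comm p, coeff_X_pow_mul, coeff_one_sub_sq_pow]

theorem natDegree_chordPoly_le (ν : ℝ) (a : ℕ) (c s : ℝ) : (chordPoly ν a c s).natDegree ≤ a := by
  unfold chordPoly diagSum
  refine natDegree_sum_le_of_forall_le _ _ fun j hj => ?_
  rw [Finset.mem_range] at hj
  refine (natDegree_C_mul_le _ _).trans ((natDegree_X_pow_mul_one_sub _ _).trans ?_)
  omega

/-- The top coefficient of (1-X²)^j is (-1)^j, as if √(1-t²) were replaced by i t. The leading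
coefficient is therefore the Laplace integral of (c + i u s)^a. -/
theorem coeff_chordPoly (ν : ℝ) (a : ℕ) (c s : ℝ) :
    (chordPoly ν a c s).coeff a =
      (a.factorial : ℝ) * wMass ν * laplaceSum a (ν + 1) c (s ^ 2) := by
  rw [chordPoly, ← lcoeff_apply, map_diagSum, laplaceSum, mul_diagSum]
  refine diagSum_congr fun p j hpj => ?_
  subst hpj
  rw [lcoeff_apply, coeff_C_mul, coeff_X_pow_mul_one_sub]
  ring

theorem chordPoly_neg (ν : ℝ) (a : ℕ) (c s t : ℝ) :
    (chordPoly ν a c s).eval (-t) = (-1) ^ a * (chordPoly ν a c s).eval t := by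
  simp only [chordPoly]
  rw [← coe_evalRingHom, map_diagSum, ← coe_evalRingHom, map_diagSum, mul_diagSum]
  refine diagSum_congr fun p j hpj => ?_
  subst hpj
  simp only [coe_evalRingHom, eval_mul, eval_C, eval_pow, eval_X, eval_sub, eval_one]
  rw [pow_add, pow_mul, neg_pow t p]
  simp
  ring

/-- The polynomial `t ↦ ∫ Q (t c + u √(1-t²) s) (1-u²)^ν du`. -/
noncomputable def chordAvg (ν : ℝ) (c s : ℝ) (Q : ℝ[X]) : ℝ[X] :=
  ∑ i ∈ Finset.range (Q.natDegree + 1), C (Q.coeff i) * chordPoly ν i c s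

theorem integral_chordAvg {ν : ℝ} (hν : -1 < ν) (Q : ℝ[X]) (c s : ℝ) {t : ℝ}
    (ht : t ∈ Set.Icc (-1 : ℝ) 1) :
    ∫ u, Q.eval (t * c + u * √(1 - t ^ 2) * s) ∂wMeasure ν = (chordAvg ν c s Q).eval t := by
  conv_lhs => simp only [eval_eq_sum_range]
  rw [integral_finsetSum]
  · rw [chordAvg, eval_finsetSum]
    refine Finset.sum_congr rfl fun i _ => ?_
    rw [integral_const_mul, integral_chord hν i c s ht, eval_mul, eval_C]
  · intro i _
    exact integrable_eval_wMeasure hν (by fun_prop)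

theorem natDegree_chordAvg_le (ν c s : ℝ) {Q : ℝ[X]} {n : ℕ} (hQ : Q.natDegree ≤ n) :
    (chordAvg ν c s Q).natDegree ≤ n := by
  refine natDegree_sum_le_of_forall_le _ _ fun i hi => ?_
  rw [Finset.mem_range] at hi
  exact (natDegree_C_mul_le _ _).trans ((natDegree_chordPoly_le _ _ _ _).trans (by omega))

theorem coeff_chordAvg (ν c s : ℝ) {Q : ℝ[X]} {n : ℕ} (hQ : Q.natDegree ≤ n) :
    (chordAvg ν c s Q).coeff n =
      Q.coeff n * ((n.factorial : ℝ) * wMass ν * laplaceSum n (ν + 1) c (s ^ 2)) := by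
  have h : ∀ i < n, (chordPoly ν i c s).coeff n = 0 := fun i hi =>
    coeff_eq_zero_of_natDegree_lt ((natDegree_chordPoly_le _ _ _ _).trans_lt hi)
  rw [chordAvg, finsetSum_coeff]
  simp_rw [coeff_C_mul]
  rcases hQ.eq_or_lt with rfl | hlt
  · rw [Finset.sum_range_succ, coeff_chordPoly, Finset.sum_eq_zero, zero_add]
    intro i hi
    rw [h i (Finset.mem_range.1 hi), mul_zero]
  · rw [coeff_eq_zero_of_natDegree_lt hlt, zero_mul]
    refine Finset.sum_eq_zero fun i hi => ?_
    rw [Finset.mem_range] at hi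
    rw [h i (by omega), mul_zero]

/-! ### Integrals of ridge functions over the disk -/

theorem wInt_gegenPoly_mul_chordPoly_of_lt {μ : ℝ} (hμ : 0 ≤ μ) {k a : ℕ} (h : a < k) (c s : ℝ) :
    wInt μ (gegenPoly k (μ + 1 / 2) * chordPoly (μ - 1 / 2) a c s) = 0 := by
  have := wInt_gegenPoly_mul_eq_zero (show 0 < μ + 1 / 2 by positivity) k
    (Q := chordPoly (μ - 1 / 2) a c s) (degree_le_natDegree.trans_lt
      (by exact_mod_cast (natDegree_chordPoly_le _ _ _ _).trans_lt h))
  rwa [add_sub_cancel_right] at this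

theorem wInt_gegenPoly_mul_chordPoly_of_odd (μ : ℝ) {k a : ℕ} (h : (k + a) % 2 = 1) (c s : ℝ) :
    wInt μ (gegenPoly k (μ + 1 / 2) * chordPoly (μ - 1 / 2) a c s) = 0 := by
  refine wInt_eq_zero_of_odd _ fun t => ?_
  rw [eval_mul, eval_mul, eval_gegenPoly, eval_gegenPoly, gegenPoly_neg, chordPoly_neg]
  have : (-1 : ℝ) ^ k * (-1) ^ a = -1 := by
    rw [← pow_add]
    exact Odd.neg_one_pow (Nat.odd_iff.2 h)
  linear_combination (gegenbauer k (μ + 1 / 2) t * eval t (chordPoly (μ - 1 / 2) a c s)) * this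

theorem wInt_gegenPoly_mul_chordAvg_of_lt {μ : ℝ} (hμ : 0 ≤ μ) {k k' : ℕ} (h : k' < k)
    (c s : ℝ) : wInt μ (gegenPoly k (μ + 1 / 2) *
      chordAvg (μ - 1 / 2) c s (gegenPoly k' (μ + 1 / 2))) = 0 := by
  have := wInt_gegenPoly_mul_eq_zero (show 0 < μ + 1 / 2 by positivity) k
    (Q := chordAvg (μ - 1 / 2) c s (gegenPoly k' (μ + 1 / 2))) (degree_le_natDegree.trans_lt
      (by exact_mod_cast (natDegree_chordAvg_le _ _ _ (natDegree_gegenPoly_le _ _)).trans_lt h))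
  rwa [add_sub_cancel_right] at this

/-- This is the inner product on the disk of two Gebenbauer ridge functions whose directions differ
by an angle of cosine c. The chord average has degree at most k, so only its leading coefficient
enters, and the Laplace-type formula identifies that coefficient with a multiple of C_k^{μ+1/2}(c).
-/
theorem wInt_gegenPoly_mul_chordAvg_self {μ : ℝ} (hμ : 0 ≤ μ) (k : ℕ) {c s : ℝ}
    (hcs : c ^ 2 + s ^ 2 = 1) : wInt μ (gegenPoly k (μ + 1 / 2) *
      chordAvg (μ - 1 / 2) c s (gegenPoly k (μ + 1 / 2))) =
        π / (k + μ + 1 / 2) * gegenbauer k (μ + 1 / 2) c := by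
  have hlam : 0 < μ + 1 / 2 := by positivity
  have h := wInt_gegenPoly_mul hlam k
    (natDegree_chordAvg_le (μ - 1 / 2) c s (natDegree_gegenPoly_le k (μ + 1 / 2)))
  rw [coeff_chordAvg _ _ _ (natDegree_gegenPoly_le _ _), coeff_gegenPoly_self,
    add_sub_cancel_right] at h
  rw [h, gegenbauer_eq_laplaceSum hlam, show s ^ 2 = 1 - c ^ 2 by linarith,
    show μ - 1 / 2 + 1 = μ + 1 / 2 by ring]
  have hm := wMass_mul_wMass_half (show -1 < μ - 1 / 2 by linarith)
  rw [sub_add_cancel, show μ - 1 / 2 + 1 = μ + 1 / 2 by ring, eq_div_iff hlam.ne'] at hm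
  have := rising_pos hlam k
  have hk : 0 < (k : ℝ) + μ + 1 / 2 := by positivity
  rw [← hm, show (k : ℝ) + (μ + 1 / 2) = k + μ + 1 / 2 by ring]
  generalize (k : ℝ) + μ + 1 / 2 = K at *
  generalize rising (μ + 1 / 2) k = R at *
  field_simp

/-! ### Cylindrical-type coordinates on the ball -/

theorem norm_linePoint_sq (θ t s : ℝ) {w : ℝ} (hw : w ∈ Set.Icc (-1 : ℝ) 1) :
    ‖linePoint θ t w s‖ ^ 2 = t ^ 2 * (1 - w ^ 2) + s ^ 2 + w ^ 2 := by
  rw [EuclideanSpace.real_norm_sq_eq, Fin.sum_univ_three]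
  have h1 := Real.sq_sqrt (one_sub_sq_nonneg hw)
  have h2 := Real.sin_sq_add_cos_sq θ
  simp only [linePoint, Matrix.cons_val_zero, Matrix.cons_val_one, Matrix.cons_val]
  linear_combination (t ^ 2 * √(1 - w ^ 2) ^ 2 + s ^ 2) * h2 + t ^ 2 * h1

/-- The point of the ball with coordinates `(t, w, u)`, adapted to the direction `θ`. -/
noncomputable def ballParam (θ : ℝ) (v : Fin 3 → ℝ) : E3 :=
  linePoint θ (v 0) (v 1) (v 2 * (√(1 - v 1 ^ 2) * √(1 - v 0 ^ 2)))

/-- The open cube `(-1, 1)^3`. -/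
def cube : Set (Fin 3 → ℝ) := Set.univ.pi fun _ => Set.Ioo (-1) 1

theorem measurableSet_cube : MeasurableSet cube :=
  MeasurableSet.univ_pi fun _ => measurableSet_Ioo

theorem continuous_linePoint (θ : ℝ) :
    Continuous fun p : ℝ × ℝ × ℝ => linePoint θ p.1 p.2.1 p.2.2 := by
  unfold linePoint
  refine (PiLp.continuous_toLp 2 _).comp (continuous_pi fun i => ?_)
  fin_cases i <;> simp <;> fun_prop

theorem continuous_ballParam (θ : ℝ) : Continuous (ballParam θ) := by
  have : ballParam θ = (fun p : ℝ × ℝ × ℝ => linePoint θ p.1 p.2.1 p.2.2) ∘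
    (fun v : Fin 3 → ℝ => (v 0, v 1, v 2 * (√(1 - v 1 ^ 2) * √(1 - v 0 ^ 2)))) := rfl
  rw [this]
  exact (continuous_linePoint θ).comp (by fun_prop)

theorem one_sub_norm_ballParam_sq (θ : ℝ) {v : Fin 3 → ℝ} (h0 : v 0 ∈ Set.Icc (-1 : ℝ) 1)
    (h1 : v 1 ∈ Set.Icc (-1 : ℝ) 1) :
    1 - ‖ballParam θ v‖ ^ 2 = (1 - v 0 ^ 2) * (1 - v 1 ^ 2) * (1 - v 2 ^ 2) := by
  have e0 := Real.sq_sqrt (one_sub_sq_nonneg h0)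
  have e1 := Real.sq_sqrt (one_sub_sq_nonneg h1)
  rw [ballParam, norm_linePoint_sq _ _ _ h1, mul_pow, mul_pow, e0, e1]
  ring

theorem injOn_ballParam (θ : ℝ) : Set.InjOn (ballParam θ) cube := by
  intro v hv v' hv' h
  have hc := fun i => congrArg (fun y : E3 => y i) h
  have c0 := hc 0
  have c1 := hc 1
  have c2 := hc 2
  simp only [ballParam, linePoint, Matrix.cons_val_zero, Matrix.cons_val_one,
    Matrix.cons_val] at c0 c1 c2
  have h2 := Real.sin_sq_add_cos_sq θ
  have hr := Real.sqrt_pos.2 (one_sub_sq_pos (hv 1 trivial))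
  rw [← c2] at c0 c1
  have a1 : v 0 * √(1 - v 1 ^ 2) = v' 0 * √(1 - v 1 ^ 2) := by
    linear_combination Real.cos θ * c0 + Real.sin θ * c1 +
      (v' 0 - v 0) * √(1 - v 1 ^ 2) * h2
  have a0 : v 0 = v' 0 := mul_right_cancel₀ hr.ne' a1
  rw [← a0] at c0 c1
  have a2 : v 2 * (√(1 - v 1 ^ 2) * √(1 - v 0 ^ 2)) =
      v' 2 * (√(1 - v 1 ^ 2) * √(1 - v 0 ^ 2)) := by
    linear_combination -Real.sin θ * c0 + Real.cos θ * c1 +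
      (v' 2 - v 2) * (√(1 - v 1 ^ 2) * √(1 - v 0 ^ 2)) * h2
  have hq := Real.sqrt_pos.2 (one_sub_sq_pos (hv 0 trivial))
  funext i
  fin_cases i
  · exact a0
  · exact c2
  · exact mul_right_cancel₀ (mul_pos hr hq).ne' a2

theorem image_ballParam (θ : ℝ) : ballParam θ '' cube = Metric.ball 0 1 := by
  ext y
  rw [mem_ball_zero_iff, Set.mem_image]
  constructor
  · rintro ⟨v, hv, rfl⟩
    have h := one_sub_norm_ballParam_sq θ (Set.Ioo_subset_Icc_self (hv 0 trivial))
      (Set.Ioo_subset_Icc_self (hv 1 trivial))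
    have := one_sub_sq_pos (hv 0 trivial)
    have := one_sub_sq_pos (hv 1 trivial)
    have := one_sub_sq_pos (hv 2 trivial)
    have : 0 < 1 - ‖ballParam θ v‖ ^ 2 := by rw [h]; positivity
    nlinarith [norm_nonneg (ballParam θ v)]
  · intro hy
    have hy2 : y 0 ^ 2 + y 1 ^ 2 + y 2 ^ 2 < 1 := by
      have := EuclideanSpace.real_norm_sq_eq y
      rw [Fin.sum_univ_three] at this
      rw [← this]
      nlinarith [norm_nonneg y]
    have h2 := Real.sin_sq_add_cos_sq θ
    set a := y 0 * Real.cos θ + y 1 * Real.sin θ with ha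
    set b := -y 0 * Real.sin θ + y 1 * Real.cos θ with hb
    have hab : a ^ 2 + b ^ 2 + y 2 ^ 2 < 1 := by
      have : a ^ 2 + b ^ 2 = y 0 ^ 2 + y 1 ^ 2 := by
        rw [ha, hb]; linear_combination (y 0 ^ 2 + y 1 ^ 2) * h2
      rw [this]; exact hy2
    have hw : 0 < 1 - y 2 ^ 2 := by nlinarith [sq_nonneg a, sq_nonneg b]
    have hr := Real.sqrt_pos.2 hw
    have hrs := Real.sq_sqrt hw.le
    set r := √(1 - y 2 ^ 2) with hrdef
    have ht : 0 < 1 - (a / r) ^ 2 := by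
      rw [div_pow, hrs, sub_pos, div_lt_one hw]
      nlinarith [sq_nonneg b]
    have hq := Real.sqrt_pos.2 ht
    have hqs := Real.sq_sqrt ht.le
    set q := √(1 - (a / r) ^ 2) with hqdef
    have hu : 0 < 1 - (b / (r * q)) ^ 2 := by
      rw [div_pow, mul_pow, hrs, hqs, sub_pos, div_lt_one (by positivity), div_pow, hrs]
      have : (1 - y 2 ^ 2) * (1 - a ^ 2 / (1 - y 2 ^ 2)) = 1 - y 2 ^ 2 - a ^ 2 := by
        field_simp
      rw [this]
      linarith
    have mem : ∀ z : ℝ, 0 < 1 - z ^ 2 → z ∈ Set.Ioo (-1 : ℝ) 1 := by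
      intro z hz
      constructor <;> nlinarith
    refine ⟨![a / r, y 2, b / (r * q)], ?_, ?_⟩
    · intro i _
      fin_cases i
      · exact mem _ ht
      · exact mem _ hw
      · exact mem _ hu
    · have e1 : a / r * r = a := by field_simp
      have e2 : b / (r * q) * (r * q) = b := by field_simp
      simp only [ballParam, linePoint, Matrix.cons_val_zero, Matrix.cons_val_one, Matrix.cons_val]
      rw [← hrdef, ← hqdef, e1, e2]
      ext i
      fin_cases i
      · simp [ha, hb]
        linear_combination y 0 * h2
      · simp [ha, hb]
        linear_combination y 1 * h2
      · simp

/-- The rotation contributes c² + s². Up to the order of the rows the remaining matrix is triangular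
in (t, w, u), so a1, b0 and b1 drop out; the sign comes from that order. -/
theorem det_rotated_triangular (c s a0 a1 b0 b1 b2 : ℝ) (d : Fin 3 → ((Fin 3 → ℝ) →L[ℝ] ℝ))
    (hd : d = fun i => ContinuousLinearMap.proj i) :
    (ContinuousLinearMap.pi ![c • (a0 • d 0 + a1 • d 1) - s • (b0 • d 0 + b1 • d 1 + b2 • d 2),
      s • (a0 • d 0 + a1 • d 1) + c • (b0 • d 0 + b1 • d 1 + b2 • d 2), d 1]).det =
      -((s ^ 2 + c ^ 2) * (a0 * b2)) := by
  subst hd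
  rw [ContinuousLinearMap.det, ← LinearMap.det_toMatrix', Matrix.det_fin_three]
  simp [LinearMap.toMatrix'_apply]
  ring

theorem exists_hasFDerivAt_ballParam (θ : ℝ) {v : Fin 3 → ℝ} (hv : v ∈ cube) :
    ∃ F : (Fin 3 → ℝ) →L[ℝ] (Fin 3 → ℝ),
      HasFDerivAt (fun v : Fin 3 → ℝ => WithLp.ofLp (ballParam θ v)) F v ∧
        |F.det| = (1 - v 1 ^ 2) * √(1 - v 0 ^ 2) := by
  have hr := one_sub_sq_pos (hv 1 trivial)
  have hq := one_sub_sq_pos (hv 0 trivial)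
  let d : Fin 3 → ((Fin 3 → ℝ) →L[ℝ] ℝ) := fun i => ContinuousLinearMap.proj i
  have hd : ∀ i, HasFDerivAt (fun v : Fin 3 → ℝ => v i) (d i) v := fun i => hasFDerivAt_apply i v
  have hsq : ∀ i, 0 < 1 - v i ^ 2 →
      HasFDerivAt (fun v : Fin 3 → ℝ => √(1 - v i ^ 2)) ((-(v i / √(1 - v i ^ 2))) • d i) v := by
    intro i hi
    have h := (((hd i).pow 2).const_sub 1).sqrt hi.ne'
    refine h.congr_fderiv ?_
    ext z
    simp
    field_simp
  have hA : HasFDerivAt (fun v : Fin 3 → ℝ => v 0 * √(1 - v 1 ^ 2))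
      (√(1 - v 1 ^ 2) • d 0 + (v 0 * -(v 1 / √(1 - v 1 ^ 2))) • d 1) v := by
    refine ((hd 0).mul (hsq 1 hr)).congr_fderiv ?_
    ext z
    simp
    ring
  have hS : HasFDerivAt (fun v : Fin 3 → ℝ => v 2 * (√(1 - v 1 ^ 2) * √(1 - v 0 ^ 2)))
      ((v 2 * √(1 - v 1 ^ 2) * -(v 0 / √(1 - v 0 ^ 2))) • d 0 +
        (v 2 * √(1 - v 0 ^ 2) * -(v 1 / √(1 - v 1 ^ 2))) • d 1 +
        (√(1 - v 1 ^ 2) * √(1 - v 0 ^ 2)) • d 2) v := by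
    refine ((hd 2).mul ((hsq 1 hr).mul (hsq 0 hq))).congr_fderiv ?_
    ext z
    simp
    ring
  have h0 := (hA.mul_const (Real.cos θ)).sub (hS.mul_const (Real.sin θ))
  have h1 := (hA.mul_const (Real.sin θ)).add (hS.mul_const (Real.cos θ))
  have hdet := det_rotated_triangular (Real.cos θ) (Real.sin θ) (√(1 - v 1 ^ 2))
    (v 0 * -(v 1 / √(1 - v 1 ^ 2))) (v 2 * √(1 - v 1 ^ 2) * -(v 0 / √(1 - v 0 ^ 2)))
    (v 2 * √(1 - v 0 ^ 2) * -(v 1 / √(1 - v 1 ^ 2))) (√(1 - v 1 ^ 2) * √(1 - v 0 ^ 2)) d rfl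
  refine ⟨_, hasFDerivAt_pi.2 (fun i => ?_), (congrArg abs hdet).trans ?_⟩
  · fin_cases i
    · exact h0
    · exact h1
    · exact hd 1
  · rw [Real.sin_sq_add_cos_sq, one_mul, abs_neg, ← mul_assoc, Real.mul_self_sqrt hr.le,
      abs_of_nonneg (mul_nonneg hr.le (Real.sqrt_nonneg _))]

theorem map_withDensity_comp {α β : Type*} [MeasurableSpace α] [MeasurableSpace β] (m : Measure α)
    {f : α → β} (hf : Measurable f) {g : β → ENNReal} (hg : Measurable g) :
    (m.map f).withDensity g = (m.withDensity (g ∘ f)).map f := by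
  ext s hs
  rw [withDensity_apply _ hs, Measure.map_apply hf hs, withDensity_apply _ (hf hs),
    setLIntegral_map hs hg hf]
  rfl

theorem measurable_ballWeight (μ : ℝ) : Measurable (ballWeight μ) := by
  unfold ballWeight
  fun_prop

/-- The coordinates `((t, w), u)` on the ball, adapted to the direction `θ`. -/
noncomputable def ballCoord (θ : ℝ) (q : (ℝ × ℝ) × ℝ) : E3 :=
  linePoint θ q.1.1 q.1.2 (q.2 * (√(1 - q.1.2 ^ 2) * √(1 - q.1.1 ^ 2)))

/-- The measure on the coordinate space corresponding to the weight on the ball. -/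
noncomputable def coordMeasure (μ : ℝ) : Measure ((ℝ × ℝ) × ℝ) :=
  ((wMeasure μ).prod (wMeasure (μ + 1 / 2))).prod (wMeasure (μ - 1 / 2))

theorem continuous_ballCoord (θ : ℝ) : Continuous (ballCoord θ) := by
  have : ballCoord θ = (fun p : ℝ × ℝ × ℝ => linePoint θ p.1 p.2.1 p.2.2) ∘
    (fun q : (ℝ × ℝ) × ℝ =>
      (q.1.1, q.1.2, q.2 * (√(1 - q.1.2 ^ 2) * √(1 - q.1.1 ^ 2)))) := rfl
  rw [this]
  exact (continuous_linePoint θ).comp (by fun_prop)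

theorem volume_preserving_toFin3 :
    MeasurePreserving (fun q : (ℝ × ℝ) × ℝ => (![q.1.1, q.1.2, q.2] : Fin 3 → ℝ)) := by
  have h1 := (volume_preserving_piFinSuccAbove (fun _ : Fin 3 => ℝ) 2).symm
  have h2 := (volume_preserving_finTwoArrow ℝ).symm
  have h3 := h1.comp ((MeasurePreserving.id volume).prod h2)
  have h4 := h3.comp (Measure.measurePreserving_swap (μ := (volume : Measure (ℝ × ℝ))) (ν := (volume : Measure ℝ)))
  convert h4 using 1
  · funext q i
    fin_cases i <;> rfl
  · rfl

theorem wMeasure_prod_eq (μ : ℝ) : coordMeasure μ =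
    ((volume : Measure ((ℝ × ℝ) × ℝ)).restrict
      ((Set.Ioo (-1) 1 ×ˢ Set.Ioo (-1) 1) ×ˢ Set.Ioo (-1) 1)).withDensity
      (fun q => ENNReal.ofReal ((1 - q.1.1 ^ 2) ^ μ) *
        ENNReal.ofReal ((1 - q.1.2 ^ 2) ^ (μ + 1 / 2)) *
        ENNReal.ofReal ((1 - q.2 ^ 2) ^ (μ - 1 / 2))) := by
  unfold coordMeasure wMeasure
  rw [prod_withDensity (by fun_prop) (by fun_prop), prod_withDensity (by fun_prop) (by fun_prop),
    Measure.prod_restrict, Measure.prod_restrict]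
  rfl

/-- Change of variables on the open cube, where the square roots are differentiable and the
coordinates are injective. -/
theorem volume_restrict_ball (θ : ℝ) :
    (volume : Measure E3).restrict (Metric.ball 0 1) =
      Measure.map (ballParam θ) ((volume.restrict cube).withDensity
        (fun v => ENNReal.ofReal ((1 - v 1 ^ 2) * √(1 - v 0 ^ 2)))) := by
  classical
  choose! F hF using fun v (hv : v ∈ cube) => exists_hasFDerivAt_ballParam θ hv
  have hinj : Set.InjOn (fun v : Fin 3 → ℝ => WithLp.ofLp (ballParam θ v)) cube := by
    intro v hv v' hv' h
    exact injOn_ballParam θ hv hv' (WithLp.ofLp_injective 2 h)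
  have h1 := map_withDensity_abs_det_fderiv_eq_addHaar (volume : Measure (Fin 3 → ℝ))
    measurableSet_cube.nullMeasurableSet (fun v hv => (hF v hv).1.hasFDerivWithinAt) hinj
  have h2 : (fun v : Fin 3 → ℝ => WithLp.ofLp (ballParam θ v)) '' cube =
      WithLp.toLp 2 ⁻¹' (Metric.ball (0 : E3) 1) := by
    rw [← image_ballParam θ]
    ext y
    constructor
    · rintro ⟨v, hv, rfl⟩
      exact ⟨v, hv, rfl⟩
    · rintro ⟨v, hv, h⟩
      exact ⟨v, hv, by simp only [h]⟩
  have h3 := ((PiLp.volume_preserving_toLp (Fin 3)).restrict_preimage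
    (Metric.isOpen_ball (x := (0 : E3)) (ε := 1)).measurableSet).map_eq
  have hmeas : Measurable (fun v : Fin 3 → ℝ => WithLp.ofLp (ballParam θ v)) :=
    (WithLp.measurable_ofLp 2 _).comp (continuous_ballParam θ).measurable
  rw [← h3, ← h2, ← h1, Measure.map_map (by fun_prop) hmeas]
  change Measure.map (ballParam θ) _ = _
  congr 1
  refine withDensity_congr_ae ?_
  filter_upwards [ae_restrict_mem measurableSet_cube] with v hv
  rw [(hF v hv).2]

theorem measurePreserving_ballCoord (μ θ : ℝ) :
    MeasurePreserving (ballCoord θ) (coordMeasure μ) (ballMeasure μ) := by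
  refine ⟨(continuous_ballCoord θ).measurable, ?_⟩
  -- The coordinates parametrize only the open ball; the sphere is a null set.
  have hball : (volume : Measure E3).restrict (Metric.closedBall 0 1) =
      volume.restrict (Metric.ball 0 1) := by
    refine Measure.restrict_congr_set ?_
    rw [← Metric.ball_union_sphere]
    exact union_ae_eq_left_of_ae_eq_empty
      (ae_eq_empty.2 (Measure.addHaar_sphere volume (0 : E3) 1))
  have hm := measurable_ballWeight μ
  have hp := (continuous_ballParam θ).measurable
  have hcube : (fun q : (ℝ × ℝ) × ℝ => (![q.1.1, q.1.2, q.2] : Fin 3 → ℝ)) ⁻¹' cube =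
      (Set.Ioo (-1) 1 ×ˢ Set.Ioo (-1) 1) ×ˢ Set.Ioo (-1) 1 := by
    ext q
    simp only [cube, Set.mem_preimage, Set.mem_pi, Set.mem_univ, forall_const, Set.mem_prod]
    constructor
    · intro h
      exact ⟨⟨h 0, h 1⟩, h 2⟩
    · rintro ⟨⟨h0, h1⟩, h2⟩ i
      fin_cases i
      · exact h0
      · exact h1
      · exact h2
  have h3 := (volume_preserving_toFin3.restrict_preimage measurableSet_cube).map_eq
  rw [ballMeasure, hball, volume_restrict_ball θ,
    map_withDensity_comp _ hp (by fun_prop), ← withDensity_mul _ (by fun_prop) (by fun_prop),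
    ← h3, map_withDensity_comp _ volume_preserving_toFin3.measurable (by fun_prop),
    Measure.map_map hp volume_preserving_toFin3.measurable, hcube, wMeasure_prod_eq]
  have e : ballParam θ ∘ (fun q : (ℝ × ℝ) × ℝ => (![q.1.1, q.1.2, q.2] : Fin 3 → ℝ)) =
    ballCoord θ := rfl
  rw [e]
  congr 1
  refine withDensity_congr_ae ?_
  filter_upwards [ae_restrict_mem
    ((measurableSet_Ioo.prod measurableSet_Ioo).prod measurableSet_Ioo)] with q hq
  obtain ⟨⟨ht, hw⟩, hu⟩ := hq
  have h0 := one_sub_sq_pos ht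
  have h1 := one_sub_sq_pos hw
  have h2 := one_sub_sq_pos hu
  simp only [Function.comp_apply, Pi.mul_apply, Matrix.cons_val_zero, Matrix.cons_val_one]
  rw [ballWeight, one_sub_norm_ballParam_sq θ (Set.Ioo_subset_Icc_self ht)
    (Set.Ioo_subset_Icc_self hw), ← ENNReal.ofReal_mul (by positivity),
    ← ENNReal.ofReal_mul (by positivity), ← ENNReal.ofReal_mul (by positivity)]
  congr 1
  simp only [Matrix.cons_val_zero, Matrix.cons_val_one, Matrix.cons_val]
  rw [Real.mul_rpow (by positivity) h2.le, Real.mul_rpow h0.le h1.le, Real.sqrt_eq_rpow]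
  -- The Jacobian (1-w²)√(1-t²) raises the exponent μ - 1/2 to μ in t and to μ + 1/2 in w, and
  -- leaves it unchanged in u.
  have a1 : (1 - q.1.1 ^ 2) ^ μ = (1 - q.1.1 ^ 2) ^ (1 / 2 : ℝ) * (1 - q.1.1 ^ 2) ^ (μ - 1 / 2) := by
    rw [← Real.rpow_add h0]; congr 1; ring
  have a2 : (1 - q.1.2 ^ 2) ^ (μ + 1 / 2) = (1 - q.1.2 ^ 2) * (1 - q.1.2 ^ 2) ^ (μ - 1 / 2) := by
    nth_rewrite 2 [← Real.rpow_one (1 - q.1.2 ^ 2)]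
    rw [← Real.rpow_add h1]; congr 1; ring
  rw [a1, a2]
  ring

/-! ### Radon projections in coordinates -/

theorem isFiniteMeasure_coordMeasure {μ : ℝ} (hμ : 0 ≤ μ) : IsFiniteMeasure (coordMeasure μ) := by
  have := isFiniteMeasure_wMeasure (show -1 < μ by linarith)
  have := isFiniteMeasure_wMeasure (show -1 < μ + 1 / 2 by linarith)
  have := isFiniteMeasure_wMeasure (show -1 < μ - 1 / 2 by linarith)
  unfold coordMeasure
  infer_instance

theorem isFiniteMeasure_ballMeasure {μ : ℝ} (hμ : 0 ≤ μ) : IsFiniteMeasure (ballMeasure μ) := by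
  have := isFiniteMeasure_coordMeasure hμ
  rw [← (measurePreserving_ballCoord μ 0).map_eq]
  infer_instance

theorem ae_mem_ballMeasure (μ : ℝ) : ∀ᵐ y ∂ballMeasure μ, y ∈ Metric.closedBall (0 : E3) 1 :=
  (withDensity_absolutelyContinuous _ _).ae_le
    (ae_restrict_mem Metric.isClosed_closedBall.measurableSet)

theorem exists_bound_closedBall {Φ : E3 → ℝ} (hΦ : Continuous Φ) (μ : ℝ) :
    ∃ C, ∀ᵐ y ∂ballMeasure μ, ‖Φ y‖ ≤ C := by
  obtain ⟨C, hC⟩ := (isCompact_closedBall (0 : E3) 1).exists_bound_of_continuousOn hΦ.continuousOn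
  exact ⟨C, (ae_mem_ballMeasure μ).mono fun y hy => hC y hy⟩

theorem memLp_of_continuous {μ : ℝ} (hμ : 0 ≤ μ) {Φ : E3 → ℝ} (hΦ : Continuous Φ) (p : ENNReal) :
    MemLp Φ p (ballMeasure μ) := by
  have := isFiniteMeasure_ballMeasure hμ
  obtain ⟨C, hC⟩ := exists_bound_closedBall hΦ μ
  exact MemLp.of_bound hΦ.aestronglyMeasurable C hC

theorem mem_segment_iff {θ t w R : ℝ} (ht : t ∈ Set.Ioo (-1 : ℝ) 1) (hw : w ∈ Set.Ioo (-1 : ℝ) 1)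
    (hR : R = √(1 - w ^ 2) * √(1 - t ^ 2)) (u : ℝ) :
    R * u ∈ segment θ t w ↔ u ∈ Set.Icc (-1 : ℝ) 1 := by
  have h0 := one_sub_sq_pos ht
  have h1 := one_sub_sq_pos hw
  have hR2 : R ^ 2 = (1 - w ^ 2) * (1 - t ^ 2) := by
    rw [hR, mul_pow, Real.sq_sqrt h0.le, Real.sq_sqrt h1.le]
  have hn := norm_linePoint_sq θ t (R * u) (Set.Ioo_subset_Icc_self hw)
  rw [segment, Set.mem_ofPred_eq, mem_closedBall_zero_iff]
  rw [mul_pow, hR2] at hn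
  have hp : 0 < (1 - w ^ 2) * (1 - t ^ 2) := by positivity
  have h2 : ‖linePoint θ t w (R * u)‖ ≤ 1 ↔ ‖linePoint θ t w (R * u)‖ ^ 2 ≤ 1 :=
    (sq_le_one_iff₀ (norm_nonneg _)).symm
  rw [h2, hn, Set.mem_Icc, ← abs_le, ← sq_le_one_iff_abs_le_one]
  constructor
  · intro h
    by_contra hu
    push Not at hu
    nlinarith
  · intro h
    nlinarith

/-- R is half the length of the chord, so s = R u carries the chord to [-1, 1]. Indicators allow the
linear substitution to be made on the whole line. -/
theorem indicator_segment {μ : ℝ} (f : E3 → ℝ) {θ t w R : ℝ} (ht : t ∈ Set.Ioo (-1 : ℝ) 1)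
    (hw : w ∈ Set.Ioo (-1 : ℝ) 1) (hR : R = √(1 - w ^ 2) * √(1 - t ^ 2)) (u : ℝ) :
    (segment θ t w).indicator
      (fun s => f (linePoint θ t w s) * ballWeight μ (linePoint θ t w s)) (R * u) =
    (Set.Icc (-1 : ℝ) 1).indicator (fun u => ((1 - t ^ 2) * (1 - w ^ 2)) ^ (μ - 1 / 2) *
      ((1 - u ^ 2) ^ (μ - 1 / 2) * f (ballCoord θ ((t, w), u)))) u := by
  by_cases hu : u ∈ Set.Icc (-1 : ℝ) 1
  · rw [Set.indicator_of_mem ((mem_segment_iff ht hw hR u).2 hu), Set.indicator_of_mem hu]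
    have h0 := one_sub_sq_pos ht
    have h1 := one_sub_sq_pos hw
    have hb : linePoint θ t w (R * u) = ballParam θ ![t, w, u] := by
      rw [mul_comm, hR]; rfl
    have hc : ballCoord θ ((t, w), u) = ballParam θ ![t, w, u] := rfl
    have hn := one_sub_norm_ballParam_sq θ (v := ![t, w, u]) (Set.Ioo_subset_Icc_self ht)
      (Set.Ioo_subset_Icc_self hw)
    rw [hc, hb, ballWeight, hn]
    simp only [Matrix.cons_val_zero, Matrix.cons_val_one, Matrix.cons_val]
    rw [Real.mul_rpow (by positivity) (one_sub_sq_nonneg hu)]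
    ring
  · rw [Set.indicator_of_notMem (fun h => hu ((mem_segment_iff ht hw hR u).1 h)),
      Set.indicator_of_notMem hu]

theorem measurableSet_segment (θ t w : ℝ) : MeasurableSet (segment θ t w) := by
  have h : Continuous fun s => linePoint θ t w s :=
    (continuous_linePoint θ).comp (by fun_prop : Continuous fun s : ℝ => (t, w, s))
  exact (Metric.isClosed_closedBall.preimage h).measurableSet

theorem integrableOn_segment {μ : ℝ} (f : E3 → ℝ) {θ t w : ℝ} (ht : t ∈ Set.Ioo (-1 : ℝ) 1)
    (hw : w ∈ Set.Ioo (-1 : ℝ) 1)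
    (hf : Integrable (fun u => f (ballCoord θ ((t, w), u))) (wMeasure (μ - 1 / 2))) :
    IntegrableOn (fun s => f (linePoint θ t w s) * ballWeight μ (linePoint θ t w s))
      (segment θ t w) := by
  have h0 := one_sub_sq_pos ht
  have h1 := one_sub_sq_pos hw
  have hR : 0 < √(1 - w ^ 2) * √(1 - t ^ 2) := by positivity
  rw [← integrable_indicator_iff (measurableSet_segment _ _ _),
    ← integrable_comp_mul_left_iff _ hR.ne']
  simp_rw [indicator_segment f ht hw rfl]
  rw [integrable_indicator_iff measurableSet_Icc, integrableOn_Icc_iff_integrableOn_Ioo]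
  exact ((integrable_wMeasure_iff _ _).1 hf).const_mul _

/-- Under s = R u the factor R = √(1-w²)√(1-t²) raises both outer exponents from μ - 1/2 to μ. -/
theorem radon_eq {μ : ℝ} (f : E3 → ℝ) {θ t w : ℝ} (ht : t ∈ Set.Ioo (-1 : ℝ) 1)
    (hw : w ∈ Set.Ioo (-1 : ℝ) 1) :
    radon μ f θ t w = (1 - t ^ 2) ^ μ * (1 - w ^ 2) ^ μ *
      ∫ u, f (ballCoord θ ((t, w), u)) ∂wMeasure (μ - 1 / 2) := by
  have h0 := one_sub_sq_pos ht
  have h1 := one_sub_sq_pos hw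
  have hR : 0 < √(1 - w ^ 2) * √(1 - t ^ 2) := by positivity
  have h2 := Measure.integral_comp_mul_left ((segment θ t w).indicator
    (fun s => f (linePoint θ t w s) * ballWeight μ (linePoint θ t w s)))
    (√(1 - w ^ 2) * √(1 - t ^ 2))
  simp_rw [indicator_segment f ht hw rfl] at h2
  rw [integral_indicator measurableSet_Icc, integral_Icc_eq_integral_Ioo, integral_const_mul,
    ← integral_wMeasure, integral_indicator (measurableSet_segment _ _ _), abs_of_pos (by positivity),
    smul_eq_mul, eq_comm, inv_mul_eq_iff_eq_mul₀ hR.ne'] at h2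
  rw [radon, h2, Real.mul_rpow h0.le h1.le, Real.sqrt_eq_rpow, Real.sqrt_eq_rpow]
  have a1 : (1 - t ^ 2) ^ μ = (1 - t ^ 2) ^ (1 / 2 : ℝ) * (1 - t ^ 2) ^ (μ - 1 / 2) := by
    rw [← Real.rpow_add h0]; congr 1; ring
  have a2 : (1 - w ^ 2) ^ μ = (1 - w ^ 2) ^ (1 / 2 : ℝ) * (1 - w ^ 2) ^ (μ - 1 / 2) := by
    rw [← Real.rpow_add h1]; congr 1; ring
  rw [a1, a2]
  ring

theorem volume_restrict_Icc_prod_Icc :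
    (volume : Measure (ℝ × ℝ)).restrict (Set.Icc (-1) 1 ×ˢ Set.Icc (-1) 1) =
      volume.restrict (Set.Ioo (-1) 1 ×ˢ Set.Ioo (-1) 1) := by
  rw [Measure.volume_eq_prod, ← Measure.prod_restrict, ← Measure.prod_restrict,
    Measure.restrict_congr_set Ioo_ae_eq_Icc]

theorem prod_wMeasure (ν ν' : ℝ) : (wMeasure ν).prod (wMeasure ν') =
    ((volume : Measure (ℝ × ℝ)).restrict (Set.Ioo (-1) 1 ×ˢ Set.Ioo (-1) 1)).withDensity
      (fun p => ENNReal.ofReal ((1 - p.1 ^ 2) ^ ν) * ENNReal.ofReal ((1 - p.2 ^ 2) ^ ν')) := by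
  unfold wMeasure
  rw [prod_withDensity (by fun_prop) (by fun_prop), Measure.prod_restrict]
  rfl

/-- Fubini gives integrability in u for almost every (t, w) with respect to the weighted measure;
the weights are positive on the open square, so its null sets there are the Lebesgue null sets. -/
theorem ae_integrableOn_segment {μ : ℝ} (hμ : 0 ≤ μ) {f : E3 → ℝ}
    (hf : Integrable f (ballMeasure μ)) (ξ : ℝ) :
    ∀ᵐ p : ℝ × ℝ ∂(volume.restrict (Set.Icc (-1) 1 ×ˢ Set.Icc (-1) 1)),
      IntegrableOn (fun s => f (linePoint ξ p.1 p.2 s) * ballWeight μ (linePoint ξ p.1 p.2 s))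
        (segment ξ p.1 p.2) := by
  have := isFiniteMeasure_wMeasure (show -1 < μ by linarith)
  have := isFiniteMeasure_wMeasure (show -1 < μ + 1 / 2 by linarith)
  have := isFiniteMeasure_wMeasure (show -1 < μ - 1 / 2 by linarith)
  have h1 := ((measurePreserving_ballCoord μ ξ).integrable_comp_of_integrable hf).prod_right_ae
  have hmem : ∀ᵐ p : ℝ × ℝ ∂(volume.restrict (Set.Ioo (-1) 1 ×ˢ Set.Ioo (-1) 1)),
      p ∈ (Set.Ioo (-1 : ℝ) 1 ×ˢ Set.Ioo (-1 : ℝ) 1) :=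
    ae_restrict_mem (measurableSet_Ioo.prod measurableSet_Ioo)
  rw [volume_restrict_Icc_prod_Icc]
  rw [prod_wMeasure] at h1
  have hac : (volume.restrict (Set.Ioo (-1 : ℝ) 1 ×ˢ Set.Ioo (-1 : ℝ) 1)) ≪ _ :=
    withDensity_absolutelyContinuous' (f := fun p : ℝ × ℝ => ENNReal.ofReal ((1 - p.1 ^ 2) ^ μ) *
      ENNReal.ofReal ((1 - p.2 ^ 2) ^ (μ + 1 / 2))) (by fun_prop) (by
        filter_upwards [hmem] with p hp
        have a1 := Real.rpow_pos_of_pos (one_sub_sq_pos hp.1) μ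
        have a2 := Real.rpow_pos_of_pos (one_sub_sq_pos hp.2) (μ + 1 / 2)
        exact (ENNReal.mul_pos (ENNReal.ofReal_pos.2 a1).ne' (ENNReal.ofReal_pos.2 a2).ne').ne')
  filter_upwards [hac.ae_le h1, hmem] with p hp hp'
  exact integrableOn_segment f hp'.1 hp'.2 hp

/-- Fubini in the adapted coordinates, with the weights in t and w moved into the integrand. Values
of J on the boundary of the square are irrelevant. -/
theorem integral_eq_integral_ballMeasure {μ : ℝ} (hμ : 0 ≤ μ) {h : E3 → ℝ}
    (hh : Integrable h (ballMeasure μ)) (ξ : ℝ) {J : ℝ → ℝ → ℝ}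
    (hJ : ∀ t ∈ Set.Ioo (-1 : ℝ) 1, ∀ w ∈ Set.Ioo (-1 : ℝ) 1,
      J t w = (1 - t ^ 2) ^ μ * (1 - w ^ 2) ^ (μ + 1 / 2) *
        ∫ u, h (ballCoord ξ ((t, w), u)) ∂wMeasure (μ - 1 / 2)) :
    IntegrableOn (fun p : ℝ × ℝ => J p.1 p.2) (Set.Icc (-1) 1 ×ˢ Set.Icc (-1) 1) ∧
      ∫ w in (-1 : ℝ)..1, ∫ t in (-1 : ℝ)..1, J t w = ∫ y, h y ∂ballMeasure μ := by
  have := isFiniteMeasure_wMeasure (show -1 < μ by linarith)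
  have := isFiniteMeasure_wMeasure (show -1 < μ + 1 / 2 by linarith)
  have := isFiniteMeasure_wMeasure (show -1 < μ - 1 / 2 by linarith)
  have hmp := measurePreserving_ballCoord μ ξ
  have hc := hmp.integrable_comp_of_integrable hh
  have hm : Integrable (fun p : ℝ × ℝ => ∫ u, h (ballCoord ξ (p, u)) ∂wMeasure (μ - 1 / 2))
    ((wMeasure μ).prod (wMeasure (μ + 1 / 2))) := hc.integral_prod_left
  have hint : ∫ y, h y ∂ballMeasure μ = ∫ p : ℝ × ℝ, ∫ u, h (ballCoord ξ (p, u))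
      ∂wMeasure (μ - 1 / 2) ∂((wMeasure μ).prod (wMeasure (μ + 1 / 2))) := by
    rw [← hmp.map_eq, integral_map hmp.measurable.aemeasurable
      (by rw [hmp.map_eq]; exact hh.aestronglyMeasurable)]
    exact integral_prod _ hc
  have hmeas : Measurable (fun p : ℝ × ℝ => ENNReal.ofReal ((1 - p.1 ^ 2) ^ μ) *
      ENNReal.ofReal ((1 - p.2 ^ 2) ^ (μ + 1 / 2))) := by fun_prop
  have hlt : ∀ᵐ p : ℝ × ℝ ∂(volume.restrict (Set.Ioo (-1 : ℝ) 1 ×ˢ Set.Ioo (-1 : ℝ) 1)),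
      ENNReal.ofReal ((1 - p.1 ^ 2) ^ μ) * ENNReal.ofReal ((1 - p.2 ^ 2) ^ (μ + 1 / 2)) < ⊤ :=
    Filter.Eventually.of_forall fun p => ENNReal.mul_lt_top ENNReal.ofReal_lt_top
      ENNReal.ofReal_lt_top
  have hcongr : (fun p : ℝ × ℝ => (ENNReal.ofReal ((1 - p.1 ^ 2) ^ μ) *
      ENNReal.ofReal ((1 - p.2 ^ 2) ^ (μ + 1 / 2))).toReal •
        ∫ u, h (ballCoord ξ (p, u)) ∂wMeasure (μ - 1 / 2)) =ᵐ[volume.restrict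
          (Set.Ioo (-1 : ℝ) 1 ×ˢ Set.Ioo (-1 : ℝ) 1)] fun p => J p.1 p.2 := by
    filter_upwards [ae_restrict_mem (measurableSet_Ioo.prod measurableSet_Ioo)] with p hp
    have a1 := Real.rpow_pos_of_pos (one_sub_sq_pos hp.1) μ
    have a2 := Real.rpow_pos_of_pos (one_sub_sq_pos hp.2) (μ + 1 / 2)
    rw [hJ _ hp.1 _ hp.2, ENNReal.toReal_mul, ENNReal.toReal_ofReal a1.le,
      ENNReal.toReal_ofReal a2.le, smul_eq_mul]
  have hI : Integrable (fun p : ℝ × ℝ => J p.1 p.2)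
      (volume.restrict (Set.Ioo (-1) 1 ×ˢ Set.Ioo (-1) 1)) := by
    rw [← integrable_congr hcongr, ← integrable_withDensity_iff_integrable_smul' hmeas hlt,
      ← prod_wMeasure]
    exact hm
  constructor
  · rw [IntegrableOn, volume_restrict_Icc_prod_Icc]
    exact hI
  · rw [hint, prod_wMeasure, integral_withDensity_eq_integral_toReal_smul hmeas hlt,
      integral_congr_ae hcongr, Measure.volume_eq_prod, ← Measure.prod_restrict, integral_prod_symm]
    · rw [intervalIntegral.integral_of_le (by norm_num), integral_Ioc_eq_integral_Ioo]
      refine integral_congr_ae (Filter.Eventually.of_forall fun w => ?_)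
      simp only
      rw [intervalIntegral.integral_of_le (by norm_num), integral_Ioc_eq_integral_Ioo]
    · rw [Measure.prod_restrict]
      exact hI

/-- The double integral against the kernel as an integral over the ball. -/
theorem integral_radonIntegrand {μ : ℝ} (hμ : 0 ≤ μ) {f : E3 → ℝ}
    (hf : Integrable f (ballMeasure μ)) (l : ℕ) (ξ : ℝ) (x : E3) {Φ : E3 → ℝ} (hΦ : Continuous Φ)
    (hG : ∀ t ∈ Set.Ioo (-1 : ℝ) 1, ∀ w ∈ Set.Ioo (-1 : ℝ) 1, ∀ u,
      kernelG μ l ξ t w x = Φ (ballCoord ξ ((t, w), u))) :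
    IntegrableOn (fun p : ℝ × ℝ => radonIntegrand μ l f ξ x p.1 p.2)
        (Set.Icc (-1) 1 ×ˢ Set.Icc (-1) 1) ∧
      ∫ w in (-1 : ℝ)..1, ∫ t in (-1 : ℝ)..1, radonIntegrand μ l f ξ x t w =
        ∫ y, f y * Φ y ∂ballMeasure μ := by
  obtain ⟨C, hC⟩ := exists_bound_closedBall hΦ μ
  refine integral_eq_integral_ballMeasure hμ (hf.mul_bdd hΦ.aestronglyMeasurable hC) ξ ?_
  intro t ht w hw
  have h1 := one_sub_sq_pos hw
  have h2 : ∫ u, f (ballCoord ξ ((t, w), u)) * Φ (ballCoord ξ ((t, w), u)) ∂wMeasure (μ - 1 / 2) =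
      (∫ u, f (ballCoord ξ ((t, w), u)) ∂wMeasure (μ - 1 / 2)) * kernelG μ l ξ t w x := by
    rw [← integral_mul_const]
    refine integral_congr_ae (Filter.Eventually.of_forall fun u => ?_)
    simp only
    rw [hG t ht w hw u]
  -- The factor √(1-w²) of the double integral supplies the missing half in the exponent of 1 - w².
  rw [h2, radonIntegrand, radon_eq f ht hw, Real.sqrt_eq_rpow, Real.rpow_add h1]
  ring

/-! ### Ridge polynomials in three variables -/

theorem mem_polyLT_succ {n : ℕ} {P : MvPolynomial (Fin 3) ℝ} :
    P ∈ polyLT (n + 1) ↔ P.totalDegree ≤ n := by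
  rw [polyLT, MvPolynomial.mem_restrictSupport_iff, MvPolynomial.totalDegree, Finset.sup_le_iff]
  constructor
  · intro h s hs
    exact Nat.lt_succ_iff.1 (h hs)
  · intro h s hs
    exact Nat.lt_succ_iff.2 (h s hs)

theorem polyLT_mono {m n : ℕ} (h : m ≤ n) : polyLT m ≤ polyLT n :=
  MvPolynomial.restrictSupport_mono ℝ fun _ hs => lt_of_lt_of_le hs h

theorem mul_mem_polyLT {m n N : ℕ} {P Q : MvPolynomial (Fin 3) ℝ} (hP : P.totalDegree ≤ m)
    (hQ : Q.totalDegree ≤ n) (hN : m + n < N) : P * Q ∈ polyLT N :=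
  polyLT_mono hN (mem_polyLT_succ.2 ((MvPolynomial.totalDegree_mul _ _).trans (add_le_add hP hQ)))

/-- The linear polynomial `x₁ cos η + x₂ sin η`. -/
noncomputable def ridge (η : ℝ) : MvPolynomial (Fin 3) ℝ :=
  MvPolynomial.C (Real.cos η) * MvPolynomial.X 0 + MvPolynomial.C (Real.sin η) * MvPolynomial.X 1

theorem totalDegree_ridge_pow_le (η : ℝ) (a : ℕ) : (ridge η ^ a).totalDegree ≤ a := by
  have h : (ridge η).totalDegree ≤ 1 := by
    refine (MvPolynomial.totalDegree_add _ _).trans (max_le ?_ ?_) <;>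
    · refine (MvPolynomial.totalDegree_mul _ _).trans ?_
      simp
  exact (MvPolynomial.totalDegree_pow _ _).trans (by nlinarith)

theorem ridge_pow_mul_X_pow_mem (η : ℝ) {a c N : ℕ} (h : a + c < N) :
    ridge η ^ a * MvPolynomial.X 2 ^ c ∈ polyLT N :=
  mul_mem_polyLT (totalDegree_ridge_pow_le η a) (by simp) h

/-- Powers of the linear forms span the binary forms. -/
theorem X_pow_mul_mem_span_ridge {a i c : ℕ} (hi : i ≤ a) :
    (MvPolynomial.X 0 ^ (a - i) * MvPolynomial.X 1 ^ i * MvPolynomial.X 2 ^ c : MvPolynomial (Fin 3) ℝ) ∈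
      Submodule.span ℝ (Set.range fun η : ℝ => ridge η ^ a * MvPolynomial.X 2 ^ c) := by
  by_contra hmem
  -- A functional φ that vanishes on all ridge powers makes q(T) vanish for every slope T = tan η,
  -- since cos(arctan T) ≠ 0. The coefficients of q are nonzero multiples of the values of φ on the
  -- monomials.
  obtain ⟨φ, hφ, hker⟩ := Submodule.exists_le_ker_of_notMem hmem
  set q : ℝ[X] := ∑ j ∈ Finset.range (a + 1), Polynomial.C
    ((a.choose j : ℝ) *
      φ (MvPolynomial.X 0 ^ (a - j) * MvPolynomial.X 1 ^ j * MvPolynomial.X 2 ^ c)) *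
        Polynomial.X ^ j with hq
  have hq0 : q = 0 := by
    refine Polynomial.funext fun T => ?_
    have hc : Real.cos (Real.arctan T) ≠ 0 := (Real.cos_arctan_pos T).ne'
    have h1 : φ (ridge (Real.arctan T) ^ a * MvPolynomial.X 2 ^ c) = 0 :=
      hker (Submodule.subset_span ⟨Real.arctan T, rfl⟩)
    have hs : Real.sin (Real.arctan T) = T * Real.cos (Real.arctan T) := by
      rw [← Real.tan_mul_cos hc, Real.tan_arctan]
    have h2 : ridge (Real.arctan T) ^ a * MvPolynomial.X 2 ^ c =
        Real.cos (Real.arctan T) ^ a • ∑ j ∈ Finset.range (a + 1),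
          ((a.choose j : ℝ) * T ^ j) • (MvPolynomial.X 0 ^ (a - j) * MvPolynomial.X 1 ^ j * MvPolynomial.X 2 ^ c :
            MvPolynomial (Fin 3) ℝ) := by
      have h3 : ridge (Real.arctan T) = MvPolynomial.C (Real.cos (Real.arctan T)) *
          (MvPolynomial.C T * MvPolynomial.X 1 + MvPolynomial.X 0) := by
        rw [ridge, hs, MvPolynomial.C.map_mul]
        ring
      rw [h3, mul_pow, add_pow, MvPolynomial.smul_eq_C_mul, ← MvPolynomial.C.map_pow, mul_assoc,
        Finset.sum_mul]
      congr 1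
      refine Finset.sum_congr rfl fun j _ => ?_
      rw [MvPolynomial.smul_eq_C_mul, MvPolynomial.C.map_mul, MvPolynomial.C.map_pow, mul_pow, map_natCast]
      ring
    rw [h2, map_smul, smul_eq_mul, map_sum] at h1
    have h4 := (mul_eq_zero.1 h1).resolve_left (pow_ne_zero _ hc)
    rw [hq, eval_finsetSum, Polynomial.eval_zero, ← h4]
    refine Finset.sum_congr rfl fun j _ => ?_
    rw [map_smul, smul_eq_mul]
    simp
    ring
  have hco : q.coeff i = 0 := by rw [hq0, coeff_zero]
  rw [hq, finsetSum_coeff] at hco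
  simp_rw [Polynomial.coeff_C_mul_X_pow] at hco
  rw [Finset.sum_ite_eq, if_pos (Finset.mem_range.2 (by omega))] at hco
  refine hφ ((mul_eq_zero.1 hco).resolve_left ?_)
  exact_mod_cast (Nat.choose_pos hi).ne'

theorem polyLT_le {n : ℕ} {M : Submodule ℝ (MvPolynomial (Fin 3) ℝ)}
    (h : ∀ a c η, a + c < n → ridge η ^ a * MvPolynomial.X 2 ^ c ∈ M) : polyLT n ≤ M := by
  intro P hP
  rw [polyLT, MvPolynomial.mem_restrictSupport_iff] at hP
  rw [P.as_sum]
  refine Submodule.sum_mem _ fun s hs => ?_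
  have hd : s.degree < n := hP hs
  rw [Finsupp.degree_eq_sum, Fin.sum_univ_three] at hd
  rw [MvPolynomial.monomial_eq, Finsupp.prod_fintype _ _ (by simp), Fin.prod_univ_three,
    ← MvPolynomial.smul_eq_C_mul]
  refine M.smul_mem _ ?_
  have h1 := X_pow_mul_mem_span_ridge (a := s 0 + s 1) (i := s 1) (c := s 2) (by omega)
  rw [Nat.add_sub_cancel] at h1
  refine Submodule.span_le.2 ?_ h1
  rintro _ ⟨η, rfl⟩
  exact h _ _ _ hd

/-- The polynomial `C_{l-k}^{k+μ+1}(x₃) r^k C_k^{μ+1/2}(⟨η, x⟩ / r)` with `r^2 = 1 - x₃^2`. -/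
noncomputable def ridgePoly (μ : ℝ) (l k : ℕ) (η : ℝ) : MvPolynomial (Fin 3) ℝ :=
  diagSum k fun p j => ridge η ^ p * Polynomial.aeval (MvPolynomial.X 2)
    (Polynomial.C (gegenCoeff (μ + 1 / 2) p j * 2 ^ p) *
      (gegenPoly (l - k) (k + μ + 1) * (1 - Polynomial.X ^ 2) ^ j))

theorem ridge_pow_mul_aeval_sub_mem (η : ℝ) {a d : ℕ} {q : ℝ[X]} (hq : q.natDegree ≤ d) :
    ridge η ^ a * Polynomial.aeval (MvPolynomial.X 2) q - q.coeff d • (ridge η ^ a * MvPolynomial.X 2 ^ d) ∈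
      polyLT (a + d) := by
  rw [aeval_eq_sum_range' (Nat.lt_succ_of_le hq), Finset.sum_range_succ, mul_add, mul_smul_comm,
    add_sub_cancel_right, Finset.mul_sum]
  refine Submodule.sum_mem _ fun i hi => ?_
  rw [mul_smul_comm]
  refine Submodule.smul_mem _ _ (ridge_pow_mul_X_pow_mem η ?_)
  have := Finset.mem_range.1 hi
  omega

/-- The span of the ridge polynomials of degree `l`. -/
noncomputable def ridgeSpan (μ : ℝ) (l : ℕ) : Submodule ℝ (MvPolynomial (Fin 3) ℝ) :=
  Submodule.span ℝ {P | ∃ k ≤ l, ∃ η, P = ridgePoly μ l k η}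

theorem ridgePoly_mem (μ : ℝ) {l k : ℕ} (hk : k ≤ l) (η : ℝ) : ridgePoly μ l k η ∈ ridgeSpan μ l :=
  Submodule.subset_span ⟨k, hk, η, rfl⟩

theorem natDegree_ridge_factor (μ : ℝ) (l k p j : ℕ) :
    (Polynomial.C (gegenCoeff (μ + 1 / 2) p j * 2 ^ p) *
      (gegenPoly (l - k) (k + μ + 1) * (1 - Polynomial.X ^ 2) ^ j)).natDegree ≤ l - k + 2 * j :=
  (natDegree_C_mul_le _ _).trans (natDegree_mul_le.trans
    (add_le_add (natDegree_gegenPoly_le _ _) (natDegree_one_sub_sq_pow_le _)))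

theorem ridgePoly_mem_polyLT (μ : ℝ) {l k : ℕ} (hk : k ≤ l) (η : ℝ) :
    ridgePoly μ l k η ∈ polyLT (l + 1) := by
  refine (polyLT (l + 1)).sum_mem fun j hj => ?_
  have hj := Finset.mem_range.1 hj
  have h := ridge_pow_mul_aeval_sub_mem η (a := k - 2 * j)
    (natDegree_ridge_factor μ l k (k - 2 * j) j)
  have h1 := polyLT_mono (show k - 2 * j + (l - k + 2 * j) ≤ l + 1 by omega) h
  have h2 := Submodule.smul_mem (polyLT (l + 1)) ((Polynomial.C
    (gegenCoeff (μ + 1 / 2) (k - 2 * j) j * 2 ^ (k - 2 * j)) *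
      (gegenPoly (l - k) (k + μ + 1) * (1 - Polynomial.X ^ 2) ^ j)).coeff (l - k + 2 * j))
    (ridge_pow_mul_X_pow_mem η (show k - 2 * j + (l - k + 2 * j) < l + 1 by omega))
  simpa using Submodule.add_mem _ h1 h2

theorem ridgeSpan_le (μ : ℝ) (l : ℕ) : ridgeSpan μ l ≤ polyLT (l + 1) := by
  refine Submodule.span_le.2 ?_
  rintro _ ⟨k, hk, η, rfl⟩
  exact ridgePoly_mem_polyLT μ hk η

/-- Modulo lower degree, the j = 0 term of the ridge polynomial is a positive multiple of the
product in question, and the terms j ≥ 1 are multiples of such products with k - 2j in place of k.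
Strong induction on k inverts this triangular system. -/
theorem ridge_pow_mul_X_pow_mem_sup {μ : ℝ} (hμ : 0 ≤ μ) {l k : ℕ} (hk : k ≤ l) (η : ℝ) :
    ridge η ^ k * MvPolynomial.X 2 ^ (l - k) ∈ ridgeSpan μ l ⊔ polyLT l := by
  induction k using Nat.strong_induction_on with
  | _ k ih =>
    set M := ridgeSpan μ l ⊔ polyLT l
    have hF : ridgePoly μ l k η ∈ M := Submodule.mem_sup_left (ridgePoly_mem μ hk η)
    rw [ridgePoly, diagSum, Finset.sum_range_succ'] at hF
    rw [M.add_mem_iff_right] at hF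
    · have h := ridge_pow_mul_aeval_sub_mem η (a := k) (natDegree_ridge_factor μ l k k 0)
      rw [show k + (l - k + 2 * 0) = l by omega, mul_zero, add_zero] at h
      have h2 := M.sub_mem hF (Submodule.mem_sup_right h)
      rw [mul_zero, Nat.sub_zero, sub_sub_cancel] at h2
      refine (Submodule.smul_mem_iff _ ?_).1 h2
      rw [pow_zero, mul_one, coeff_C_mul, coeff_gegenPoly_self]
      have r1 := rising_pos (show 0 < μ + 1 / 2 by positivity) k
      have r2 := rising_pos (show 0 < (k : ℝ) + μ + 1 by positivity) (l - k)
      simp only [gegenCoeff, add_zero]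
      positivity
    · refine M.sum_mem fun j hj => ?_
      have hj := Finset.mem_range.1 hj
      have h := ridge_pow_mul_aeval_sub_mem η (a := k - 2 * (j + 1))
        (natDegree_ridge_factor μ l k (k - 2 * (j + 1)) (j + 1))
      rw [show k - 2 * (j + 1) + (l - k + 2 * (j + 1)) = l by omega,
        show l - k + 2 * (j + 1) = l - (k - 2 * (j + 1)) by omega] at h
      have h3 := ih (k - 2 * (j + 1)) (by omega) (by omega)
      have h4 := M.add_mem (Submodule.mem_sup_right h) (M.smul_mem ((Polynomial.C
        (gegenCoeff (μ + 1 / 2) (k - 2 * (j + 1)) (j + 1) * 2 ^ (k - 2 * (j + 1))) *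
        (gegenPoly (l - k) (k + μ + 1) * (1 - Polynomial.X ^ 2) ^ (j + 1))).coeff
          (l - (k - 2 * (j + 1)))) h3)
      rwa [sub_add_cancel] at h4

theorem polyLT_succ_le {μ : ℝ} (hμ : 0 ≤ μ) (l : ℕ) : polyLT (l + 1) ≤ ridgeSpan μ l ⊔ polyLT l := by
  refine polyLT_le fun a c η h => ?_
  rcases Nat.lt_or_ge (a + c) l with h1 | h1
  · exact Submodule.mem_sup_right (ridge_pow_mul_X_pow_mem η h1)
  · rw [show c = l - a by omega]
    exact ridge_pow_mul_X_pow_mem_sup hμ (by omega) η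

/-! ### Values of ridge polynomials -/

/-- `r^k C_k^lam (s / r)` as a function of `s` and `b = r^2`. -/
noncomputable def homGegenbauer (k : ℕ) (lam s b : ℝ) : ℝ :=
  diagSum k fun p j => gegenCoeff lam p j * (2 * s) ^ p * b ^ j

theorem homGegenbauer_mul (k : ℕ) (lam r t : ℝ) :
    homGegenbauer k lam (r * t) (r ^ 2) = r ^ k * gegenbauer k lam t := by
  rw [homGegenbauer, gegenbauer_eq_diagSum, mul_diagSum]
  refine diagSum_congr fun p j hpj => ?_
  rw [← hpj]
  ring

theorem polyEval_ridge (η : ℝ) (y : E3) :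
    polyEval (ridge η) y = y 0 * Real.cos η + y 1 * Real.sin η := by
  simp [polyEval, ridge]
  ring

theorem polyEval_ridgePoly (μ : ℝ) (l k : ℕ) (η : ℝ) (y : E3) :
    polyEval (ridgePoly μ l k η) y = gegenbauer (l - k) (k + μ + 1) (y 2) *
      homGegenbauer k (μ + 1 / 2) (y 0 * Real.cos η + y 1 * Real.sin η) (1 - y 2 ^ 2) := by
  have h := polyEval_ridge η y
  unfold polyEval at *
  rw [ridgePoly, map_diagSum, homGegenbauer, mul_diagSum]
  refine diagSum_congr fun p j _ => ?_
  have h2 : ∀ q : ℝ[X], MvPolynomial.eval (fun i => y i) (Polynomial.aeval (MvPolynomial.X 2) q) =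
      q.eval (y 2) := by
    intro q
    rw [← MvPolynomial.coe_aeval_eq_eval, RingHom.coe_coe, ← Polynomial.aeval_algHom_apply]
    simp
  rw [map_mul, map_pow, h, h2]
  simp only [eval_mul, eval_C, eval_pow, eval_sub, eval_one, eval_X, eval_gegenPoly, mul_pow]
  ring

theorem continuous_polyEval (P : MvPolynomial (Fin 3) ℝ) : Continuous (polyEval P) := by
  have : Continuous fun x : E3 => fun i => x i := by fun_prop
  exact (MvPolynomial.continuous_eval P).comp this

/-! ### Inner products of ridge polynomials over the ball -/

theorem ballCoord_two (ξ t w u : ℝ) : ballCoord ξ ((t, w), u) 2 = w := by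
  simp [ballCoord, linePoint]

theorem ballCoord_ridge (ξ η t w u : ℝ) :
    ballCoord ξ ((t, w), u) 0 * Real.cos η + ballCoord ξ ((t, w), u) 1 * Real.sin η =
      √(1 - w ^ 2) * (t * Real.cos (η - ξ) + u * √(1 - t ^ 2) * Real.sin (η - ξ)) := by
  simp only [ballCoord, linePoint, Real.cos_sub, Real.sin_sub]
  simp
  ring

theorem polyEval_ridgePoly_ballCoord (μ : ℝ) (l k : ℕ) (ξ η t u : ℝ) {w : ℝ}
    (hw : w ∈ Set.Icc (-1 : ℝ) 1) :
    polyEval (ridgePoly μ l k η) (ballCoord ξ ((t, w), u)) =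
      gegenbauer (l - k) (k + μ + 1) w * (√(1 - w ^ 2) ^ k *
        gegenbauer k (μ + 1 / 2) (t * Real.cos (η - ξ) + u * √(1 - t ^ 2) * Real.sin (η - ξ))) := by
  rw [polyEval_ridgePoly, ballCoord_two, ballCoord_ridge, ← homGegenbauer_mul,
    Real.sq_sqrt (one_sub_sq_nonneg hw)]

/-- Fubini for the shape that occurs when one factor is a ridge function in the direction ξ: that
factor is free of u, and the other one is averaged over the chord. -/
theorem integral_ballMeasure_eq {μ : ℝ} (hμ : 0 ≤ μ) {g : E3 → ℝ} (hg : Continuous g) (ξ : ℝ)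
    {A : ℝ → ℝ} {p B : ℝ[X]} {h : ℝ → ℝ → ℝ}
    (hgf : ∀ t ∈ Set.Ioo (-1 : ℝ) 1, ∀ w ∈ Set.Ioo (-1 : ℝ) 1, ∀ u,
      g (ballCoord ξ ((t, w), u)) = A w * p.eval t * h t u)
    (hB : ∀ t ∈ Set.Ioo (-1 : ℝ) 1, ∫ u, h t u ∂wMeasure (μ - 1 / 2) = B.eval t) :
    ∫ y, g y ∂ballMeasure μ = (∫ w, A w ∂wMeasure (μ + 1 / 2)) * wInt μ (p * B) := by
  have := isFiniteMeasure_wMeasure (show -1 < μ by linarith)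
  have := isFiniteMeasure_wMeasure (show -1 < μ + 1 / 2 by linarith)
  have := isFiniteMeasure_wMeasure (show -1 < μ - 1 / 2 by linarith)
  have hmp := measurePreserving_ballCoord μ ξ
  have hgi : Integrable g (ballMeasure μ) :=
    memLp_one_iff_integrable.1 (memLp_of_continuous hμ hg 1)
  have hc := hmp.integrable_comp_of_integrable hgi
  have hint : ∫ y, g y ∂ballMeasure μ = ∫ q : ℝ × ℝ, ∫ u, g (ballCoord ξ (q, u))
      ∂wMeasure (μ - 1 / 2) ∂((wMeasure μ).prod (wMeasure (μ + 1 / 2))) := by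
    rw [← hmp.map_eq, integral_map hmp.measurable.aemeasurable
      (by rw [hmp.map_eq]; exact hgi.aestronglyMeasurable)]
    exact integral_prod _ hc
  have h1 : ∀ᵐ q : ℝ × ℝ ∂((wMeasure μ).prod (wMeasure (μ + 1 / 2))), q.1 ∈ Set.Ioo (-1 : ℝ) 1 :=
    Measure.quasiMeasurePreserving_fst.ae (ae_mem_wMeasure μ)
  have h2 : ∀ᵐ q : ℝ × ℝ ∂((wMeasure μ).prod (wMeasure (μ + 1 / 2))), q.2 ∈ Set.Ioo (-1 : ℝ) 1 :=
    Measure.quasiMeasurePreserving_snd.ae (ae_mem_wMeasure (μ + 1 / 2))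
  rw [hint, mul_comm, wInt, ← integral_prod_mul]
  refine integral_congr_ae ?_
  filter_upwards [h1, h2] with q hq1 hq2
  have h3 : ∀ u, g (ballCoord ξ (q, u)) = A q.2 * p.eval q.1 * h q.1 u :=
    fun u => hgf _ hq1 _ hq2 u
  simp_rw [h3]
  rw [integral_const_mul, hB _ hq1, eval_mul]
  ring

theorem sqrt_pow_two_mul {w : ℝ} (hw : w ∈ Set.Icc (-1 : ℝ) 1) (m : ℕ) :
    √(1 - w ^ 2) ^ (2 * m) = (1 - w ^ 2) ^ m := by
  rw [pow_mul, Real.sq_sqrt (one_sub_sq_nonneg hw)]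

/-- In the coordinates of ξ the t-integral vanishes by orthogonality if a < k and by parity if a + k
is odd. In the remaining case the w-integral vanishes. -/
theorem integral_ridgePoly_mul_ridge_pow {μ : ℝ} (hμ : 0 ≤ μ) {l k a c : ℕ} (h : a + c < l) (ξ η : ℝ) :
    ∫ y, polyEval (ridgePoly μ l k ξ) y * polyEval (ridge η ^ a * MvPolynomial.X 2 ^ c) y
      ∂ballMeasure μ = 0 := by
  rw [integral_ballMeasure_eq hμ (g := fun y => polyEval (ridgePoly μ l k ξ) y *
      polyEval (ridge η ^ a * MvPolynomial.X 2 ^ c) y) ((continuous_polyEval _).mul (continuous_polyEval _)) ξ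
    (A := fun w => gegenbauer (l - k) (k + μ + 1) w * √(1 - w ^ 2) ^ (k + a) * w ^ c)
    (p := gegenPoly k (μ + 1 / 2)) (h := fun t u => (t * Real.cos (η - ξ) +
      u * √(1 - t ^ 2) * Real.sin (η - ξ)) ^ a)
    (B := chordPoly (μ - 1 / 2) a (Real.cos (η - ξ)) (Real.sin (η - ξ)))]
  · rcases Nat.lt_or_ge a k with hak | hak
    · rw [wInt_gegenPoly_mul_chordPoly_of_lt hμ hak, mul_zero]
    · rcases Nat.mod_two_eq_zero_or_one (k + a) with he | ho
      -- Now √(1-w²)^{k+a} = (1-w²)^{k+j}. The factor (1-w²)^k completes the weight of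
      -- C_{l-k}^{k+μ+1}, and the polynomial left over has degree at most c + 2j < l - k.
      · obtain ⟨j, rfl⟩ : ∃ j, a = k + 2 * j := ⟨(a - k) / 2, by omega⟩
        convert zero_mul _
        have h1 := wInt_gegenPoly_mul_eq_zero (show 0 < (k : ℝ) + μ + 1 by positivity) (l - k)
          (Q := (1 - Polynomial.X ^ 2) ^ j * Polynomial.X ^ c) (by
            refine degree_le_natDegree.trans_lt ?_
            have := natDegree_X_pow_mul_one_sub c j
            rw [mul_comm] at this
            exact_mod_cast this.trans_lt (show c + 2 * j < l - k by omega))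
        rw [show (k : ℝ) + μ + 1 - 1 / 2 = μ + 1 / 2 + k by ring, ← wInt_one_sub_sq_pow_mul,
          wInt] at h1
        rw [← h1]
        refine integral_congr_ae ?_
        filter_upwards [ae_mem_wMeasure (μ + 1 / 2)] with w hw
        rw [show k + (k + 2 * j) = 2 * (k + j) by ring, sqrt_pow_two_mul (Set.Ioo_subset_Icc_self hw)]
        simp only [eval_mul, eval_pow, eval_sub, eval_one, eval_X, eval_gegenPoly]
        ring
      · rw [wInt_gegenPoly_mul_chordPoly_of_odd μ ho, mul_zero]
  · intro t ht w hw u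
    have h1 : polyEval (ridge η ^ a * MvPolynomial.X 2 ^ c) (ballCoord ξ ((t, w), u)) =
        polyEval (ridge η) (ballCoord ξ ((t, w), u)) ^ a * w ^ c := by
      simp [polyEval, ballCoord_two]
    rw [h1, polyEval_ridge, ballCoord_ridge,
      polyEval_ridgePoly_ballCoord _ _ _ _ _ _ _ (Set.Ioo_subset_Icc_self hw), sub_self,
      Real.cos_zero, Real.sin_zero, eval_gegenPoly, mul_one, mul_zero, add_zero, mul_pow]
    ring
  · intro t ht
    exact integral_chord (by linarith) _ _ _ (Set.Ioo_subset_Icc_self ht)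

theorem integral_ridgePoly_mul_ridgePoly {μ : ℝ} (hμ : 0 ≤ μ) (l k k' : ℕ) (ξ η : ℝ) :
    ∫ y, polyEval (ridgePoly μ l k ξ) y * polyEval (ridgePoly μ l k' η) y ∂ballMeasure μ =
      (∫ w, gegenbauer (l - k) (k + μ + 1) w * gegenbauer (l - k') (k' + μ + 1) w *
        √(1 - w ^ 2) ^ (k + k') ∂wMeasure (μ + 1 / 2)) * wInt μ (gegenPoly k (μ + 1 / 2) *
          chordAvg (μ - 1 / 2) (Real.cos (η - ξ)) (Real.sin (η - ξ))
            (gegenPoly k' (μ + 1 / 2))) := by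
  refine integral_ballMeasure_eq hμ (g := fun y => polyEval (ridgePoly μ l k ξ) y *
      polyEval (ridgePoly μ l k' η) y) ((continuous_polyEval _).mul (continuous_polyEval _)) ξ
    (h := fun t u => (gegenPoly k' (μ + 1 / 2)).eval (t * Real.cos (η - ξ) +
      u * √(1 - t ^ 2) * Real.sin (η - ξ))) ?_ ?_
  · intro t ht w hw u
    rw [polyEval_ridgePoly_ballCoord _ _ _ _ _ _ _ (Set.Ioo_subset_Icc_self hw),
      polyEval_ridgePoly_ballCoord _ _ _ _ _ _ _ (Set.Ioo_subset_Icc_self hw), sub_self,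
      Real.cos_zero, Real.sin_zero, eval_gegenPoly, eval_gegenPoly, mul_one, mul_zero, add_zero]
    ring
  · intro t ht
    exact integral_chordAvg (by linarith) _ _ _ (Set.Ioo_subset_Icc_self ht)

theorem integral_ridgePoly_mul_ridgePoly_of_ne {μ : ℝ} (hμ : 0 ≤ μ) (l : ℕ) {k k' : ℕ}
    (hk : k ≠ k') (ξ η : ℝ) :
    ∫ y, polyEval (ridgePoly μ l k ξ) y * polyEval (ridgePoly μ l k' η) y ∂ballMeasure μ = 0 := by
  -- The coordinates are adapted to the factor with the larger index, so that its Gegenbauer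
  -- polynomial in t meets a chord average of smaller degree.
  rcases lt_or_gt_of_ne hk with h | h
  · simp_rw [mul_comm (polyEval (ridgePoly μ l k ξ) _)]
    rw [integral_ridgePoly_mul_ridgePoly hμ, wInt_gegenPoly_mul_chordAvg_of_lt hμ h, mul_zero]
  · rw [integral_ridgePoly_mul_ridgePoly hμ, wInt_gegenPoly_mul_chordAvg_of_lt hμ h, mul_zero]

theorem integral_ridgePoly_mul_ridgePoly_self {μ : ℝ} (hμ : 0 ≤ μ) (l k : ℕ) (ξ η : ℝ) :
    ∫ y, polyEval (ridgePoly μ l k ξ) y * polyEval (ridgePoly μ l k η) y ∂ballMeasure μ =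
      wMass (μ + 1 / 2 + k) * gegenbauerNormSq (l - k) (k + μ + 1) *
        (π / (k + μ + 1 / 2) * gegenbauer k (μ + 1 / 2) (Real.cos (ξ - η))) := by
  rw [integral_ridgePoly_mul_ridgePoly hμ, wInt_gegenPoly_mul_chordAvg_self hμ k
    (Real.cos_sq_add_sin_sq _), ← neg_sub η ξ, Real.cos_neg]
  congr 1
  have h1 := wInt_gegenPoly_mul_self (show 0 < (k : ℝ) + μ + 1 by positivity) (l - k)
  rw [show (k : ℝ) + μ + 1 - 1 / 2 = μ + 1 / 2 + k by ring, ← wInt_one_sub_sq_pow_mul, wInt] at h1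
  rw [← h1]
  refine integral_congr_ae ?_
  filter_upwards [ae_mem_wMeasure (μ + 1 / 2)] with w hw
  rw [← two_mul, sqrt_pow_two_mul (Set.Ioo_subset_Icc_self hw)]
  simp only [eval_mul, eval_pow, eval_sub, eval_one, eval_X, eval_gegenPoly]
  ring

/-! ### Integration of polynomials over the ball -/

theorem polyEval_add (P Q : MvPolynomial (Fin 3) ℝ) (y : E3) :
    polyEval (P + Q) y = polyEval P y + polyEval Q y := map_add _ _ _

theorem polyEval_smul (c : ℝ) (P : MvPolynomial (Fin 3) ℝ) (y : E3) :
    polyEval (c • P) y = c * polyEval P y := by simp [polyEval]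

/-- Integration of a product with a continuous weight, as a functional on polynomials. -/
noncomputable def ballPairing {μ : ℝ} (hμ : 0 ≤ μ) {g : E3 → ℝ} (hg : MemLp g 2 (ballMeasure μ)) :
    MvPolynomial (Fin 3) ℝ →ₗ[ℝ] ℝ where
  toFun P := ∫ y, g y * polyEval P y ∂ballMeasure μ
  map_add' P Q := by
    simp_rw [polyEval_add, mul_add]
    exact integral_add (hg.integrable_mul (memLp_of_continuous hμ (continuous_polyEval P) 2))
      (hg.integrable_mul (memLp_of_continuous hμ (continuous_polyEval Q) 2))
  map_smul' c P := by
    simp_rw [polyEval_smul, mul_left_comm (g _)]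
    exact integral_const_mul _ _

theorem integral_mul_polyEval_eq_zero {μ : ℝ} (hμ : 0 ≤ μ) {g : E3 → ℝ}
    (hg : MemLp g 2 (ballMeasure μ)) {M : Submodule ℝ (MvPolynomial (Fin 3) ℝ)}
    {S : Set (MvPolynomial (Fin 3) ℝ)} (hM : M ≤ Submodule.span ℝ S)
    (hS : ∀ P ∈ S, ∫ y, g y * polyEval P y ∂ballMeasure μ = 0) {P : MvPolynomial (Fin 3) ℝ}
    (hP : P ∈ M) : ∫ y, g y * polyEval P y ∂ballMeasure μ = 0 :=
  (Submodule.span_le (p := LinearMap.ker (ballPairing hμ hg))).2 hS (hM hP)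

theorem integral_ridgeSpan_mul_polyLT {μ : ℝ} (hμ : 0 ≤ μ) {l : ℕ}
    {P R : MvPolynomial (Fin 3) ℝ} (hP : P ∈ ridgeSpan μ l) (hR : R ∈ polyLT l) :
    ∫ y, polyEval R y * polyEval P y ∂ballMeasure μ = 0 := by
  refine integral_mul_polyEval_eq_zero hμ (memLp_of_continuous hμ (continuous_polyEval R) 2)
    (le_refl (ridgeSpan μ l)) ?_ hP
  rintro _ ⟨k, _, ξ, rfl⟩
  simp_rw [mul_comm (polyEval R _)]
  refine integral_mul_polyEval_eq_zero hμ (memLp_of_continuous hμ (continuous_polyEval _) 2)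
    (M := polyLT l) (S := {Q | ∃ a c η, a + c < l ∧ Q = ridge η ^ a * MvPolynomial.X 2 ^ c})
    (polyLT_le fun a c η h => Submodule.subset_span ⟨a, c, η, h, rfl⟩) ?_ hR
  rintro _ ⟨a, c, η, h, rfl⟩
  exact integral_ridgePoly_mul_ridge_pow hμ h ξ η

/-! ### Orthogonal polynomials on the ball are combinations of ridge polynomials -/

/-- The element of `L²(W_μ; B³)` given by a polynomial. -/
noncomputable def polyLp {μ : ℝ} (hμ : 0 ≤ μ) (P : MvPolynomial (Fin 3) ℝ) :
    Lp ℝ 2 (ballMeasure μ) :=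
  (memLp_of_continuous hμ (continuous_polyEval P) 2).toLp _

theorem coeFn_polyLp {μ : ℝ} (hμ : 0 ≤ μ) (P : MvPolynomial (Fin 3) ℝ) :
    polyLp hμ P =ᵐ[ballMeasure μ] polyEval P := MemLp.coeFn_toLp _

theorem inner_polyLp {μ : ℝ} (hμ : 0 ≤ μ) (P : MvPolynomial (Fin 3) ℝ)
    {F : Lp ℝ 2 (ballMeasure μ)} {g : E3 → ℝ} (hF : F =ᵐ[ballMeasure μ] g) :
    inner ℝ (polyLp hμ P) F = ∫ y, g y * polyEval P y ∂ballMeasure μ := by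
  rw [L2.inner_def]
  refine integral_congr_ae ?_
  filter_upwards [hF, coeFn_polyLp hμ P] with y h1 h2
  rw [h1, h2]
  simp

theorem polyLp_mem_orthoPoly {μ : ℝ} (hμ : 0 ≤ μ) {l : ℕ} {P : MvPolynomial (Fin 3) ℝ}
    (hP : P ∈ ridgeSpan μ l) : polyLp hμ P ∈ orthoPoly μ l := by
  refine ⟨⟨P, ridgeSpan_le μ l hP, coeFn_polyLp hμ P⟩, ?_⟩
  rw [SetLike.mem_coe, Submodule.mem_orthogonal']
  rintro G ⟨R, hR, hG⟩
  rw [inner_polyLp hμ P hG]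
  exact integral_ridgeSpan_mul_polyLT hμ hP hR

/-- Write F as an element of the ridge span plus a polynomial R of degree less than l. Both F and
the first part are orthogonal to R, so R has norm zero. -/
theorem exists_mem_ridgeSpan {μ : ℝ} (hμ : 0 ≤ μ) {l : ℕ} {F : Lp ℝ 2 (ballMeasure μ)}
    (hF : F ∈ orthoPoly μ l) : ∃ P ∈ ridgeSpan μ l, F =ᵐ[ballMeasure μ] polyEval P := by
  obtain ⟨⟨P₀, hP₀, h0⟩, hF2⟩ := hF
  obtain ⟨P, hP, R, hR, rfl⟩ := Submodule.mem_sup.1 (polyLT_succ_le hμ l hP₀)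
  refine ⟨P, hP, ?_⟩
  have hRL : polyLp hμ R ∈ polyL2 μ l := ⟨R, hR, coeFn_polyLp hμ R⟩
  have h1 := (Submodule.mem_orthogonal _ _).1 hF2 _ hRL
  have h2 := integral_ridgeSpan_mul_polyLT hμ hP hR
  simp_rw [mul_comm (polyEval R _)] at h2
  rw [← inner_polyLp hμ R (coeFn_polyLp hμ P)] at h2
  have e : F = polyLp hμ P + polyLp hμ R := by
    refine Lp.ext ?_
    filter_upwards [h0, Lp.coeFn_add (polyLp hμ P) (polyLp hμ R), coeFn_polyLp hμ P,
      coeFn_polyLp hμ R] with y a1 a2 a3 a4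
    rw [a1, a2, Pi.add_apply, a3, a4, polyEval_add]
  rw [e, inner_add_right, h2, zero_add, inner_self_eq_zero] at h1
  rw [e, h1, add_zero]
  exact coeFn_polyLp hμ P

theorem exists_ballProj_eq {μ : ℝ} (hμ : 0 ≤ μ) (l : ℕ) {f : E3 → ℝ}
    (hf : MemLp f 2 (ballMeasure μ)) :
    ∃ P ∈ ridgeSpan μ l, (ballProj μ l (hf.toLp f) : E3 → ℝ) =ᵐ[ballMeasure μ] polyEval P ∧
      ∀ Q ∈ ridgeSpan μ l, ∫ y, f y * polyEval Q y ∂ballMeasure μ =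
        ∫ y, polyEval P y * polyEval Q y ∂ballMeasure μ := by
  obtain ⟨P, hP, h⟩ := exists_mem_ridgeSpan hμ
    (F := ballProj μ l (hf.toLp f)) (Submodule.starProjection_apply_mem _ _)
  refine ⟨P, hP, h, fun Q hQ => ?_⟩
  have h1 := Submodule.starProjection_inner_eq_zero (K := orthoPoly μ l) (hf.toLp f) _
    (polyLp_mem_orthoPoly hμ hQ)
  rw [real_inner_comm, inner_sub_right, sub_eq_zero, inner_polyLp hμ Q hf.coeFn_toLp] at h1
  rw [h1]
  exact inner_polyLp hμ Q h

/-! ### The reproducing kernel -/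

/-- The factor of `ridgePoly μ l k ξ` in the kernel. -/
noncomputable def kernelCoeff (μ : ℝ) (l k : ℕ) (ξ : ℝ) (x : E3) : ℝ :=
  ballConst μ * (rising (μ + 2) k / rising (μ + 3 / 2) k *
    ((k + μ + 1 / 2) / (μ + 1 / 2) *
      diskKernel μ k ξ (x 0 / √(1 - x 2 ^ 2)) (x 1 / √(1 - x 2 ^ 2))) * √(1 - x 2 ^ 2) ^ k *
        (gegenbauer (l - k) (k + μ + 1) (x 2) / gegenbauerNormSq (l - k) (k + μ + 1)))

/-- The polynomial that the kernel induces on the ball. -/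
noncomputable def kernelPoly (μ : ℝ) (l : ℕ) (ξ : ℝ) (x : E3) : MvPolynomial (Fin 3) ℝ :=
  ∑ k ∈ Finset.range (l + 1), kernelCoeff μ l k ξ x • ridgePoly μ l k ξ

theorem kernelPoly_mem (μ : ℝ) (l : ℕ) (ξ : ℝ) (x : E3) : kernelPoly μ l ξ x ∈ ridgeSpan μ l :=
  Submodule.sum_mem _ fun _ hk => Submodule.smul_mem _ _
    (ridgePoly_mem μ (Nat.lt_succ_iff.1 (Finset.mem_range.1 hk)) ξ)

/-- Ridge polynomials in the direction ξ are constant along the line with parameters (t, w), which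
is why u is arbitrary. The two square roots of the orthonormal polynomials combine into one squared
norm. -/
theorem kernelG_eq {μ : ℝ} (hμ : 0 ≤ μ) (l : ℕ) (ξ t u : ℝ) (x : E3) {w : ℝ}
    (hw : w ∈ Set.Ioo (-1 : ℝ) 1) :
    kernelG μ l ξ t w x = polyEval (kernelPoly μ l ξ x) (ballCoord ξ ((t, w), u)) := by
  have h1 : polyEval (kernelPoly μ l ξ x) (ballCoord ξ ((t, w), u)) =
      ∑ k ∈ Finset.range (l + 1), kernelCoeff μ l k ξ x *
        polyEval (ridgePoly μ l k ξ) (ballCoord ξ ((t, w), u)) := by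
    simp [polyEval, kernelPoly]
  rw [h1, kernelG, Finset.mul_sum]
  refine Finset.sum_congr rfl fun k _ => ?_
  rw [polyEval_ridgePoly_ballCoord _ _ _ _ _ _ _ (Set.Ioo_subset_Icc_self hw), sub_self,
    Real.cos_zero, Real.sin_zero, mul_one, mul_zero, add_zero, kernelCoeff, diskKernelT,
    gegenbauerON, gegenbauerON]
  have h2 := gegenbauerNormSq_pos (show 0 < (k : ℝ) + μ + 1 by positivity) (l - k)
  have h3 : gegenbauer (l - k) (k + μ + 1) (x 2) / gegenbauerNormSq (l - k) (k + μ + 1) =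
      gegenbauer (l - k) (k + μ + 1) (x 2) / √(gegenbauerNormSq (l - k) (k + μ + 1)) /
        √(gegenbauerNormSq (l - k) (k + μ + 1)) := by
    rw [div_div, Real.mul_self_sqrt h2.le]
  rw [h3]
  ring

/-- The constants a_{μ,3} and h_k² are exactly the reciprocals of the masses in the norms of the
ridge polynomials. -/
theorem ballConst_mul {μ : ℝ} (hμ : 0 ≤ μ) (k : ℕ) :
    ballConst μ * (rising (μ + 2) k / rising (μ + 3 / 2) k) * wMass (μ + 1 / 2 + k) *
      (π / (μ + 1 / 2)) = 1 := by
  rw [wMass_add_nat (by linarith), show μ + 1 / 2 + 1 = μ + 3 / 2 by ring,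
    show μ + 1 / 2 + 3 / 2 = μ + 2 by ring, ballConst, wMass,
    Real.Gamma_add_one (by positivity), show μ + 1 / 2 + 3 / 2 = μ + 2 by ring]
  have r1 := rising_pos (show 0 < μ + 2 by positivity) k
  have r2 := rising_pos (show 0 < μ + 3 / 2 by positivity) k
  have g1 := Real.Gamma_pos_of_pos (show 0 < μ + 1 / 2 by positivity)
  have g2 := Real.Gamma_pos_of_pos (show 0 < μ + 2 by positivity)
  have hp : π ^ (3 / 2 : ℝ) = π * √π := by
    rw [Real.sqrt_eq_rpow, ← Real.rpow_one_add' Real.pi_pos.le (by norm_num)]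
    norm_num
  rw [hp]
  have hm : μ + 1 / 2 ≠ 0 := by positivity
  have := Real.pi_pos
  have : √π ≠ 0 := by positivity
  generalize μ + 1 / 2 = m at *
  generalize rising (μ + 3 / 2) k = R at *
  field_simp

/-- Different indices are orthogonal, so only the k-th term of the kernel contributes, and all its
constants cancel. The dependence on ξ that is left is the one averaged in
`sum_diskKernel_mul_gegenbauer`. -/
theorem integral_ridgePoly_mul_kernelPoly {μ : ℝ} (hμ : 0 ≤ μ) {l k : ℕ} (hk : k ≤ l) (ξ η : ℝ)
    (x : E3) :
    ∫ y, polyEval (ridgePoly μ l k η) y * polyEval (kernelPoly μ l ξ x) y ∂ballMeasure μ =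
      diskKernel μ k ξ (x 0 / √(1 - x 2 ^ 2)) (x 1 / √(1 - x 2 ^ 2)) *
        gegenbauer k (μ + 1 / 2) (Real.cos (ξ - η)) *
          (√(1 - x 2 ^ 2) ^ k * gegenbauer (l - k) (k + μ + 1) (x 2)) := by
  have h1 := map_sum (ballPairing hμ (memLp_of_continuous hμ
    (continuous_polyEval (ridgePoly μ l k η)) 2))
    (fun k => kernelCoeff μ l k ξ x • ridgePoly μ l k ξ) (Finset.range (l + 1))
  refine h1.trans ?_
  rw [Finset.sum_eq_single k]
  · rw [map_smul, smul_eq_mul]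
    have h2 := integral_ridgePoly_mul_ridgePoly_self hμ l k η ξ
    change kernelCoeff μ l k ξ x * ∫ y, polyEval (ridgePoly μ l k η) y *
      polyEval (ridgePoly μ l k ξ) y ∂ballMeasure μ = _
    rw [h2, kernelCoeff, ← neg_sub ξ η, Real.cos_neg]
    have h3 := ballConst_mul hμ k
    have h4 := gegenbauerNormSq_pos (show 0 < (k : ℝ) + μ + 1 by positivity) (l - k)
    have h5 : (k : ℝ) + μ + 1 / 2 ≠ 0 := by positivity
    have h6 : μ + 1 / 2 ≠ 0 := by positivity
    generalize diskKernel μ k ξ (x 0 / √(1 - x 2 ^ 2)) (x 1 / √(1 - x 2 ^ 2)) = D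
    generalize gegenbauerNormSq (l - k) (k + μ + 1) = N at *
    generalize gegenbauer k (μ + 1 / 2) (Real.cos (ξ - η)) = c
    generalize gegenbauer (l - k) (k + μ + 1) (x 2) = g
    generalize √(1 - x 2 ^ 2) ^ k = r
    generalize wMass (μ + 1 / 2 + k) = W at *
    generalize rising (μ + 2) k / rising (μ + 3 / 2) k = h at *
    calc _ = (ballConst μ * h * W * (π / (μ + 1 / 2))) * (D * c * (r * g)) *
          ((N / N) * ((k + μ + 1 / 2) / (k + μ + 1 / 2))) := by ring
      _ = _ := by rw [h3, div_self h4.ne', div_self h5]; ring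
  · intro k' _ hk'
    rw [map_smul, smul_eq_mul]
    change _ * ∫ y, polyEval (ridgePoly μ l k η) y * polyEval (ridgePoly μ l k' ξ) y
      ∂ballMeasure μ = _
    rw [integral_ridgePoly_mul_ridgePoly_of_ne hμ l hk'.symm, mul_zero]
  · intro h
    exact absurd (Finset.mem_range.2 (Nat.lt_succ_of_le hk)) h

theorem sqrt_pow_mul_gegenbauer {x : E3} (hx : x ∈ Metric.closedBall (0 : E3) 1) (k : ℕ)
    (lam η : ℝ) :
    √(1 - x 2 ^ 2) ^ k * gegenbauer k lam
      (x 0 / √(1 - x 2 ^ 2) * Real.cos η + x 1 / √(1 - x 2 ^ 2) * Real.sin η) =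
    homGegenbauer k lam (x 0 * Real.cos η + x 1 * Real.sin η) (1 - x 2 ^ 2) := by
  rw [mem_closedBall_zero_iff, ← sq_le_one_iff₀ (norm_nonneg _), EuclideanSpace.norm_sq_eq,
    Fin.sum_univ_three] at hx
  simp only [Real.norm_eq_abs, sq_abs] at hx
  have h0 : 0 ≤ 1 - x 2 ^ 2 := by nlinarith [sq_nonneg (x 0), sq_nonneg (x 1)]
  rw [← homGegenbauer_mul, Real.sq_sqrt h0]
  congr 1
  -- If x₃ = ±1, the ball forces x₁ = x₂ = 0, so the quotients by zero, which are zero by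
  -- convention, give the right value.
  rcases h0.eq_or_lt with h | h
  · have a0 : x 0 = 0 := by nlinarith [sq_nonneg (x 0), sq_nonneg (x 1)]
    have a1 : x 1 = 0 := by nlinarith [sq_nonneg (x 0), sq_nonneg (x 1)]
    simp [a0, a1]
  · have := Real.sqrt_pos.2 h
    field_simp

/-- The reproducing property of the averaged kernel. Both sides are linear in P, so ridge
polynomials suffice, and for them it is the discrete identity on the disk. -/
theorem sum_integral_mul_kernelPoly {μ : ℝ} (hμ : 0 ≤ μ) {n l M : ℕ} (hl : l ≤ n) (hM : n + 1 ∣ M)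
    {P : MvPolynomial (Fin 3) ℝ} (hP : P ∈ ridgeSpan μ l) {x : E3}
    (hx : x ∈ Metric.closedBall (0 : E3) 1) :
    ∑ ν ∈ Finset.range M, ∫ y, polyEval P y *
      polyEval (kernelPoly μ l (ν * π / (n + 1)) x) y ∂ballMeasure μ = M * polyEval P x := by
  simp_rw [mul_comm (polyEval P _)]
  induction hP using Submodule.span_induction with
  | mem P h =>
    obtain ⟨k, hk, η, rfl⟩ := h
    simp_rw [mul_comm _ (polyEval (ridgePoly μ l k η) _)]
    simp_rw [integral_ridgePoly_mul_kernelPoly hμ hk]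
    rw [← Finset.sum_mul, sum_diskKernel_mul_gegenbauer hμ hM (hk.trans hl), polyEval_ridgePoly,
      ← sqrt_pow_mul_gegenbauer hx]
    ring
  | zero => simp [polyEval]
  | add P Q _ _ hP hQ =>
    rw [polyEval_add, mul_add, ← hP, ← hQ, ← Finset.sum_add_distrib]
    exact Finset.sum_congr rfl fun ν _ => (ballPairing hμ (memLp_of_continuous hμ
      (continuous_polyEval (kernelPoly μ l (ν * π / (n + 1)) x)) 2)).map_add P Q
  | smul c P _ hP =>
    rw [polyEval_smul, mul_left_comm, ← hP, Finset.mul_sum]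
    exact Finset.sum_congr rfl fun ν _ => (ballPairing hμ (memLp_of_continuous hμ
      (continuous_polyEval (kernelPoly μ l (ν * π / (n + 1)) x)) 2)).map_smul c P

end BallRadon

/-! ### The projection formulas -/

open BallRadon
theorem proposition4p4 (μ : ℝ) (hμ : 0 ≤ μ) (n l : ℕ) (hl : l ≤ n)
    (f : E3 → ℝ) (hf : MemLp f 2 (ballMeasure μ)) :
    -- the attenuated Radon projections and the double integrals of the formulas exist
    (∀ ξ : ℝ, ∀ᵐ p : ℝ × ℝ ∂(volume.restrict (Set.Icc (-1) 1 ×ˢ Set.Icc (-1) 1)),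
      IntegrableOn (fun s => f (linePoint ξ p.1 p.2 s) * ballWeight μ (linePoint ξ p.1 p.2 s))
        (BallRadon.segment ξ p.1 p.2)) ∧
    (∀ ξ : ℝ, ∀ x ∈ Metric.closedBall (0 : E3) 1,
      IntegrableOn (fun p : ℝ × ℝ => radonIntegrand μ l f ξ x p.1 p.2)
        (Set.Icc (-1) 1 ×ˢ Set.Icc (-1) 1)) ∧
    -- the projection of `f` is a polynomial, whose values on the ball are given by both formulas
    ∃ P : MvPolynomial (Fin 3) ℝ,
      (ballProj μ l (hf.toLp f) : E3 → ℝ) =ᵐ[ballMeasure μ] polyEval P ∧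
      ∀ x ∈ Metric.closedBall (0 : E3) 1,
        polyEval P x = 1 / (n + 1) * ∑ ν ∈ Finset.range (n + 1),
          ∫ w in (-1 : ℝ)..1, ∫ t in (-1 : ℝ)..1,
            radonIntegrand μ l f (ν * π / (n + 1)) x t w ∧
        polyEval P x = 1 / (2 * n + 2) * ∑ ν ∈ Finset.range (2 * n + 2),
          ∫ w in (-1 : ℝ)..1, ∫ t in (-1 : ℝ)..1,
            radonIntegrand μ l f (ν * π / (n + 1)) x t w := by
  have := isFiniteMeasure_ballMeasure hμ
  have hfi : Integrable f (ballMeasure μ) := hf.integrable (by norm_num)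
  have hI := fun ξ x => integral_radonIntegrand hμ hfi l ξ x
    (continuous_polyEval (kernelPoly μ l ξ x)) fun t _ w hw u => kernelG_eq hμ l ξ t u x hw
  refine ⟨ae_integrableOn_segment hμ hfi, fun ξ x _ => (hI ξ x).1, ?_⟩
  obtain ⟨P, hP, hproj, hint⟩ := exists_ballProj_eq hμ l hf
  refine ⟨P, hproj, fun x hx => ?_⟩
  -- Both formulas are the cases M = n + 1 and M = 2n + 2. Since the kernel polynomial lies in the
  -- ridge span, f may be replaced by its projection P before the reproducing property is applied.
  have key : ∀ M : ℕ, n + 1 ∣ M → ∑ ν ∈ Finset.range M, ∫ w in (-1 : ℝ)..1, ∫ t in (-1 : ℝ)..1,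
      radonIntegrand μ l f (ν * π / (n + 1)) x t w = M * polyEval P x := by
    intro M hM
    rw [← sum_integral_mul_kernelPoly hμ hl hM hP hx]
    exact Finset.sum_congr rfl fun ν _ => (hI _ x).2.trans (hint _ (kernelPoly_mem _ _ _ _))
  constructor
  · rw [key _ dvd_rfl]
    push_cast
    field_simp
  · rw [key _ ⟨2, by ring⟩]
    push_cast
    field_simp
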